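/- **Setting.** Let $n\ge 1$ and equip $\mathbb R^n$ with the supremum norm $|x|=\max_i|x_i|$; $Q(x,t)$ denotes the closed cube with centre $x$, sidelength $t$ and sides parallel to the axes. Let $\Omega\subsetneq\mathbb R^n$ be a strongly Lipschitz domain: a non-empty proper open connected set whose boundary is covered by finitely many open sets, in each of which $\Omega$ coincides with the region above a rotated graph of a Lipschitz function, at most one of the resulting boundary parts being unbounded. Put $\operatorname{diam}(\Omega)=\sup\{|x-y|:x,y\in\Omega\}\in(0,\infty]$ and $d_\Omega=2\operatorname{diam}(\Omega)$. Let $A:\mathbb R^n\to M_n(\mathbb C)$ be measurable and elliptic: for some $\delta\in(0,1]$, $|A(x)\xi\cdot\overline\eta|\le\delta^{-1}|\xi||\eta|$ for almost every $x$ and all $\xi,\eta\in\mathbb C^n$, and $\Re(A(x)\xi\cdot\overline\xi)\ge\delta|\xi|^2$ for all $x$ and $\xi$. Let $L=-\mathrm{div}(A\nabla)$ be the operator on $L^2(\Omega)$ (complex-valued functions) with the Dirichlet boundary condition: with $V=W^{1,2}_0(\Omega)$, the closure of $C_c^\infty(\Omega)$ in $W^{1,2}(\Omega)$, one has $u\in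 D(L)$ and $Lu=w\in L^2(\Omega)$ if and only if $u\in V$ and $\int_\Omega A\nabla u\cdot\overline{\nabla g}\,dx=\int_\Omega w\,\overline g\,dx$ for all $g\in V$. Let $\{e^{-tL}\}_{t\ge0}$ be the semigroup on $L^2(\Omega)$ with generator $-L$. Assume that it has the Gaussian property $(G_{\operatorname{diam}(\Omega)})$ with exponent $\mu\in(0,1]$: for every $t\in(0,\operatorname{diam}(\Omega))$ the operator $e^{-tL}$ has a measurable kernel $K_t$ on $\Omega\times\Omega$, and there are constants $C,\alpha>0$ such that for all such $t$ and all $x,y,y_1,y_2\in\Omega$, $$|K_t(x,y)|\le \frac{C}{t^{n/2}}e^{-\alpha|x-y|^2/t},\qquad |K_t(x,y_1)-K_t(x,y_2)|+|K_t(y_1,x)-K_t(y_2,x)|\le\frac{C}{t^{n/2}}\,\frac{|y_1-y_2|^\mu}{t^{\mu/2}}.$$ (In particular, for $f\in L^2(\Omega)$ and $t>0$, $e^{-tL}f$ has a continuous representative on $\Omega$, which is used below.) Let $\Phi:(0,\infty)\to(0,\infty)$ be continuous, strictly increasing, subadditive and of upper type $1$ (there is $C>0$ with $\Phi(st)\le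 Ct\,\Phi(s)$ for all $t\ge1$, $s>0$), and suppose that $$p_\Phi:=\sup\{p>0:\ \Phi(st)\le t^p\Phi(s)\ \text{for all } t\in(0,1),\ s>0\}\in\Bigl(\frac n{n+\mu},1\Bigr].$$ Extend $\Phi$ by $\Phi(0)=0$, $\Phi(\infty)=\infty$. A measurable function $g:\Omega\to[0,\infty]$ belongs to $L^\Phi(\Omega)$ if $\int_\Omega\Phi(g)\,dx<\infty$, and $\|g\|_{L^\Phi(\Omega)}:=\inf\{\lambda>0:\int_\Omega\Phi(g/\lambda)\,dx\le1\}$. For $f\in L^2(\Omega)$ and $x\in\Omega$ let $$\mathcal N_h(f)(x)=\sup_{y\in\Omega,\ t\in(0,d_\Omega),\ |y-x|<t}|e^{-t^2L}f(y)|,\qquad \widetilde S_h(f)(x)=\Bigl\{\int_{\Gamma(x)}|t\nabla e^{-t^2L}f(y)|^2\frac{dy\,dt}{t\,|Q(x,t)\cap\Omega|}\Bigr\}^{1/2},$$ where $\Gamma(x)=\{(y,t)\in\Omega\times(0,d_\Omega):|y-x|<t\}$. Write $f\in H_{\Phi,\mathcal N_h}(\Omega)\cap L^2(\Omega)$ if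 $f\in L^2(\Omega)$ and $\mathcal N_h(f)\in L^\Phi(\Omega)$, and put $\|f\|_{H_{\Phi,\mathcal N_h}(\Omega)}=\|\mathcal N_h(f)\|_{L^\Phi(\Omega)}$. **Proposition 3.2.** There exists a constant $C\in(0,\infty)$, independent of $f$, such that for all $f\in H_{\Phi,\mathcal N_h}(\Omega)\cap L^2(\Omega)$ one has $\widetilde S_h(f)\in L^\Phi(\Omega)$ and $$\bigl\|\widetilde S_h(f)\bigr\|_{L^\Phi(\Omega)}\le C\,\|f\|_{H_{\Phi,\mathcal N_h}(\Omega)}.$$ -/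

import Mathlib

open MeasureTheory Filter Set
open scoped ENNReal NNReal Topology ContDiff Matrix

noncomputable section

namespace OrliczHardy

/-! ### The domain

`ℝⁿ` is `Fin n → ℝ`; its norm in Mathlib is the supremum norm, so `Metric.ball x t` and
`Metric.closedBall x (t / 2)` are cubes with sides parallel to the axes, and `Metric.ediam` is the
diameter for the supremum norm. -/

/-- The open epigraph `{x : (O x)_k > φ((O x)_j, j ≠ k)}` of a function `φ` of `n - 1` variables,
in the coordinates rotated by the matrix `O`, the `k`-th one being the vertical one. -/
def rotatedEpigraph {n : ℕ} (O : Matrix (Fin n) (Fin n) ℝ) (k : Fin n)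
    (φ : ({j : Fin n // j ≠ k} → ℝ) → ℝ) : Set (Fin n → ℝ) :=
  {x | φ (fun j => (O *ᵥ x) j) < (O *ᵥ x) k}

/-- Strongly Lipschitz domain: a proper open connected subset of `ℝⁿ` whose boundary is covered by
finitely many open sets `U i`, in each of which the domain is the part lying above a rotated
graph of a Lipschitz function; at most one of the boundary parts is unbounded. -/
structure IsStronglyLipschitzDomain {n : ℕ} (Ω : Set (Fin n → ℝ)) : Prop where
  isOpen : IsOpen Ω
  isConnected : IsConnected Ω
  ne_univ : Ω ≠ univ
  boundary : ∃ (m : ℕ) (U : Fin m → Set (Fin n → ℝ)),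
    (∀ i, IsOpen (U i)) ∧ frontier Ω ⊆ ⋃ i, U i ∧
    (∀ i, ∃ O ∈ Matrix.orthogonalGroup (Fin n) ℝ, ∃ (k : Fin n)
      (φ : ({j : Fin n // j ≠ k} → ℝ) → ℝ) (K : ℝ≥0),
      LipschitzWith K φ ∧ Ω ∩ U i = rotatedEpigraph O k φ ∩ U i) ∧
    (∀ i j, ¬ Bornology.IsBounded (frontier Ω ∩ U i) →
      ¬ Bornology.IsBounded (frontier Ω ∩ U j) → i = j)

/-- `d_Ω = 2 diam Ω`, an element of `[0, ∞]`. -/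
def dOmega {n : ℕ} (Ω : Set (Fin n → ℝ)) : ℝ≥0∞ := 2 * Metric.ediam Ω

/-! ### Sobolev spaces -/

/-- `L²(Ω)`, complex valued. -/
abbrev L2 {n : ℕ} (Ω : Set (Fin n → ℝ)) : Type :=
  Lp ℂ 2 (volume.restrict Ω)

/-- `L²(Ω; ℂⁿ)`, with the Euclidean norm on `ℂⁿ`. -/
abbrev L2Vec {n : ℕ} (Ω : Set (Fin n → ℝ)) : Type :=
  Lp (EuclideanSpace ℂ (Fin n)) 2 (volume.restrict Ω)

/-- `φ ∈ C_c^∞(Ω)`, complex valued. -/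
structure IsTestFunction {n : ℕ} (Ω : Set (Fin n → ℝ)) (φ : (Fin n → ℝ) → ℂ) : Prop where
  contDiff : ContDiff ℝ ∞ φ
  hasCompactSupport : HasCompactSupport φ
  tsupport_subset : tsupport φ ⊆ Ω

/-- The classical gradient of a function. -/
def classicalGrad {n : ℕ} (φ : (Fin n → ℝ) → ℂ) (x : Fin n → ℝ) : EuclideanSpace ℂ (Fin n) :=
  WithLp.toLp 2 (fun i => fderiv ℝ φ x (Pi.single i 1))

/-- `G` is the distributional gradient of `u` on `Ω`. -/
def IsWeakGradient {n : ℕ} {Ω : Set (Fin n → ℝ)} (u : L2 Ω) (G : L2Vec Ω) : Prop :=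
  ∀ φ : (Fin n → ℝ) → ℂ, IsTestFunction Ω φ → ∀ i : Fin n,
    ∫ x in Ω, u x * classicalGrad φ x i = - ∫ x in Ω, G x i * φ x

/-- `W^{1,2}(Ω)` as a subset of `L²(Ω)`. -/
def sobolevW {n : ℕ} (Ω : Set (Fin n → ℝ)) : Set (L2 Ω) :=
  {u | ∃ G : L2Vec Ω, IsWeakGradient u G}

open Classical in
/-- The distributional gradient `∇u` of `u ∈ W^{1,2}(Ω)` (zero if `u ∉ W^{1,2}(Ω)`). -/
def weakGrad {n : ℕ} {Ω : Set (Fin n → ℝ)} (u : L2 Ω) : L2Vec Ω :=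
  if h : ∃ G : L2Vec Ω, IsWeakGradient u G then h.choose else 0

/-- `W_0^{1,2}(Ω)`: the closure of `C_c^∞(Ω)` in `W^{1,2}(Ω)`. -/
def sobolevW0 {n : ℕ} (Ω : Set (Fin n → ℝ)) : Set (L2 Ω) :=
  {u | u ∈ sobolevW Ω ∧ ∀ ε : ℝ≥0∞, 0 < ε → ∃ φ : (Fin n → ℝ) → ℂ, IsTestFunction Ω φ ∧
    eLpNorm (fun x => u x - φ x) 2 (volume.restrict Ω) +
      eLpNorm (fun x => weakGrad u x - classicalGrad φ x) 2 (volume.restrict Ω) < ε}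

/-! ### The operator and its semigroup -/

/-- The ellipticity class `𝒜(δ)`. -/
structure IsElliptic {n : ℕ} (δ : ℝ) (A : (Fin n → ℝ) → Matrix (Fin n) (Fin n) ℂ) : Prop where
  measurable : ∀ i j, Measurable fun x => A x i j
  bounded : ∀ᵐ x, ∀ ξ η : EuclideanSpace ℂ (Fin n), ‖ξ‖ = 1 → ‖η‖ = 1 →
    ‖(A x *ᵥ ξ.ofLp) ⬝ᵥ star η.ofLp‖ ≤ δ⁻¹
  coercive : ∀ x, ∀ ξ : EuclideanSpace ℂ (Fin n),
    δ * ‖ξ‖ ^ 2 ≤ ((A x *ᵥ ξ.ofLp) ⬝ᵥ star ξ.ofLp).re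

/-- The graph of the operator `L = -div(A∇)` with form domain `V`, largest possible domain: `u`
is in `D(L)` and `Lu = w` if and only if `u ∈ V` and
`∫_Ω A∇u · conj(∇g) = ⟨w, g⟩` for all `g ∈ V`. -/
def IsDivFormOperator {n : ℕ} {Ω : Set (Fin n → ℝ)} (A : (Fin n → ℝ) → Matrix (Fin n) (Fin n) ℂ)
    (V : Set (L2 Ω)) (u w : L2 Ω) : Prop :=
  u ∈ V ∧ ∀ g ∈ V,
    ∫ x in Ω, (A x *ᵥ (weakGrad u x).ofLp) ⬝ᵥ star (weakGrad g x).ofLp =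
      ∫ x in Ω, w x * star (g x)

/-- `T` (of which only the times `t ≥ 0` matter) is the strongly continuous semigroup of bounded
operators whose generator is `-L`, the operator `L` being given by its graph. -/
structure IsSemigroupGeneratedByNeg {X : Type*} [NormedAddCommGroup X] [NormedSpace ℂ X]
    (L : X → X → Prop) (T : ℝ → X →L[ℂ] X) : Prop where
  zero : T 0 = ContinuousLinearMap.id ℂ X
  add : ∀ s t : ℝ, 0 ≤ s → 0 ≤ t → T (s + t) = (T s).comp (T t)
  continuous : ∀ f : X, ContinuousOn (fun t : ℝ => T t f) (Ici 0)
  generator : ∀ u w : X, L u w ↔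
    Tendsto (fun t : ℝ => ((t⁻¹ : ℝ) : ℂ) • (T t u - u)) (𝓝[>] 0) (𝓝 (-w))

open Classical in
/-- The semigroup `e^{-tL}`, `t ≥ 0`, on `L²(Ω)`, where `L = -div(A∇)` satisfies the Dirichlet
boundary condition, that is, has form domain `W_0^{1,2}(Ω)`. For elliptic `A` this semigroup
exists and its values at `t ≥ 0` are unique. -/
def heatSemigroup {n : ℕ} (Ω : Set (Fin n → ℝ)) (A : (Fin n → ℝ) → Matrix (Fin n) (Fin n) ℂ) :
    ℝ → L2 Ω →L[ℂ] L2 Ω :=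
  if h : ∃ T : ℝ → L2 Ω →L[ℂ] L2 Ω,
      IsSemigroupGeneratedByNeg (IsDivFormOperator A (sobolevW0 Ω)) T
  then h.choose else 0

/-- The Gaussian property `(G_β)`, with Hölder exponent `μ`, of a family `T t = e^{-tL}` of
operators on `L²(Ω)`: for `t ∈ (0, β)` the operator `T t` has a kernel `K t` with Gaussian bounds
which is Hölder continuous in each variable. -/
def HasGaussianProperty {n : ℕ} {Ω : Set (Fin n → ℝ)} (T : ℝ → L2 Ω →L[ℂ] L2 Ω)
    (β : ℝ≥0∞) (μ : ℝ) : Prop :=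
  ∃ K : ℝ → (Fin n → ℝ) → (Fin n → ℝ) → ℂ,
    (∀ t : ℝ, 0 < t → ENNReal.ofReal t < β →
      Measurable (fun p : Ω × Ω => K t p.1 p.2) ∧
      ∀ f : L2 Ω, ∀ᵐ x ∂(volume.restrict Ω), T t f x = ∫ y in Ω, K t x y * f y) ∧
    (∃ C > 0, ∃ α > 0, ∀ t : ℝ, 0 < t → ENNReal.ofReal t < β → ∀ x ∈ Ω, ∀ y ∈ Ω,
      ‖K t x y‖ ≤ C / t ^ ((n : ℝ) / 2) * Real.exp (-α * ‖x - y‖ ^ 2 / t)) ∧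
    (∃ C > 0, ∀ t : ℝ, 0 < t → ENNReal.ofReal t < β → ∀ x ∈ Ω, ∀ y₁ ∈ Ω, ∀ y₂ ∈ Ω,
      ‖K t x y₁ - K t x y₂‖ + ‖K t y₁ x - K t y₂ x‖ ≤
        C / t ^ ((n : ℝ) / 2) * (‖y₁ - y₂‖ ^ μ / t ^ (μ / 2)))

/-! ### Orlicz functions and Orlicz norms -/

/-- The strictly critical lower type index
`p_Φ = sup {p > 0 : Φ(st) ≤ t^p Φ(s) for all t ∈ (0,1), s > 0}`. -/
def criticalLowerType (Φ : ℝ → ℝ) : ℝ :=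
  sSup {p : ℝ | 0 < p ∧ ∀ t s : ℝ, 0 < t → t < 1 → 0 < s → Φ (s * t) ≤ t ^ p * Φ s}

/-- The standing assumptions on `Φ : (0, ∞) → (0, ∞)` (only the values on `(0, ∞)` matter). -/
structure AssumptionA (n : ℕ) (μ : ℝ) (Φ : ℝ → ℝ) : Prop where
  pos : ∀ s, 0 < s → 0 < Φ s
  upperType : ∃ C > 0, ∀ t s : ℝ, 1 ≤ t → 0 < s → Φ (s * t) ≤ C * t * Φ s
  lt_criticalLowerType : (n : ℝ) / (n + μ) < criticalLowerType Φ
  criticalLowerType_le : criticalLowerType Φ ≤ 1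
  continuousOn : ContinuousOn Φ (Ioi 0)
  strictMonoOn : StrictMonoOn Φ (Ioi 0)
  subadditive : ∀ s t : ℝ, 0 < s → 0 < t → Φ (s + t) ≤ Φ s + Φ t

open Classical in
/-- The extension of `Φ` to `[0, ∞]` by `Φ(0) = 0` and `Φ(∞) = ∞`, its limits at the endpoints. -/
def extendPhi (Φ : ℝ → ℝ) (a : ℝ≥0∞) : ℝ≥0∞ :=
  if a = 0 then 0 else if a = ⊤ then ⊤ else ENNReal.ofReal (Φ a.toReal)

/-- A nonnegative function `g` belongs to `L^Φ(Ω)`. -/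
def MemOrlicz {n : ℕ} (Φ : ℝ → ℝ) (Ω : Set (Fin n → ℝ)) (g : (Fin n → ℝ) → ℝ≥0∞) : Prop :=
  AEMeasurable g (volume.restrict Ω) ∧ ∫⁻ x in Ω, extendPhi Φ (g x) < ⊤

/-- `‖g‖_{L^Φ(Ω)} = inf {λ > 0 : ∫_Ω Φ(g/λ) ≤ 1}` for a nonnegative function `g`. -/
def orliczNorm {n : ℕ} (Φ : ℝ → ℝ) (Ω : Set (Fin n → ℝ)) (g : (Fin n → ℝ) → ℝ≥0∞) : ℝ≥0∞ :=
  ⨅ (l : ℝ) (_ : 0 < l ∧ ∫⁻ x in Ω, extendPhi Φ (g x / ENNReal.ofReal l) ≤ 1), ENNReal.ofReal l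

/-! ### The nontangential maximal function and the area function -/

open Classical in
/-- The continuous representative on `Ω` of a class `u` (unique on `Ω` when it exists; it exists
for `u = e^{-tL} f`, `t > 0`, under the Gaussian property). It gives `e^{-tL} f (y)` its meaning
at every point `y ∈ Ω`. -/
def contRep {n : ℕ} {Ω : Set (Fin n → ℝ)} (u : L2 Ω) : (Fin n → ℝ) → ℂ :=
  if h : ∃ g : (Fin n → ℝ) → ℂ, ContinuousOn g Ω ∧ u =ᵐ[volume.restrict Ω] g
  then h.choose else u

/-- `𝒩_h f (x) = sup {|e^{-t²L} f (y)| : y ∈ Ω, t ∈ (0, 2 diam Ω), |y - x| < t}`. -/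
def maximalFn {n : ℕ} {Ω : Set (Fin n → ℝ)} (A : (Fin n → ℝ) → Matrix (Fin n) (Fin n) ℂ)
    (f : L2 Ω) (x : Fin n → ℝ) : ℝ≥0∞ :=
  ⨆ (y : Fin n → ℝ) (t : ℝ) (_ : y ∈ Ω ∧ 0 < t ∧ ENNReal.ofReal t < dOmega Ω ∧ ‖y - x‖ < t),
    ‖contRep (heatSemigroup Ω A (t ^ 2) f) y‖ₑ

/-- `S̃_h f (x) = (∫_{Γ(x)} |t ∇e^{-t²L} f (y)|² dy dt / (t |Q(x,t) ∩ Ω|))^{1/2}`, where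
`Γ(x) = {(y,t) : y ∈ Ω, 0 < t < 2 diam Ω, |y - x| < t}` and `Q(x,t)` is the closed cube with centre
`x` and sidelength `t`. The integral over the cone is written as an iterated one. -/
def areaFn {n : ℕ} {Ω : Set (Fin n → ℝ)} (A : (Fin n → ℝ) → Matrix (Fin n) (Fin n) ℂ)
    (f : L2 Ω) (x : Fin n → ℝ) : ℝ≥0∞ :=
  (∫⁻ t in {t : ℝ | 0 < t ∧ ENNReal.ofReal t < dOmega Ω},
    ∫⁻ y in Ω ∩ Metric.ball x t,
      ‖t • weakGrad (heatSemigroup Ω A (t ^ 2) f) y‖ₑ ^ 2 /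
        (ENNReal.ofReal t * volume (Metric.closedBall x (t / 2) ∩ Ω))) ^ (1 / 2 : ℝ)

/-- `f ∈ H_{Φ,𝒩_h}(Ω) ∩ L²(Ω)`, that is, `f ∈ L²(Ω)` and `𝒩_h f ∈ L^Φ(Ω)`. -/
def MemHardy {n : ℕ} {Ω : Set (Fin n → ℝ)} (Φ : ℝ → ℝ)
    (A : (Fin n → ℝ) → Matrix (Fin n) (Fin n) ℂ) (f : L2 Ω) : Prop :=
  MemOrlicz Φ Ω (maximalFn A f)

/-- `‖f‖_{H_{Φ,𝒩_h}(Ω)} = ‖𝒩_h f‖_{L^Φ(Ω)}`. -/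
def hardyNorm {n : ℕ} {Ω : Set (Fin n → ℝ)} (Φ : ℝ → ℝ)
    (A : (Fin n → ℝ) → Matrix (Fin n) (Fin n) ℂ) (f : L2 Ω) : ℝ≥0∞ :=
  orliczNorm Φ Ω (maximalFn A f)

end OrliczHardy

end

/-! The proof compares the distribution functions of the area function S and the maximal function N,
both built from u(y,t) = e^{-t²L} f(y). At every finite level Λ > 0 it establishes |{S > Λ}| ≤ C
(|{N > Λ}| + Λ⁻² ∫_{N ≤ Λ} N²) (`volume_lt_areaFn_le`). Integrating this against dΦ(Λ) gives ∫ Φ(S)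
≤ K ∫ Φ(N): positive lower type handles the first term, and upper type 1 < 2 handles the second
(`AssumptionA.exists_lintegral_le`). The constant K in this modular inequality becomes a norm
constant because Φ(s / 2^j) ≤ q^j Φ(s) for some q < 1.

For the level-set inequality, remove from Ω every ball B(y, 4t) with |u(y,t)| > Λ and call the
remainder E. A Vitali covering shows |Ω \ E| ≤ C |{N > Λ}| (`volume_inter_shadow_le`). On the
sawtooth region {(y,t) : dist(y, E) < 4t} one has |u| ≤ Λ, so a Caccioppoli argument bounds the
energy of ∇u on the narrower sawtooth {dist(y, E) < t} by C (Λ² |Ω \ E| + ∫_E N²)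
(`sawtooth_estimate`). Fubini identifies this energy, up to a constant, with an upper bound for ∫_E
S² (`lintegral_areaFn_sq_le`), and Chebyshev concludes.

The sawtooth estimate uses cutoffs that are constant in time on dyadic blocks. On each block,
`energy_inequality` is the integral of d/ds ‖χ e^{-sL} f‖² ≤ -δ ‖χ∇e^{-sL} f‖² + (4/δ³) ‖ |∇χ|
e^{-sL} f‖². The errors, from ∇χ and from changing the cutoff between blocks, live on annuli around
E that are disjoint and contained in Ω \ E, so they sum to a multiple of Λ² |Ω \ E|.

Both the Vitali argument and the Fubini argument need |B(x,t) ∩ Ω| ≥ c tⁿ for x ∈ Ω and t < d_Ω,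
which is the one place where the Lipschitz geometry enters
(`IsStronglyLipschitzDomain.exists_density`). -/

noncomputable section

namespace OrliczHardy

open scoped Pointwise

/-! ### Measure density of strongly Lipschitz domains -/

section Density

variable {n : ℕ}

/-- A convex set that meets `Ω` but not its boundary is contained in `Ω`. -/
lemma subset_of_convex_of_disjoint_frontier {Ω s : Set (Fin n → ℝ)} (hΩ : IsOpen Ω)
    (hs : Convex ℝ s) (hm : (s ∩ Ω).Nonempty) (hd : Disjoint s (frontier Ω)) : s ⊆ Ω := by
  refine hs.isPreconnected.subset_of_closure_inter_subset hΩ hm fun z hz => ?_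
  by_contra h
  exact hd.le_bot ⟨hz.2, by rw [hΩ.frontier_eq]; exact ⟨hz.1, h⟩⟩

/-- The open cone of directions that stay strictly above a rotated graph of a `K`-Lipschitz
function. -/
def upCone (O : Matrix (Fin n) (Fin n) ℝ) (k : Fin n) (K : ℝ≥0) : Set (Fin n → ℝ) :=
  {v | K * ‖fun j : {j : Fin n // j ≠ k} => (O *ᵥ v) j‖ < (O *ᵥ v) k}

lemma continuous_mulVec (O : Matrix (Fin n) (Fin n) ℝ) : Continuous fun v => O *ᵥ v :=
  Continuous.matrix_mulVec continuous_const continuous_id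

lemma isOpen_upCone (O : Matrix (Fin n) (Fin n) ℝ) (k : Fin n) (K : ℝ≥0) :
    IsOpen (upCone O k K) := by
  have h := continuous_mulVec O
  refine isOpen_lt (continuous_const.mul ?_) ((continuous_apply k).comp h)
  exact (continuous_pi fun j : {j : Fin n // j ≠ k} => (continuous_apply j.1).comp h).norm

lemma smul_mem_upCone {O : Matrix (Fin n) (Fin n) ℝ} {k : Fin n} {K : ℝ≥0} {v : Fin n → ℝ}
    (hv : v ∈ upCone O k K) {a : ℝ} (ha : 0 < a) : a • v ∈ upCone O k K := by
  have e : (fun j : {j : Fin n // j ≠ k} => (O *ᵥ (a • v)) j) =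
      a • fun j : {j : Fin n // j ≠ k} => (O *ᵥ v) j := by
    ext j; simp [Matrix.mulVec_smul]
  simp only [upCone, mem_ofPred_eq] at hv ⊢
  rw [e, norm_smul, Matrix.mulVec_smul, Real.norm_of_nonneg ha.le, Pi.smul_apply, smul_eq_mul]
  nlinarith

lemma add_mem_upCone {O : Matrix (Fin n) (Fin n) ℝ} {k : Fin n} {K : ℝ≥0} {v w : Fin n → ℝ}
    (hv : v ∈ upCone O k K) (hw : w ∈ upCone O k K) : v + w ∈ upCone O k K := by
  have e : (fun j : {j : Fin n // j ≠ k} => (O *ᵥ (v + w)) j) =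
      (fun j : {j : Fin n // j ≠ k} => (O *ᵥ v) j) +
        fun j : {j : Fin n // j ≠ k} => (O *ᵥ w) j := by
    ext j; simp [Matrix.mulVec_add]
  simp only [upCone, mem_ofPred_eq] at hv hw ⊢
  rw [e, Matrix.mulVec_add, Pi.add_apply]
  have := norm_add_le (fun j : {j : Fin n // j ≠ k} => (O *ᵥ v) j)
    (fun j : {j : Fin n // j ≠ k} => (O *ᵥ w) j)
  have hK : (0 : ℝ) ≤ K := K.2
  nlinarith

lemma upCone_nonempty {O : Matrix (Fin n) (Fin n) ℝ}
    (hO : O ∈ Matrix.orthogonalGroup (Fin n) ℝ) (k : Fin n) (K : ℝ≥0) :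
    (upCone O k K).Nonempty := by
  refine ⟨star O *ᵥ Pi.single k 1, ?_⟩
  have e : O *ᵥ (star O *ᵥ Pi.single k 1) = Pi.single k 1 := by
    rw [Matrix.mulVec_mulVec, (Matrix.mem_unitaryGroup_iff).1 hO, Matrix.one_mulVec]
  have e2 : (fun j : {j : Fin n // j ≠ k} => (Pi.single k 1 : Fin n → ℝ) j) = 0 := by
    ext j; simp [j.2]
  simp only [upCone, mem_ofPred_eq, e, e2]
  simp

lemma convex_upCone (O : Matrix (Fin n) (Fin n) ℝ) (k : Fin n) (K : ℝ≥0) :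
    Convex ℝ (upCone O k K) := by
  rw [convex_iff_forall_pos]
  intro x hx y hy a b ha hb _
  exact add_mem_upCone (smul_mem_upCone hx ha) (smul_mem_upCone hy hb)

/-- The set of points on a rotated graph. -/
def rotatedGraph (O : Matrix (Fin n) (Fin n) ℝ) (k : Fin n)
    (φ : ({j : Fin n // j ≠ k} → ℝ) → ℝ) : Set (Fin n → ℝ) :=
  {x | φ (fun j => (O *ᵥ x) j) = (O *ᵥ x) k}

/-- From a point on or above the graph, a cone vector raises the vertical coordinate by more than K
times the horizontal displacement, while φ can rise by at most that amount. -/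
lemma add_notMem_rotatedGraph {O : Matrix (Fin n) (Fin n) ℝ} {k : Fin n}
    {φ : ({j : Fin n // j ≠ k} → ℝ) → ℝ} {K : ℝ≥0} (hφ : LipschitzWith K φ) {x v : Fin n → ℝ}
    (hx : φ (fun j => (O *ᵥ x) j) ≤ (O *ᵥ x) k) (hv : v ∈ upCone O k K) :
    x + v ∉ rotatedGraph O k φ := by
  intro h
  simp only [upCone, rotatedGraph, mem_ofPred_eq, Matrix.mulVec_add] at hv h
  have := hφ.dist_le_mul (fun j => (O *ᵥ x + O *ᵥ v) j) (fun j => (O *ᵥ x) j)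
  have e : (fun j : {j : Fin n // j ≠ k} => (O *ᵥ x + O *ᵥ v) j) -
      (fun j : {j : Fin n // j ≠ k} => (O *ᵥ x) j) =
      fun j : {j : Fin n // j ≠ k} => (O *ᵥ v) j := by ext j; simp
  rw [dist_eq_norm, dist_eq_norm, e, Real.norm_eq_abs] at this
  have := (le_abs_self _).trans this
  simp only [Pi.add_apply] at *
  linarith

/-- The reflection x ↦ -x turns φ into y ↦ -φ(-y), which is again K-Lipschitz, and exchanges the two
sides of the graph. -/
lemma sub_notMem_rotatedGraph {O : Matrix (Fin n) (Fin n) ℝ} {k : Fin n}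
    {φ : ({j : Fin n // j ≠ k} → ℝ) → ℝ} {K : ℝ≥0} (hφ : LipschitzWith K φ) {x v : Fin n → ℝ}
    (hx : (O *ᵥ x) k ≤ φ (fun j => (O *ᵥ x) j)) (hv : v ∈ upCone O k K) :
    x - v ∉ rotatedGraph O k φ := by
  intro h
  refine add_notMem_rotatedGraph (O := O) (k := k) (φ := fun y => - φ (-y)) (K := K)
    (x := -x) ?_ ?_ hv ?_
  · intro a b
    simpa [edist_neg_neg] using hφ (-a) (-b)
  · have : -(fun j : {j : Fin n // j ≠ k} => (O *ᵥ (-x)) j) =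
        fun j : {j : Fin n // j ≠ k} => (O *ᵥ x) j := by
      ext j; simp [Matrix.mulVec_neg]
    show -φ _ ≤ _
    rw [this, Matrix.mulVec_neg, Pi.neg_apply]
    linarith
  · have e : -x + v = -(x - v) := by abel
    have : -(fun j : {j : Fin n // j ≠ k} => (O *ᵥ (-(x - v))) j) =
        fun j : {j : Fin n // j ≠ k} => (O *ᵥ (x - v)) j := by
      ext j; rw [Matrix.mulVec_neg]; simp
    simp only [rotatedGraph, mem_ofPred_eq] at h ⊢
    rw [e, this, h, Matrix.mulVec_neg, Pi.neg_apply]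

/-- The boundary inside an open set depends only on the trace of Ω there, and the boundary of {f <
g} lies in {f = g} for continuous f and g. -/
lemma frontier_inter_subset_rotatedGraph {Ω U : Set (Fin n → ℝ)} (hU : IsOpen U)
    {O : Matrix (Fin n) (Fin n) ℝ} {k : Fin n} {φ : ({j : Fin n // j ≠ k} → ℝ) → ℝ}
    (hφ : Continuous φ) (h : Ω ∩ U = rotatedEpigraph O k φ ∩ U) :
    frontier Ω ∩ U ⊆ rotatedGraph O k φ := by
  rw [← frontier_inter_open_inter hU, h, frontier_inter_open_inter hU]
  refine inter_subset_left.trans ?_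
  have h := continuous_mulVec O
  exact frontier_lt_subset_eq (hφ.comp (continuous_pi fun j => (continuous_apply j.1).comp h))
    ((continuous_apply k).comp h)

lemma volume_image_cone (S : Set (Fin n → ℝ)) (x : Fin n → ℝ) (a : ℝ) :
    volume ((fun v => x + a • v) '' S) = ENNReal.ofReal (|a| ^ n) * volume S := by
  have : (fun v => x + a • v) '' S = (fun v => x + v) '' (a • S) := by
    rw [← image_smul, image_image]
  rw [this, image_add_left, measure_preimage_add, Measure.addHaar_smul]
  simp

/-- Interior cone estimate: if near `x ∈ Ω` the boundary of `Ω` lies on a Lipschitz graph, then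
`Ω` contains a fixed portion of the ball. -/
lemma volume_ball_inter_ge_of_frontier_subset_graph {Ω : Set (Fin n → ℝ)} (hΩ : IsOpen Ω)
    {O : Matrix (Fin n) (Fin n) ℝ} (hO : O ∈ Matrix.orthogonalGroup (Fin n) ℝ) {k : Fin n}
    {φ : ({j : Fin n // j ≠ k} → ℝ) → ℝ} {K : ℝ≥0} (hφ : LipschitzWith K φ) {x : Fin n → ℝ}
    (hx : x ∈ Ω) {t : ℝ} (ht : 0 < t)
    (hfr : frontier Ω ∩ Metric.ball x t ⊆ rotatedGraph O k φ) :
    volume (upCone O k K ∩ Metric.ball 0 1) * ENNReal.ofReal t ^ n ≤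
      volume (Metric.ball x t ∩ Ω) := by
  -- The sign σ selects the upward cone when x is on or above the graph and the downward one
  -- otherwise. Only the location of the boundary matters, not the side on which Ω lies.
  obtain ⟨σ, hσ, hσg⟩ : ∃ σ : ℝ, |σ| = 1 ∧
      ∀ v ∈ upCone O k K, x + σ • v ∉ rotatedGraph O k φ := by
    rcases le_total (φ (fun j => (O *ᵥ x) j)) ((O *ᵥ x) k) with h | h
    · exact ⟨1, by simp, fun v hv => by simpa using add_notMem_rotatedGraph hφ h hv⟩
    · exact ⟨-1, by simp, fun v hv => by
        simpa [sub_eq_add_neg] using sub_notMem_rotatedGraph hφ h hv⟩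
  set S := upCone O k K ∩ Metric.ball (0 : Fin n → ℝ) 1
  have hσt : |σ * t| = t := by rw [abs_mul, hσ, one_mul, abs_of_pos ht]
  have hball : (fun v => x + (σ * t) • v) '' S ⊆ Metric.ball x t := by
    rintro _ ⟨v, ⟨-, hv⟩, rfl⟩
    rw [mem_ball_zero_iff] at hv
    rw [mem_ball_iff_norm, add_sub_cancel_left, norm_smul, Real.norm_eq_abs, hσt]
    nlinarith
  have hsub : (fun v => x + (σ * t) • v) '' S ⊆ Ω := by
    apply subset_of_convex_of_disjoint_frontier hΩ
    · have hc : Convex ℝ S := (convex_upCone O k K).inter (convex_ball 0 1)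
      have := (hc.smul (σ * t)).translate x
      rwa [← image_smul, image_image] at this
    -- The truncated cone has its vertex at x, so its points close to x lie in the open set Ω.
    · obtain ⟨v, hv⟩ := upCone_nonempty hO k K
      have hc : Tendsto (fun a : ℝ => x + (σ * t) • (a • v)) (𝓝[>] 0) (𝓝 x) := by
        have : Continuous fun a : ℝ => x + (σ * t) • (a • v) := by fun_prop
        simpa using (this.tendsto 0).mono_left nhdsWithin_le_nhds
      have hc2 : Tendsto (fun a : ℝ => a • v) (𝓝[>] 0) (𝓝 0) := by
        have : Continuous fun a : ℝ => a • v := by fun_prop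
        simpa using (this.tendsto 0).mono_left nhdsWithin_le_nhds
      obtain ⟨a, h1, h2, h3⟩ := ((hc.eventually (hΩ.mem_nhds hx)).and
        ((hc2.eventually (Metric.ball_mem_nhds 0 one_pos)).and self_mem_nhdsWithin)).exists
      exact ⟨_, ⟨a • v, ⟨smul_mem_upCone hv h3, h2⟩, rfl⟩, h1⟩
    · rw [Set.disjoint_left]
      intro z hz hzf
      have hg := hfr ⟨hzf, hball hz⟩
      obtain ⟨v, hv, rfl⟩ := hz
      refine hσg (t • v) (smul_mem_upCone hv.1 ht) ?_
      rwa [smul_smul]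
  calc _ = volume ((fun v => x + (σ * t) • v) '' S) := by
        rw [volume_image_cone, hσt, ENNReal.ofReal_pow ht.le, mul_comm]
    _ ≤ _ := measure_mono (subset_inter hball hsub)

lemma volume_upCone_pos {O : Matrix (Fin n) (Fin n) ℝ}
    (hO : O ∈ Matrix.orthogonalGroup (Fin n) ℝ) (k : Fin n) (K : ℝ≥0) :
    0 < volume (upCone O k K ∩ Metric.ball 0 1) := by
  refine ((isOpen_upCone O k K).inter Metric.isOpen_ball).measure_pos _ ?_
  obtain ⟨v, hv⟩ := upCone_nonempty hO k K
  have hc2 : Tendsto (fun a : ℝ => a • v) (𝓝[>] 0) (𝓝 0) := by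
    have : Continuous fun a : ℝ => a • v := by fun_prop
    simpa using (this.tendsto 0).mono_left nhdsWithin_le_nhds
  obtain ⟨a, h2, h3⟩ := ((hc2.eventually (Metric.ball_mem_nhds 0 one_pos)).and
    self_mem_nhdsWithin).exists
  exact ⟨a • v, smul_mem_upCone hv h3, h2⟩

lemma volume_ball_inter_ge_of_disjoint_frontier {Ω : Set (Fin n → ℝ)} (hΩ : IsOpen Ω) {x : Fin n → ℝ}
    (hx : x ∈ Ω) {t : ℝ} (ht : 0 < t) (hfr : Disjoint (Metric.ball x t) (frontier Ω)) :
    ENNReal.ofReal t ^ n ≤ volume (Metric.ball x t ∩ Ω) := by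
  rw [inter_eq_left.2 (subset_of_convex_of_disjoint_frontier hΩ (convex_ball x t)
    ⟨x, Metric.mem_ball_self ht, hx⟩ hfr), Real.volume_pi_ball x ht, Fintype.card_fin,
    ← ENNReal.ofReal_pow ht.le]
  apply ENNReal.ofReal_le_ofReal
  gcongr
  linarith

/-- The part of the boundary near a bounded set of centres is compact, so it has a Lebesgue number
for the cover U: a small ball either misses the boundary or sits inside a single chart, where the
cone estimate applies. -/
lemma exists_density_of_norm_le {Ω : Set (Fin n → ℝ)} (hΩ : IsStronglyLipschitzDomain Ω)
    (ρ T : ℝ) : ∃ c : ℝ≥0∞, c ≠ 0 ∧ ∀ x ∈ Ω, ‖x‖ ≤ ρ → ∀ t : ℝ, 0 < t → t ≤ T →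
      c * ENNReal.ofReal t ^ n ≤ volume (Metric.ball x t ∩ Ω) := by
  obtain ⟨m, U, hU, hcov, hgr, -⟩ := hΩ.boundary
  choose O hO k φ K hφ hgr using hgr
  have hK : IsCompact (frontier Ω ∩ Metric.closedBall 0 (ρ + 1)) :=
    (isCompact_closedBall 0 (ρ + 1)).inter_left isClosed_frontier
  obtain ⟨r, hr, hleb⟩ := lebesgue_number_lemma_of_metric hK hU (inter_subset_left.trans hcov)
  obtain ⟨c, hc0, hc1, hci⟩ : ∃ c : ℝ≥0∞, c ≠ 0 ∧ c ≤ 1 ∧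
      ∀ i, c ≤ volume (upCone (O i) (k i) (K i) ∩ Metric.ball 0 1) := by
    refine ⟨min 1 (Finset.univ.inf fun i => volume (upCone (O i) (k i) (K i) ∩ Metric.ball 0 1)),
      ?_, min_le_left _ _, fun i => (min_le_right _ _).trans (Finset.inf_le (Finset.mem_univ i))⟩
    refine (lt_min one_pos ?_).ne'
    rw [Finset.lt_inf_iff (by simp)]
    exact fun i _ => volume_upCone_pos (hO i) _ _
  set r₀ := min (r / 2) 1
  have hr₀ : 0 < r₀ := lt_min (by positivity) one_pos
  have hsmall : ∀ x ∈ Ω, ‖x‖ ≤ ρ → ∀ t : ℝ, 0 < t → t ≤ r₀ →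
      c * ENNReal.ofReal t ^ n ≤ volume (Metric.ball x t ∩ Ω) := by
    intro x hx hxρ t ht htr
    by_cases hd : Disjoint (Metric.ball x t) (frontier Ω)
    · refine le_trans ?_ (volume_ball_inter_ge_of_disjoint_frontier hΩ.isOpen hx ht hd)
      exact (mul_le_mul_left hc1 _).trans_eq (one_mul _)
    · obtain ⟨z, hz, hzf⟩ := Set.not_disjoint_iff.1 hd
      have hzt : dist z x < t := hz
      have hzρ : ‖z‖ ≤ ρ + 1 := by
        have h1 := norm_le_norm_add_norm_sub' z x
        rw [← dist_eq_norm] at h1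
        have : r₀ ≤ 1 := min_le_right _ _
        linarith
      obtain ⟨i, hi⟩ := hleb z ⟨hzf, by simpa using hzρ⟩
      have hsub : Metric.ball x t ⊆ U i := by
        refine Subset.trans (fun y hy => ?_) hi
        have : r₀ ≤ r / 2 := min_le_left _ _
        have h2 : dist y x < t := hy
        have := dist_triangle_right y z x
        rw [Metric.mem_ball]
        linarith
      refine le_trans (mul_le_mul_left (hci i) _)
        (volume_ball_inter_ge_of_frontier_subset_graph hΩ.isOpen (hO i) (hφ i) hx ht ?_)
      exact (inter_subset_inter_right _ hsub).trans
        (frontier_inter_subset_rotatedGraph (hU i) (hφ i).continuous (hgr i))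
  rcases lt_or_ge T r₀ with hT | hT
  · exact ⟨c, hc0, fun x hx hxρ t ht htT => hsmall x hx hxρ t ht (htT.trans hT.le)⟩
  · have hTpos : 0 < T := hr₀.trans_le hT
    -- A radius t ≤ T is shrunk to (r₀ / T) t ≤ r₀, at the price of the factor (r₀ / T)ⁿ.
    refine ⟨c * ENNReal.ofReal (r₀ / T) ^ n, ?_, fun x hx hxρ t ht htT => ?_⟩
    · refine mul_ne_zero hc0 (pow_ne_zero _ ?_)
      simpa using div_pos hr₀ hTpos
    · have hs : r₀ / T * t ≤ r₀ := by
        rw [div_mul_eq_mul_div, div_le_iff₀ hTpos]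
        exact mul_le_mul_of_nonneg_left htT hr₀.le
      have hs2 : r₀ / T * t ≤ t := mul_le_of_le_one_left ht.le ((div_le_one hTpos).2 hT)
      calc c * ENNReal.ofReal (r₀ / T) ^ n * ENNReal.ofReal t ^ n
          = c * ENNReal.ofReal (r₀ / T * t) ^ n := by
            rw [ENNReal.ofReal_mul (by positivity), mul_pow, mul_assoc]
        _ ≤ _ := hsmall x hx hxρ _ (by positivity) hs
        _ ≤ _ := measure_mono (inter_subset_inter_left _ (Metric.ball_subset_ball hs2))

/-- Bounded boundary parts fit in a ball of radius R. A ball of radius at most ‖x‖ / 2 about x with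
‖x‖ ≥ 2R avoids that ball, so it can meet only the unique unbounded part, and a single graph
describes the boundary in it at every such scale. -/
lemma exists_density_far {Ω : Set (Fin n → ℝ)} (hΩ : IsStronglyLipschitzDomain Ω) :
    ∃ R : ℝ, 0 < R ∧ ∃ c : ℝ≥0∞, c ≠ 0 ∧ ∀ x ∈ Ω, R ≤ ‖x‖ → ∀ t : ℝ, 0 < t → t ≤ ‖x‖ / 2 →
      c * ENNReal.ofReal t ^ n ≤ volume (Metric.ball x t ∩ Ω) := by
  obtain ⟨m, U, hU, hcov, hgr, huniq⟩ := hΩ.boundary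
  choose O hO k φ K hφ hgr using hgr
  have hbd : Bornology.IsBounded (⋃ i ∈ {i | Bornology.IsBounded (frontier Ω ∩ U i)},
      frontier Ω ∩ U i) := by
    rw [Bornology.isBounded_biUnion (Set.toFinite _)]
    exact fun i hi => hi
  obtain ⟨R, hR0, hR⟩ := hbd.subset_ball_lt 0 0
  have hnorm : ∀ x : Fin n → ℝ, 2 * R ≤ ‖x‖ → ∀ t ≤ ‖x‖ / 2, ∀ z ∈ Metric.ball x t, R ≤ ‖z‖ := by
    intro x hx t ht z hz
    have h1 := norm_le_norm_add_norm_sub' x z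
    rw [← dist_eq_norm, dist_comm] at h1
    have h2 : dist z x < t := hz
    linarith
  have hfar : ∀ z ∈ frontier Ω, R ≤ ‖z‖ → ∃ i, ¬ Bornology.IsBounded (frontier Ω ∩ U i) ∧
      z ∈ U i := by
    intro z hz hzR
    obtain ⟨i, hi⟩ := mem_iUnion.1 (hcov hz)
    refine ⟨i, fun hb => ?_, hi⟩
    have : z ∈ Metric.ball (0 : Fin n → ℝ) R := hR (mem_biUnion hb ⟨hz, hi⟩)
    rw [mem_ball_zero_iff] at this
    linarith
  by_cases hex : ∃ i, ¬ Bornology.IsBounded (frontier Ω ∩ U i)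
  · obtain ⟨i, hi⟩ := hex
    refine ⟨2 * R, by positivity, _, (volume_upCone_pos (hO i) (k i) (K i)).ne',
      fun x hx hxR t ht htx => ?_⟩
    refine volume_ball_inter_ge_of_frontier_subset_graph hΩ.isOpen (hO i) (hφ i) hx ht ?_
    refine Subset.trans (fun z hz => ?_)
      (frontier_inter_subset_rotatedGraph (hU i) (hφ i).continuous (hgr i))
    obtain ⟨j, hj, hzj⟩ := hfar z hz.1 (hnorm x hxR t htx z hz.2)
    rw [huniq i j hi hj]
    exact ⟨hz.1, hzj⟩
  · push Not at hex
    refine ⟨2 * R, by positivity, 1, one_ne_zero, fun x hx hxR t ht htx => ?_⟩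
    rw [one_mul]
    refine volume_ball_inter_ge_of_disjoint_frontier hΩ.isOpen hx ht ?_
    rw [Set.disjoint_left]
    intro z hz hzf
    obtain ⟨j, hj, -⟩ := hfar z hzf (hnorm x hxR t htx z hz)
    exact hj (hex j)

/-- Strongly Lipschitz domains contain a fixed portion of every ball centred in them whose radius
is less than `d_Ω`. -/
theorem IsStronglyLipschitzDomain.exists_density {Ω : Set (Fin n → ℝ)}
    (hΩ : IsStronglyLipschitzDomain Ω) :
    ∃ c : ℝ≥0∞, c ≠ 0 ∧ c ≠ ⊤ ∧ ∀ x ∈ Ω, ∀ t : ℝ, 0 < t → ENNReal.ofReal t < dOmega Ω →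
      c * ENNReal.ofReal t ^ n ≤ volume (Metric.ball x t ∩ Ω) := by
  suffices h : ∃ c : ℝ≥0∞, c ≠ 0 ∧ ∀ x ∈ Ω, ∀ t : ℝ, 0 < t → ENNReal.ofReal t < dOmega Ω →
      c * ENNReal.ofReal t ^ n ≤ volume (Metric.ball x t ∩ Ω) by
    obtain ⟨c, hc, h⟩ := h
    refine ⟨min c 1, (lt_min hc.bot_lt one_pos).ne', ((min_le_right _ _).trans_lt
      ENNReal.one_lt_top).ne, fun x hx t ht htd => le_trans ?_ (h x hx t ht htd)⟩
    gcongr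
    exact min_le_left _ _
  by_cases hb : Bornology.IsBounded Ω
  · obtain ⟨ρ, hρ⟩ := hb.exists_norm_le
    obtain ⟨c, hc, h⟩ := exists_density_of_norm_le hΩ ρ (dOmega Ω).toReal
    refine ⟨c, hc, fun x hx t ht htd => h x hx (hρ x hx) t ht ?_⟩
    have hfin : dOmega Ω ≠ ⊤ := ENNReal.mul_ne_top (by simp) hb.ediam_ne_top
    exact (ENNReal.ofReal_le_iff_le_toReal hfin).1 htd.le
  · obtain ⟨R, hR0, c₁, hc₁, h₁⟩ := exists_density_far hΩ
    obtain ⟨x₀, hx₀⟩ := hΩ.isConnected.nonempty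
    set R' := max R ‖x₀‖ with hR'
    have hR'0 : 0 < R' := hR0.trans_le (le_max_left _ _)
    obtain ⟨c₂, hc₂, h₂⟩ := exists_density_of_norm_le hΩ (8 * R') (4 * R')
    -- The norm is continuous and unbounded on the connected set Ω, hence takes every large value.
    have hinter : ∀ s, R' ≤ s → ∃ y ∈ Ω, ‖y‖ = s := by
      intro s hs
      obtain ⟨z, hz, hzs⟩ : ∃ z ∈ Ω, s ≤ ‖z‖ := by
        by_contra hcon
        push Not at hcon
        exact hb (isBounded_iff_forall_norm_le.2 ⟨s, fun x hx => (hcon x hx).le⟩)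
      have := hΩ.isConnected.isPreconnected.intermediate_value hx₀ hz continuous_norm.continuousOn
      obtain ⟨y, hy, hys⟩ := this ⟨(le_max_right _ _).trans hs, hzs⟩
      exact ⟨y, hy, hys⟩
    -- If ‖x‖ < t / 4, the centre is moved to some y ∈ Ω with ‖y‖ = t / 4; then B(y, t / 8) ⊆ B(x,
    -- t), and the radius t / 8 is half of ‖y‖.
    have hlarge : ∀ x ∈ Ω, ∀ t, 4 * R' ≤ t →
        c₁ * ENNReal.ofReal (t / 8) ^ n ≤ volume (Metric.ball x t ∩ Ω) := by
      intro x hx t ht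
      have ht0 : 0 < t := by linarith
      rcases le_or_gt (t / 4) ‖x‖ with hxt | hxt
      · refine (h₁ x hx ?_ (t / 8) (by positivity) (by linarith)).trans (measure_mono
          (inter_subset_inter_left _ (Metric.ball_subset_ball (by linarith))))
        have := le_max_left R ‖x₀‖
        linarith
      · obtain ⟨y, hy, hyt⟩ := hinter (t / 4) (by linarith)
        refine (h₁ y hy ?_ (t / 8) (by positivity) (by linarith)).trans (measure_mono
          (inter_subset_inter_left _ (Metric.ball_subset_ball' ?_)))
        · have := le_max_left R ‖x₀‖
          linarith
        · rw [dist_eq_norm]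
          have := norm_sub_le y x
          linarith
    refine ⟨min (c₁ * ENNReal.ofReal (1 / 8) ^ n) c₂, ?_, fun x hx t ht _ => ?_⟩
    · refine (lt_min (pos_iff_ne_zero.2 (mul_ne_zero hc₁ (pow_ne_zero _ ?_))) hc₂.bot_lt).ne'
      simp
    rcases le_or_gt (4 * R') t with htR | htR
    · refine le_trans (mul_le_mul_left (min_le_left _ _) _) (le_trans (le_of_eq ?_)
        (hlarge x hx t htR))
      rw [mul_assoc, ← mul_pow, ← ENNReal.ofReal_mul (by norm_num)]
      congr 3
      ring
    rcases le_or_gt ‖x‖ (8 * R') with hxR | hxR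
    · exact le_trans (mul_le_mul_left (min_le_right _ _) _) (h₂ x hx hxR t ht htR.le)
    · refine le_trans (mul_le_mul_left ((min_le_left _ _).trans ?_) _)
        (h₁ x hx ?_ t ht (by linarith))
      · refine mul_le_of_le_one_right' (pow_le_one' ?_ _)
        exact ENNReal.ofReal_le_one.2 (by norm_num)
      · have := le_max_left R ‖x₀‖
        linarith

end Density

/-! ### Multiplication operators and the graph of the gradient -/

section Sobolev

variable {n : ℕ} {Ω : Set (Fin n → ℝ)}

/-- Multiplication of an `L²` function by a bounded real function. -/
def mulOp {E : Type*} [NormedAddCommGroup E] [NormedSpace ℝ E] {g : (Fin n → ℝ) → ℝ}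
    (hg : MemLp g ∞ (volume.restrict Ω)) :
    Lp E 2 (volume.restrict Ω) →L[ℝ] Lp E 2 (volume.restrict Ω) :=
  (ContinuousLinearMap.lsmul ℝ ℝ).holderL (volume.restrict Ω) ∞ 2 2 hg.toLp

lemma coeFn_mulOp {E : Type*} [NormedAddCommGroup E] [NormedSpace ℝ E] {g : (Fin n → ℝ) → ℝ}
    (hg : MemLp g ∞ (volume.restrict Ω)) (u : Lp E 2 (volume.restrict Ω)) :
    mulOp hg u =ᵐ[volume.restrict Ω] fun x => g x • u x := by
  have h := (ContinuousLinearMap.lsmul ℝ ℝ).coeFn_holder (r := 2) hg.toLp u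
  filter_upwards [h, hg.coeFn_toLp] with x h1 h2
  rw [← h2]
  exact h1

/-- Multiplication of a scalar `L²` function by a bounded vector field. -/
def mulVecOp {w : (Fin n → ℝ) → EuclideanSpace ℂ (Fin n)}
    (hw : MemLp w ∞ (volume.restrict Ω)) : L2 Ω →L[ℝ] L2Vec Ω :=
  ((ContinuousLinearMap.lsmul ℝ ℂ).flip).holderL (volume.restrict Ω) ∞ 2 2 hw.toLp

lemma coeFn_mulVecOp {w : (Fin n → ℝ) → EuclideanSpace ℂ (Fin n)}
    (hw : MemLp w ∞ (volume.restrict Ω)) (u : L2 Ω) :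
    mulVecOp hw u =ᵐ[volume.restrict Ω] fun x => u x • w x := by
  have h := ((ContinuousLinearMap.lsmul ℝ ℂ).flip).coeFn_holder (r := 2) hw.toLp u
  filter_upwards [h, hw.coeFn_toLp] with x h1 h2
  rw [← h2]
  exact h1

lemma classicalGrad_apply (φ : (Fin n → ℝ) → ℂ) (x : Fin n → ℝ) (i : Fin n) :
    classicalGrad φ x i = fderiv ℝ φ x (Pi.single i 1) := rfl

lemma continuous_classicalGrad {φ : (Fin n → ℝ) → ℂ} (hφ : ContDiff ℝ ∞ φ) :
    Continuous (classicalGrad φ) := by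
  refine (PiLp.continuous_toLp 2 _).comp (continuous_pi fun i => ?_)
  exact (hφ.continuous_fderiv (by simp)).clm_apply continuous_const

lemma classicalGrad_add {φ ψ : (Fin n → ℝ) → ℂ} (hφ : ContDiff ℝ ∞ φ) (hψ : ContDiff ℝ ∞ ψ)
    (x : Fin n → ℝ) :
    classicalGrad (fun y => φ y + ψ y) x = classicalGrad φ x + classicalGrad ψ x := by
  ext i
  rw [PiLp.add_apply, classicalGrad_apply, classicalGrad_apply, classicalGrad_apply,
    fderiv_fun_add (hφ.differentiable (by simp) x) (hψ.differentiable (by simp) x)]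
  rfl

lemma classicalGrad_mul {φ ψ : (Fin n → ℝ) → ℂ} (hφ : ContDiff ℝ ∞ φ) (hψ : ContDiff ℝ ∞ ψ)
    (x : Fin n → ℝ) :
    classicalGrad (fun y => φ y * ψ y) x = φ x • classicalGrad ψ x + ψ x • classicalGrad φ x := by
  ext i
  rw [PiLp.add_apply, PiLp.smul_apply, PiLp.smul_apply, classicalGrad_apply, classicalGrad_apply,
    classicalGrad_apply,
    fderiv_fun_mul (hφ.differentiable (by simp) x) (hψ.differentiable (by simp) x)]
  rfl

lemma classicalGrad_const_mul (c : ℂ) {φ : (Fin n → ℝ) → ℂ} (hφ : ContDiff ℝ ∞ φ)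
    (x : Fin n → ℝ) :
    classicalGrad (fun y => c * φ y) x = c • classicalGrad φ x := by
  rw [classicalGrad_mul contDiff_const hφ]
  ext i
  simp [classicalGrad_apply]

lemma classicalGrad_eq_zero_of_notMem {φ : (Fin n → ℝ) → ℂ} {x : Fin n → ℝ}
    (hx : x ∉ tsupport φ) : classicalGrad φ x = 0 := by
  have : fderiv ℝ φ x = 0 := by
    by_contra h
    exact hx (tsupport_fderiv_subset ℝ (subset_tsupport _ h))
  ext i
  simp [classicalGrad_apply, this]

namespace IsTestFunction

lemma add {φ ψ : (Fin n → ℝ) → ℂ} (hφ : IsTestFunction Ω φ) (hψ : IsTestFunction Ω ψ) :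
    IsTestFunction Ω (fun x => φ x + ψ x) :=
  ⟨hφ.contDiff.add hψ.contDiff, hφ.hasCompactSupport.add hψ.hasCompactSupport,
    (tsupport_add φ ψ).trans (union_subset hφ.tsupport_subset hψ.tsupport_subset)⟩

lemma mul_left {φ ψ : (Fin n → ℝ) → ℂ} (hφ : IsTestFunction Ω φ) (hψ : ContDiff ℝ ∞ ψ) :
    IsTestFunction Ω (fun x => ψ x * φ x) :=
  ⟨hψ.mul hφ.contDiff, hφ.hasCompactSupport.mul_left,
    (tsupport_mul_subset_right).trans hφ.tsupport_subset⟩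

lemma zero : IsTestFunction Ω (fun _ => 0) :=
  ⟨contDiff_const, HasCompactSupport.zero, by
    have : tsupport (fun _ : Fin n → ℝ => (0 : ℂ)) = ∅ := tsupport_eq_empty_iff.2 rfl
    simp [this]⟩

lemma memLp {φ : (Fin n → ℝ) → ℂ} (hφ : IsTestFunction Ω φ) :
    MemLp φ 2 (volume.restrict Ω) :=
  (hφ.contDiff.continuous.memLp_of_hasCompactSupport hφ.hasCompactSupport)

lemma hasCompactSupport_grad {φ : (Fin n → ℝ) → ℂ} (hφ : IsTestFunction Ω φ) :
    HasCompactSupport (classicalGrad φ) :=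
  HasCompactSupport.intro hφ.hasCompactSupport fun _ hx => classicalGrad_eq_zero_of_notMem hx

lemma memLp_grad {φ : (Fin n → ℝ) → ℂ} (hφ : IsTestFunction Ω φ) :
    MemLp (classicalGrad φ) 2 (volume.restrict Ω) :=
  (continuous_classicalGrad hφ.contDiff).memLp_of_hasCompactSupport hφ.hasCompactSupport_grad

lemma integral_mul_grad {φ ψ : (Fin n → ℝ) → ℂ} (hφ : IsTestFunction Ω φ)
    (hψ : IsTestFunction Ω ψ) (i : Fin n) :
    ∫ x in Ω, φ x * classicalGrad ψ x i = - ∫ x in Ω, classicalGrad φ x i * ψ x := by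
  have h0 : ∀ x ∉ Ω, φ x = 0 := fun x hx => by
    by_contra h
    exact hx (hφ.tsupport_subset (subset_tsupport _ h))
  have h1 : ∀ x ∉ Ω, ψ x = 0 := fun x hx => by
    by_contra h
    exact hx (hψ.tsupport_subset (subset_tsupport _ h))
  rw [setIntegral_eq_integral_of_forall_compl_eq_zero (fun x hx => by simp [h0 x hx]),
    setIntegral_eq_integral_of_forall_compl_eq_zero (fun x hx => by simp [h1 x hx])]
  have c1 := hφ.contDiff.continuous
  have c2 := hψ.contDiff.continuous
  have c3 : Continuous fun x => fderiv ℝ φ x (Pi.single i 1) :=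
    (hφ.contDiff.continuous_fderiv (by simp)).clm_apply continuous_const
  have c4 : Continuous fun x => fderiv ℝ ψ x (Pi.single i 1) :=
    (hψ.contDiff.continuous_fderiv (by simp)).clm_apply continuous_const
  apply integral_mul_fderiv_eq_neg_fderiv_mul_of_integrable
  · exact (c3.mul c2).integrable_of_hasCompactSupport hψ.hasCompactSupport.mul_left
  · exact (c1.mul c4).integrable_of_hasCompactSupport hφ.hasCompactSupport.mul_right
  · exact (c1.mul c2).integrable_of_hasCompactSupport hφ.hasCompactSupport.mul_right
  · exact fun x _ => hφ.contDiff.differentiable (by simp) x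
  · exact fun x _ => hψ.contDiff.differentiable (by simp) x

end IsTestFunction

variable (Ω) in
/-- The pairs `(φ, ∇φ)`, `φ ∈ C_c^∞(Ω)`. -/
def testGraph : Submodule ℂ (L2 Ω × L2Vec Ω) where
  carrier := {p | ∃ φ, IsTestFunction Ω φ ∧ p.1 =ᵐ[volume.restrict Ω] φ ∧
    p.2 =ᵐ[volume.restrict Ω] classicalGrad φ}
  add_mem' := by
    rintro p q ⟨φ, hφ, hφ1, hφ2⟩ ⟨ψ, hψ, hψ1, hψ2⟩
    refine ⟨_, hφ.add hψ, ?_, ?_⟩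
    · filter_upwards [Lp.coeFn_add p.1 q.1, hφ1, hψ1] with x h1 h2 h3
      rw [Prod.fst_add, h1, Pi.add_apply, h2, h3]
    · filter_upwards [Lp.coeFn_add p.2 q.2, hφ2, hψ2] with x h1 h2 h3
      rw [Prod.snd_add, h1, Pi.add_apply, h2, h3, classicalGrad_add hφ.contDiff hψ.contDiff]
  zero_mem' := by
    refine ⟨_, IsTestFunction.zero, Lp.coeFn_zero _ _ _, ?_⟩
    refine (Lp.coeFn_zero _ _ _).trans (Eventually.of_forall fun x => ?_)
    ext i
    simp [classicalGrad_apply]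
  smul_mem' := by
    rintro c p ⟨φ, hφ, hφ1, hφ2⟩
    refine ⟨_, hφ.mul_left (contDiff_const (c := c)), ?_, ?_⟩
    · filter_upwards [Lp.coeFn_smul c p.1, hφ1] with x h1 h2
      rw [Prod.smul_fst, h1, Pi.smul_apply, h2, smul_eq_mul]
    · filter_upwards [Lp.coeFn_smul c p.2, hφ2] with x h1 h2
      rw [Prod.smul_snd, h1, Pi.smul_apply, h2, classicalGrad_const_mul c hφ.contDiff]

variable (Ω) in
/-- The graph of the gradient on `W_0^{1,2}(Ω)`. -/
def gradGraph : Submodule ℂ (L2 Ω × L2Vec Ω) := (testGraph Ω).topologicalClosure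

/-- For a fixed test function, the integration by parts identity says that a continuous functional
on L² × L² vanishes. It holds on pairs (φ, ∇φ), hence on their closure. -/
lemma isWeakGradient_of_mem_gradGraph {u : L2 Ω} {G : L2Vec Ω} (h : (u, G) ∈ gradGraph Ω) :
    IsWeakGradient u G := by
  intro ψ hψ i
  let B₁ := ContinuousLinearMap.mul ℂ ℂ
  let B₂ := (ContinuousLinearMap.mul ℂ ℂ).comp (EuclideanSpace.proj (𝕜 := ℂ) i)
  have hgi : MemLp (fun x => classicalGrad ψ x i) 2 (volume.restrict Ω) :=
    hψ.memLp_grad.continuousLinearMap_comp (EuclideanSpace.proj (𝕜 := ℂ) i)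
  let F : L2 Ω × L2Vec Ω → ℂ := fun p =>
    B₁.lpPairing (volume.restrict Ω) 2 2 p.1 hgi.toLp +
      B₂.lpPairing (volume.restrict Ω) 2 2 p.2 hψ.memLp.toLp
  have hF : ∀ p, F p = (∫ x in Ω, p.1 x * classicalGrad ψ x i) + ∫ x in Ω, p.2 x i * ψ x := by
    intro p
    simp only [F, ContinuousLinearMap.lpPairing_eq_integral]
    congr 1
    · refine integral_congr_ae ?_
      filter_upwards [hgi.coeFn_toLp] with x hx
      rw [hx]; rfl
    · refine integral_congr_ae ?_
      filter_upwards [hψ.memLp.coeFn_toLp] with x hx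
      rw [hx]; rfl
  have hcont : Continuous F := by
    refine Continuous.add ?_ ?_
    · exact ((B₁.lpPairing (volume.restrict Ω) 2 2).flip _).continuous.comp continuous_fst
    · exact ((B₂.lpPairing (volume.restrict Ω) 2 2).flip _).continuous.comp continuous_snd
  have hmem : (u, G) ∈ {p | F p = 0} := by
    refine closure_minimal ?_ (isClosed_eq hcont continuous_const) h
    rintro p ⟨φ, hφ, h1, h2⟩
    show F p = 0
    rw [hF, integral_congr_ae (g := fun x => φ x * classicalGrad ψ x i),
      integral_congr_ae (f := fun x => p.2 x i * ψ x) (g := fun x => classicalGrad φ x i * ψ x),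
      hφ.integral_mul_grad hψ i, neg_add_cancel]
    · filter_upwards [h2] with x hx
      rw [hx]
    · filter_upwards [h1] with x hx
      rw [hx]
  have h0 : F (u, G) = 0 := hmem
  rw [hF] at h0
  exact eq_neg_of_add_eq_zero_left h0

lemma ae_eq_zero_of_integral_mul_testFunction_eq_zero (hΩ : IsOpen Ω) {h : (Fin n → ℝ) → ℂ}
    (hm : MemLp h 2 (volume.restrict Ω))
    (h0 : ∀ φ, IsTestFunction Ω φ → ∫ x in Ω, h x * φ x = 0) :
    ∀ᵐ x ∂(volume.restrict Ω), h x = 0 := by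
  rw [ae_restrict_iff' hΩ.measurableSet]
  refine hΩ.ae_eq_zero_of_integral_contDiff_smul_eq_zero (μ := volume) ?_ ?_
  · exact locallyIntegrableOn_of_locallyIntegrable_restrict (hm.locallyIntegrable (by norm_num))
  · intro g hg hgc hgs
    have ht : IsTestFunction Ω (fun x => (g x : ℂ)) :=
      ⟨Complex.ofRealCLM.contDiff.comp hg, hgc.comp_left (g := fun r : ℝ => (r : ℂ)) (by simp),
        (tsupport_comp_subset (g := fun r : ℝ => (r : ℂ)) (by simp) g).trans hgs⟩
    rw [← setIntegral_eq_integral_of_forall_compl_eq_zero (s := Ω), ← h0 _ ht]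
    · refine integral_congr_ae (Eventually.of_forall fun x => ?_)
      show g x • h x = h x * (g x : ℂ)
      rw [Complex.real_smul, mul_comm]
    · intro x hx
      rw [image_eq_zero_of_notMem_tsupport (fun hx' => hx (hgs hx')), zero_smul]

lemma IsWeakGradient.unique (hΩ : IsOpen Ω) {u : L2 Ω} {G G' : L2Vec Ω} (h : IsWeakGradient u G)
    (h' : IsWeakGradient u G') : G = G' := by
  have key : ∀ i, ∀ᵐ x ∂(volume.restrict Ω), G x i - G' x i = 0 := by
    intro i
    have hm : ∀ H : L2Vec Ω, MemLp (fun x => H x i) 2 (volume.restrict Ω) := fun H =>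
      (Lp.memLp H).continuousLinearMap_comp (EuclideanSpace.proj (𝕜 := ℂ) i)
    refine ae_eq_zero_of_integral_mul_testFunction_eq_zero hΩ ((hm G).sub (hm G')) ?_
    intro φ hφ
    have e := (h _ hφ i).symm.trans (h' _ hφ i)
    rw [neg_inj] at e
    simp_rw [sub_mul]
    rw [integral_sub, e, sub_self]
    · exact (hm G).integrable_mul hφ.memLp
    · exact (hm G').integrable_mul hφ.memLp
  refine Lp.ext ?_
  filter_upwards [ae_all_iff.2 key] with x hx
  ext i
  exact sub_eq_zero.1 (hx i)

lemma weakGrad_eq (hΩ : IsOpen Ω) {u : L2 Ω} {G : L2Vec Ω} (h : IsWeakGradient u G) :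
    weakGrad u = G := by
  have hex : ∃ G : L2Vec Ω, IsWeakGradient u G := ⟨G, h⟩
  rw [weakGrad, dif_pos hex]
  exact hex.choose_spec.unique hΩ h

/-- This replaces approximation in the Sobolev norm by membership in a closed subspace of L² × L²,
from which linearity, completeness and stability under multiplication follow. -/
lemma mem_sobolevW0_iff {u : L2 Ω} :
    u ∈ sobolevW0 Ω ↔ (u, weakGrad u) ∈ gradGraph Ω := by
  constructor
  · rintro ⟨-, h⟩
    refine EMetric.mem_closure_iff.2 fun ε hε => ?_
    obtain ⟨φ, hφ, hlt⟩ := h ε hε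
    refine ⟨(hφ.memLp.toLp, hφ.memLp_grad.toLp), ⟨φ, hφ, hφ.memLp.coeFn_toLp,
      hφ.memLp_grad.coeFn_toLp⟩, ?_⟩
    refine lt_of_le_of_lt ?_ hlt
    rw [Prod.edist_eq, Lp.edist_def, Lp.edist_def]
    refine max_le ?_ ?_
    · refine le_trans (le_of_eq (eLpNorm_congr_ae ?_)) le_self_add
      filter_upwards [hφ.memLp.coeFn_toLp] with x hx
      simp only [Pi.sub_apply, hx]
    · refine le_trans (le_of_eq (eLpNorm_congr_ae ?_)) le_add_self
      filter_upwards [hφ.memLp_grad.coeFn_toLp] with x hx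
      simp only [Pi.sub_apply, hx]
  · intro h
    refine ⟨⟨_, isWeakGradient_of_mem_gradGraph h⟩, fun ε hε => ?_⟩
    obtain ⟨p, ⟨φ, hφ, h1, h2⟩, hlt⟩ := EMetric.mem_closure_iff.1 h (ε / 2)
      (ENNReal.half_pos hε.ne')
    rw [Prod.edist_eq, Lp.edist_def, Lp.edist_def, max_lt_iff] at hlt
    refine ⟨φ, hφ, ?_⟩
    rw [eLpNorm_congr_ae (f := fun x => u x - φ x) (g := ⇑u - ⇑p.1),
      eLpNorm_congr_ae (f := fun x => weakGrad u x - classicalGrad φ x) (g := ⇑(weakGrad u) - ⇑p.2)]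
    · exact (ENNReal.add_lt_add hlt.1 hlt.2).trans_eq (ENNReal.add_halves ε)
    · filter_upwards [h2] with x hx
      simp only [Pi.sub_apply, hx]
    · filter_upwards [h1] with x hx
      simp only [Pi.sub_apply, hx]

lemma mem_sobolevW0_of_mem_gradGraph (hΩ : IsOpen Ω) {u : L2 Ω} {G : L2Vec Ω}
    (h : (u, G) ∈ gradGraph Ω) : u ∈ sobolevW0 Ω ∧ weakGrad u = G := by
  have e := weakGrad_eq hΩ (isWeakGradient_of_mem_gradGraph h)
  exact ⟨mem_sobolevW0_iff.2 (e ▸ h), e⟩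

lemma sub_mem_sobolevW0 (hΩ : IsOpen Ω) {u v : L2 Ω} (hu : u ∈ sobolevW0 Ω)
    (hv : v ∈ sobolevW0 Ω) : u - v ∈ sobolevW0 Ω ∧ weakGrad (u - v) = weakGrad u - weakGrad v :=
  mem_sobolevW0_of_mem_gradGraph hΩ
    ((gradGraph Ω).sub_mem (mem_sobolevW0_iff.1 hu) (mem_sobolevW0_iff.1 hv))

/-- `W_0^{1,2}(Ω)` is closed in `W^{1,2}(Ω)`. -/
lemma mem_sobolevW0_of_tendsto (hΩ : IsOpen Ω) {u : ℕ → L2 Ω} {u₀ : L2 Ω} {G : L2Vec Ω}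
    (hu : ∀ k, u k ∈ sobolevW0 Ω) (h1 : Tendsto u atTop (𝓝 u₀))
    (h2 : Tendsto (fun k => weakGrad (u k)) atTop (𝓝 G)) :
    u₀ ∈ sobolevW0 Ω ∧ weakGrad u₀ = G := by
  refine mem_sobolevW0_of_mem_gradGraph hΩ ?_
  exact isClosed_closure.mem_of_tendsto (h1.prodMk_nhds h2)
    (Eventually.of_forall fun k => mem_sobolevW0_iff.1 (hu k))

lemma weakGrad_zero (hΩ : IsOpen Ω) : weakGrad (0 : L2 Ω) = 0 :=
  (mem_sobolevW0_of_mem_gradGraph hΩ (gradGraph Ω).zero_mem).2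

/-! ### Multiplication by cutoff functions -/

/-- The gradient of a real function, as a complex vector field. -/
def realGrad (χ : (Fin n → ℝ) → ℝ) : (Fin n → ℝ) → EuclideanSpace ℂ (Fin n) :=
  classicalGrad fun x => (χ x : ℂ)

/-- Smooth bounded real functions with bounded gradient. -/
structure IsCutoff (χ : (Fin n → ℝ) → ℝ) : Prop where
  contDiff : ContDiff ℝ ∞ χ
  bounded : ∃ C, ∀ x, ‖χ x‖ ≤ C
  grad_bounded : ∃ C, ∀ x, ‖realGrad χ x‖ ≤ C

namespace IsCutoff

variable {χ : (Fin n → ℝ) → ℝ}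

lemma contDiff_ofReal (h : IsCutoff χ) : ContDiff ℝ ∞ fun x => (χ x : ℂ) :=
  Complex.ofRealCLM.contDiff.comp h.contDiff

lemma memLp (h : IsCutoff χ) : MemLp χ ∞ (volume.restrict Ω) :=
  memLp_top_of_bound h.contDiff.continuous.aestronglyMeasurable _
    (Eventually.of_forall h.bounded.choose_spec)

lemma continuous_grad (h : IsCutoff χ) : Continuous (realGrad χ) :=
  continuous_classicalGrad h.contDiff_ofReal

lemma memLp_grad (h : IsCutoff χ) : MemLp (realGrad χ) ∞ (volume.restrict Ω) :=
  memLp_top_of_bound h.continuous_grad.aestronglyMeasurable _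
    (Eventually.of_forall h.grad_bounded.choose_spec)

lemma memLp_norm_grad (h : IsCutoff χ) :
    MemLp (fun x => ‖realGrad χ x‖) ∞ (volume.restrict Ω) := h.memLp_grad.norm

lemma const (c : ℝ) : IsCutoff (fun _ : Fin n → ℝ => c) :=
  ⟨contDiff_const, ⟨‖c‖, fun _ => le_rfl⟩, ⟨0, fun x => by
    have : realGrad (fun _ : Fin n → ℝ => c) x = 0 := by
      ext i
      simp [realGrad, classicalGrad_apply]
    simp [this]⟩⟩

lemma realGrad_sq (h : IsCutoff χ) (x : Fin n → ℝ) :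
    realGrad (fun y => χ y ^ 2) x = ((2 * χ x : ℝ) : ℂ) • realGrad χ x := by
  have e : (fun y => ((χ y ^ 2 : ℝ) : ℂ)) = fun y => (χ y : ℂ) * χ y := by
    ext y; push_cast; ring
  rw [realGrad, e, classicalGrad_mul h.contDiff_ofReal h.contDiff_ofReal, ← two_smul ℂ, smul_smul]
  push_cast
  rfl

lemma sq (h : IsCutoff χ) : IsCutoff fun x => χ x ^ 2 := by
  obtain ⟨C, hC⟩ := h.bounded
  obtain ⟨D, hD⟩ := h.grad_bounded
  refine ⟨h.contDiff.pow 2, ⟨C ^ 2, fun x => ?_⟩, ⟨2 * C * D, fun x => ?_⟩⟩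
  · rw [norm_pow]
    exact pow_le_pow_left₀ (norm_nonneg _) (hC x) 2
  · rw [h.realGrad_sq, norm_smul, Complex.norm_real, norm_mul, Real.norm_two]
    have := norm_nonneg (χ x)
    exact mul_le_mul (mul_le_mul_of_nonneg_left (hC x) zero_le_two) (hD x) (norm_nonneg _)
      (by linarith [hC x])

/-- The map (u, G) ↦ (χu, χG + u∇χ) is continuous and preserves the pairs (φ, ∇φ) by the product
rule, so it preserves their closure. -/
lemma mulOp_mem_sobolevW0 (h : IsCutoff χ) (hΩ : IsOpen Ω) {u : L2 Ω} (hu : u ∈ sobolevW0 Ω) :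
    mulOp h.memLp u ∈ sobolevW0 Ω ∧
      weakGrad (mulOp h.memLp u) = mulOp h.memLp (weakGrad u) + mulVecOp h.memLp_grad u := by
  refine mem_sobolevW0_of_mem_gradGraph hΩ ?_
  have hc : Continuous fun p : L2 Ω × L2Vec Ω =>
      ((mulOp h.memLp p.1, mulOp h.memLp p.2 + mulVecOp h.memLp_grad p.1) :
        L2 Ω × L2Vec Ω) := by fun_prop
  have hm : MapsTo (fun p : L2 Ω × L2Vec Ω =>
      ((mulOp h.memLp p.1, mulOp h.memLp p.2 + mulVecOp h.memLp_grad p.1) : L2 Ω × L2Vec Ω))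
      (testGraph Ω) (testGraph Ω) := by
    rintro p ⟨φ, hφ, h1, h2⟩
    refine ⟨_, hφ.mul_left h.contDiff_ofReal, ?_, ?_⟩
    · filter_upwards [coeFn_mulOp h.memLp p.1, h1] with x e1 e2
      rw [e1, e2, Complex.real_smul]
    · filter_upwards [Lp.coeFn_add (mulOp h.memLp p.2) (mulVecOp h.memLp_grad p.1),
        coeFn_mulOp h.memLp p.2, coeFn_mulVecOp h.memLp_grad p.1, h1, h2] with x e1 e2 e3 e4 e5
      rw [e1, Pi.add_apply, e2, e3, e4, e5, classicalGrad_mul h.contDiff_ofReal hφ.contDiff]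
      rfl
  exact hm.closure hc (mem_sobolevW0_iff.1 hu)

end IsCutoff

end Sobolev

/-! ### Strongly continuous semigroups -/

namespace IsSemigroupGeneratedByNeg

variable {X : Type*} [NormedAddCommGroup X] [NormedSpace ℂ X] {L : X → X → Prop}
  {T : ℝ → X →L[ℂ] X}

lemma generator_sub (hT : IsSemigroupGeneratedByNeg L T) {u u' w w' : X} (h : L u w)
    (h' : L u' w') : L (u - u') (w - w') := by
  rw [hT.generator] at *
  refine (h.sub h').congr' (Eventually.of_forall fun t => ?_) |>.trans (by rw [neg_sub_neg, neg_sub])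
  simp only [map_sub, smul_sub]
  abel

lemma generator_map (hT : IsSemigroupGeneratedByNeg L T) {u w : X} (h : L u w) {s : ℝ}
    (hs : 0 ≤ s) : L (T s u) (T s w) := by
  rw [hT.generator] at *
  have := ((T s).continuous.tendsto _).comp h
  rw [map_neg] at this
  refine this.congr' ?_
  filter_upwards [self_mem_nhdsWithin] with t ht
  have e : T s (T t u) = T t (T s u) := by
    have h1 := hT.add s t hs (le_of_lt ht)
    have h2 := hT.add t s (le_of_lt ht) hs
    rw [add_comm, h1] at h2
    exact DFunLike.congr_fun h2 u
  simp [e, smul_sub]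

variable [NormedSpace ℝ X] [IsScalarTower ℝ ℂ X]

lemma ofReal_smul_eq (r : ℝ) (x : X) : (r : ℂ) • x = r • x := algebraMap_smul ℂ r x

/-- By the semigroup law the right slope at s is the difference quotient at 0 of T s u, which lies
in the domain. A right derivative is all that the energy inequality requires. -/
lemma hasDerivWithinAt (hT : IsSemigroupGeneratedByNeg L T) {u w : X} (h : L u w) {s : ℝ}
    (hs : 0 ≤ s) : HasDerivWithinAt (fun r => T r u) (-T s w) (Ioi s) s := by
  rw [hasDerivWithinAt_iff_tendsto_slope' (by simp)]
  have h1 := (hT.generator _ _).1 (hT.generator_map h hs)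
  have h2 : Tendsto (fun r => r - s) (𝓝[>] s) (𝓝[>] 0) := by
    refine tendsto_nhdsWithin_of_tendsto_nhds_of_eventually_within _ ?_ ?_
    · have : Continuous fun r : ℝ => r - s := by fun_prop
      simpa using (this.tendsto s).mono_left nhdsWithin_le_nhds
    · filter_upwards [self_mem_nhdsWithin] with r hr
      exact sub_pos.2 (mem_Ioi.1 hr)
  refine (h1.comp h2).congr' ?_
  filter_upwards [self_mem_nhdsWithin] with r hr
  have hr' : s < r := hr
  have e : T (r - s) (T s u) = T r u := by
    have := hT.add (r - s) s (by linarith) hs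
    rw [sub_add_cancel] at this
    rw [this]; rfl
  rw [Function.comp_apply, e, slope_def_module, ofReal_smul_eq]

/-- The averages h⁻¹ ∫₀ʰ T r f dr lie in the domain, with image h⁻¹ (f - T h f), and tend to f as h
→ 0. -/
lemma exists_seq_tendsto (hT : IsSemigroupGeneratedByNeg L T) [CompleteSpace X] (f : X) :
    ∃ u w : ℕ → X, (∀ k, L (u k) (w k)) ∧ Tendsto u atTop (𝓝 f) := by
  -- Nothing is known about T at negative times; clamping the time at 0 makes the integrand
  -- continuous on all of ℝ.
  let c : ℝ → X := fun r => T (max r 0) f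
  have hc : Continuous c := by
    have := hT.continuous f
    exact this.comp_continuous (by fun_prop) fun r => mem_Ici.2 (le_max_right _ _)
  let F : ℝ → X := fun x => ∫ r in (0 : ℝ)..x, c r
  have hF : ∀ x, HasDerivAt F (c x) x := fun x => (hc.integral_hasStrictDerivAt 0 x).hasDerivAt
  have hL : ∀ h, 0 < h → L (F h) (f - T h f) := by
    intro h hh
    rw [hT.generator, neg_sub]
    have hd : HasDerivAt (fun ε => F (h + ε) - F ε) (c h - c 0) 0 := by
      have h1 : HasDerivAt (fun ε => F (h + ε)) (c h) 0 := by
        have := (hF (h + 0)).comp_const_add h 0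
        rwa [add_zero] at this
      exact h1.sub (hF 0)
    have hd' := (hasDerivWithinAt_iff_tendsto_slope' (s := Ioi 0) (by simp)).1 hd.hasDerivWithinAt
    have e0 : c h - c 0 = T h f - f := by
      simp only [c, max_eq_left hh.le, max_self, hT.zero]
      rfl
    rw [e0] at hd'
    refine hd'.congr' ?_
    filter_upwards [self_mem_nhdsWithin] with ε hε
    have hε' : 0 < ε := hε
    have e1 : T ε (F h) = F (h + ε) - F ε := by
      have i1 : T ε (F h) = ∫ r in (0 : ℝ)..h, T ε (c r) := by
        exact (((T ε).restrictScalars ℝ).intervalIntegral_comp_comm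
          (hc.intervalIntegrable _ _)).symm
      have i2 : ∫ r in (0 : ℝ)..h, T ε (c r) = ∫ r in (0 : ℝ)..h, c (r + ε) := by
        refine intervalIntegral.integral_congr fun r hr => ?_
        rw [uIcc_of_le hh.le] at hr
        simp only [c]
        rw [max_eq_left hr.1, max_eq_left (by linarith [hr.1]), add_comm r ε,
          hT.add ε r hε'.le hr.1]
        rfl
      rw [i1, i2, intervalIntegral.integral_comp_add_right, zero_add]
      exact (intervalIntegral.integral_interval_sub_left (hc.intervalIntegrable _ _)
        (hc.intervalIntegrable _ _)).symm
    rw [slope_def_module, e1, ofReal_smul_eq]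
    simp [F]
  have hlim : Tendsto (fun h : ℝ => h⁻¹ • F h) (𝓝[>] 0) (𝓝 f) := by
    have h0 := (hasDerivWithinAt_iff_tendsto_slope' (s := Ioi 0) (by simp)).1
      (hF 0).hasDerivWithinAt
    have e0 : c 0 = f := by simp [c, hT.zero]
    rw [e0] at h0
    refine h0.congr' (Eventually.of_forall fun h => ?_)
    simp [slope_def_module, F]
  have hseq : Tendsto (fun k : ℕ => ((k : ℝ) + 1)⁻¹) atTop (𝓝[>] 0) := by
    refine tendsto_nhdsWithin_of_tendsto_nhds_of_eventually_within _ ?_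
      (Eventually.of_forall fun k => ?_)
    · exact tendsto_inv_atTop_zero.comp
        (tendsto_atTop_add_const_right _ _ tendsto_natCast_atTop_atTop)
    · rw [mem_Ioi]; positivity
  have hsmul : ∀ (a : ℝ) (u w : X), L u w → L (a • u) (a • w) := by
    intro a u w h
    rw [hT.generator] at *
    have := h.const_smul (a : ℂ)
    rw [smul_neg, ofReal_smul_eq] at this
    refine this.congr' (Eventually.of_forall fun t => ?_)
    beta_reduce
    rw [← ofReal_smul_eq a u, map_smul, ← smul_sub, smul_comm]
  exact ⟨_, _, fun k => hsmul _ _ _ (hL (((k : ℝ) + 1)⁻¹) (by positivity)), hlim.comp hseq⟩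

end IsSemigroupGeneratedByNeg

/-! ### The sesquilinear form -/

section Form

variable {n : ℕ}

lemma enorm_sq_eq_lintegral {α E : Type*} [MeasurableSpace α] {ν : Measure α}
    [NormedAddCommGroup E] (f : Lp E 2 ν) : ‖f‖ₑ ^ 2 = ∫⁻ x, ‖f x‖ₑ ^ 2 ∂ν := by
  rw [Lp.enorm_def, eLpNorm_eq_lintegral_rpow_enorm_toReal (by norm_num) (by norm_num)]
  rw [← ENNReal.rpow_natCast, ← ENNReal.rpow_mul]
  norm_num

lemma norm_sq_eq_integral {α E : Type*} [MeasurableSpace α] {ν : Measure α}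
    [NormedAddCommGroup E] (f : Lp E 2 ν) : ‖f‖ ^ 2 = ∫ x, ‖f x‖ ^ 2 ∂ν := by
  rw [integral_eq_lintegral_of_nonneg_ae (Eventually.of_forall fun x => by positivity)
    (show AEStronglyMeasurable (fun x => ‖f x‖ ^ 2) ν from
      (Lp.aestronglyMeasurable f).norm.pow 2)]
  have : ∫⁻ x, ENNReal.ofReal (‖f x‖ ^ 2) ∂ν = ‖f‖ₑ ^ 2 := by
    rw [enorm_sq_eq_lintegral]
    refine lintegral_congr fun x => ?_
    rw [ENNReal.ofReal_pow (norm_nonneg _), ofReal_norm]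
  rw [this, ENNReal.toReal_pow, toReal_enorm]

/-- The sesquilinear form `A ξ · conj η`. -/
def form (M : Matrix (Fin n) (Fin n) ℂ) (ξ η : EuclideanSpace ℂ (Fin n)) : ℂ :=
  (M *ᵥ ξ.ofLp) ⬝ᵥ star η.ofLp

variable (M : Matrix (Fin n) (Fin n) ℂ)

lemma form_add_right (ξ η ζ : EuclideanSpace ℂ (Fin n)) :
    form M ξ (η + ζ) = form M ξ η + form M ξ ζ := by
  simp [form, dotProduct_add]

lemma form_smul_right (c : ℂ) (ξ η : EuclideanSpace ℂ (Fin n)) :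
    form M ξ (c • η) = star c * form M ξ η := by
  simp [form, dotProduct_smul]

lemma form_smul_left (c : ℂ) (ξ η : EuclideanSpace ℂ (Fin n)) :
    form M (c • ξ) η = c * form M ξ η := by
  simp [form, Matrix.mulVec_smul, smul_dotProduct]

lemma norm_form_le_of_unit {C : ℝ} (h : ∀ ξ η : EuclideanSpace ℂ (Fin n), ‖ξ‖ = 1 → ‖η‖ = 1 →
    ‖form M ξ η‖ ≤ C) (ξ η : EuclideanSpace ℂ (Fin n)) : ‖form M ξ η‖ ≤ C * ‖ξ‖ * ‖η‖ := by
  rcases eq_or_ne ξ 0 with rfl | hξ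
  · simp [form]
  rcases eq_or_ne η 0 with rfl | hη
  · simp [form]
  have e : ∀ ζ : EuclideanSpace ℂ (Fin n), ζ ≠ 0 →
      ‖((‖ζ‖⁻¹ : ℝ) : ℂ) • ζ‖ = 1 ∧ ζ = ((‖ζ‖ : ℝ) : ℂ) • (((‖ζ‖⁻¹ : ℝ) : ℂ) • ζ) := by
    intro ζ hζ
    have : ‖ζ‖ ≠ 0 := norm_ne_zero_iff.2 hζ
    constructor
    · rw [norm_smul, Complex.norm_real, norm_inv, norm_norm, inv_mul_cancel₀ this]
    · rw [smul_smul, ← Complex.ofReal_mul, mul_inv_cancel₀ this, Complex.ofReal_one, one_smul]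
  obtain ⟨h1, h2⟩ := e ξ hξ
  obtain ⟨h3, h4⟩ := e η hη
  have := h _ _ h1 h3
  rw [h2, h4, form_smul_left, form_smul_right, norm_mul, norm_mul, norm_star, Complex.norm_real,
    Complex.norm_real, norm_norm, norm_norm, ← h2, ← h4]
  have h5 : 0 ≤ ‖ξ‖ * ‖η‖ := by positivity
  nlinarith

variable {M}

/-- Pointwise Caccioppoli, with ξ = ∇u, w = ∇χ, c = χ and v = u: the second argument is then ∇(χ²u).
The cross term is absorbed by Young's inequality, which uses half of the coercivity. -/
lemma re_form_cutoff_ge {δ : ℝ} (hδ : 0 < δ) {ξ w : EuclideanSpace ℂ (Fin n)}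
    (hb : ‖form M ξ w‖ ≤ δ⁻¹ * ‖ξ‖ * ‖w‖) (hc : δ * ‖ξ‖ ^ 2 ≤ (form M ξ ξ).re)
    (c : ℝ) (v : ℂ) :
    δ / 2 * (|c| * ‖ξ‖) ^ 2 - 2 / δ ^ 3 * (‖w‖ * ‖v‖) ^ 2 ≤
      (form M ξ (((c ^ 2 : ℝ) : ℂ) • ξ + v • (((2 * c : ℝ) : ℂ) • w))).re := by
  rw [form_add_right, form_smul_right, smul_smul, form_smul_right, Complex.add_re]
  have e1 : (star ((c ^ 2 : ℝ) : ℂ) * form M ξ ξ).re = c ^ 2 * (form M ξ ξ).re := by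
    rw [Complex.star_def, Complex.conj_ofReal, Complex.re_ofReal_mul]
  have e2 : |(star (v * ((2 * c : ℝ) : ℂ)) * form M ξ w).re| ≤
      2 * (|c| * ‖ξ‖) * (δ⁻¹ * (‖w‖ * ‖v‖)) := by
    refine (Complex.abs_re_le_norm _).trans ?_
    rw [norm_mul, norm_star, norm_mul, Complex.norm_real, Real.norm_eq_abs, abs_mul, abs_two]
    calc ‖v‖ * (2 * |c|) * ‖form M ξ w‖ ≤ ‖v‖ * (2 * |c|) * (δ⁻¹ * ‖ξ‖ * ‖w‖) := by gcongr
      _ = _ := by ring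
  have e3 := (abs_le.1 e2).1
  have e4 : 2 * (|c| * ‖ξ‖) * (δ⁻¹ * (‖w‖ * ‖v‖)) ≤
      δ / 2 * (|c| * ‖ξ‖) ^ 2 + 2 / δ ^ 3 * (‖w‖ * ‖v‖) ^ 2 := by
    have e5 : 2 / δ ^ 3 = 2 / δ * (δ⁻¹) ^ 2 := by field_simp
    have e6 := two_mul_le_add_sq (δ / 2 * (|c| * ‖ξ‖)) (δ⁻¹ * (‖w‖ * ‖v‖))
    have e7 : δ / 2 * (2 * (|c| * ‖ξ‖) * (δ⁻¹ * (‖w‖ * ‖v‖))) ≤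
        δ / 2 * (δ / 2 * (|c| * ‖ξ‖) ^ 2 + 2 / δ ^ 3 * (‖w‖ * ‖v‖) ^ 2) := by
      calc _ = 2 * (δ / 2 * (|c| * ‖ξ‖)) * (δ⁻¹ * (‖w‖ * ‖v‖)) := by ring
        _ ≤ _ := e6
        _ = _ := by rw [e5]; field_simp
    exact le_of_mul_le_mul_left e7 (by positivity)
  have e8 : c ^ 2 * (δ * ‖ξ‖ ^ 2) ≤ c ^ 2 * (form M ξ ξ).re := by gcongr
  have e9 : (|c| * ‖ξ‖) ^ 2 = c ^ 2 * ‖ξ‖ ^ 2 := by rw [mul_pow, sq_abs]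
  rw [e1]
  rw [e9] at e4 ⊢
  linarith

variable {Ω : Set (Fin n → ℝ)} {A : (Fin n → ℝ) → Matrix (Fin n) (Fin n) ℂ} {δ : ℝ}

lemma IsElliptic.ae_norm_form_le (hA : IsElliptic δ A) :
    ∀ᵐ x ∂(volume.restrict Ω), ∀ ξ η, ‖form (A x) ξ η‖ ≤ δ⁻¹ * ‖ξ‖ * ‖η‖ := by
  filter_upwards [ae_restrict_of_ae hA.bounded] with x hx
  exact norm_form_le_of_unit _ hx

lemma IsElliptic.integrable_form (hA : IsElliptic δ A) (G H : L2Vec Ω) :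
    Integrable (fun x => form (A x) (G x) (H x)) (volume.restrict Ω) := by
  have hG : ∀ (G : L2Vec Ω) i, AEStronglyMeasurable (fun x => G x i) (volume.restrict Ω) :=
    fun G i => ((Lp.memLp G).continuousLinearMap_comp (EuclideanSpace.proj (𝕜 := ℂ) i)).1
  have hint : Integrable (fun x => δ⁻¹ * (‖G x‖ * ‖H x‖)) (volume.restrict Ω) :=
    ((Lp.memLp G).norm.integrable_mul (Lp.memLp H).norm).const_mul _
  refine hint.mono' ?_ ?_
  · simp only [form, dotProduct, Matrix.mulVec]
    refine Finset.aestronglyMeasurable_fun_sum _ fun i _ => AEStronglyMeasurable.mul ?_ ?_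
    · refine Finset.aestronglyMeasurable_fun_sum _ fun j _ => AEStronglyMeasurable.mul ?_ (hG G j)
      exact (hA.measurable i j).aestronglyMeasurable
    · exact continuous_star.comp_aestronglyMeasurable (hG H i)
  · filter_upwards [hA.ae_norm_form_le] with x hx
    exact (hx _ _).trans_eq (mul_assoc _ _ _)

/-- Caccioppoli's inequality for `u ∈ D(L)`. -/
lemma IsDivFormOperator.cutoff_estimate (hΩ : IsOpen Ω) (hA : IsElliptic δ A) (hδ : 0 < δ)
    {u w : L2 Ω} (h : IsDivFormOperator A (sobolevW0 Ω) u w) {χ : (Fin n → ℝ) → ℝ}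
    (hχ : IsCutoff χ) :
    δ / 2 * ‖mulOp hχ.memLp (weakGrad u)‖ ^ 2 - 2 / δ ^ 3 * ‖mulOp hχ.memLp_norm_grad u‖ ^ 2 ≤
      (inner ℂ (mulOp hχ.memLp u) (mulOp hχ.memLp w)).re := by
  -- The weak equation is tested against χ²u.
  obtain ⟨hmem, hgrad⟩ := hχ.sq.mulOp_mem_sobolevW0 hΩ h.1
  have h1 := h.2 _ hmem
  have h2 : inner ℂ (mulOp hχ.memLp u) (mulOp hχ.memLp w) =
      ∫ x in Ω, form (A x) (weakGrad u x) (weakGrad (mulOp hχ.sq.memLp u) x) := by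
    rw [L2.inner_def]
    refine Eq.trans (integral_congr_ae ?_) h1.symm
    filter_upwards [coeFn_mulOp hχ.memLp u, coeFn_mulOp hχ.memLp w,
      coeFn_mulOp hχ.sq.memLp u] with x e1 e2 e3
    rw [e1, e2, e3, Complex.real_smul, Complex.real_smul, Complex.real_smul]
    simp only [RCLike.inner_apply, map_mul, Complex.conj_ofReal, Complex.star_def]
    push_cast
    ring
  have hi1 : Integrable (fun x => (|χ x| * ‖weakGrad u x‖) ^ 2) (volume.restrict Ω) := by
    refine ((Lp.memLp (mulOp hχ.memLp (weakGrad u))).norm.integrable_sq).congr ?_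
    filter_upwards [coeFn_mulOp hχ.memLp (weakGrad u)] with x e1
    rw [e1, norm_smul, Real.norm_eq_abs]
  have hi2 : Integrable (fun x => (‖realGrad χ x‖ * ‖u x‖) ^ 2) (volume.restrict Ω) := by
    refine ((Lp.memLp (mulOp hχ.memLp_norm_grad u)).norm.integrable_sq).congr ?_
    filter_upwards [coeFn_mulOp hχ.memLp_norm_grad u] with x e1
    rw [e1, norm_smul, norm_norm]
  have e1 : ‖mulOp hχ.memLp (weakGrad u)‖ ^ 2 = ∫ x in Ω, (|χ x| * ‖weakGrad u x‖) ^ 2 := by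
    rw [norm_sq_eq_integral]
    refine integral_congr_ae ?_
    filter_upwards [coeFn_mulOp hχ.memLp (weakGrad u)] with x e1
    rw [e1, norm_smul, Real.norm_eq_abs]
  have e2 : ‖mulOp hχ.memLp_norm_grad u‖ ^ 2 = ∫ x in Ω, (‖realGrad χ x‖ * ‖u x‖) ^ 2 := by
    rw [norm_sq_eq_integral]
    refine integral_congr_ae ?_
    filter_upwards [coeFn_mulOp hχ.memLp_norm_grad u] with x e1
    rw [e1, norm_smul, norm_norm]
  have hi3 := hA.integrable_form (weakGrad u) (weakGrad (mulOp hχ.sq.memLp u))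
  rw [h2, e1, e2, ← integral_const_mul, ← integral_const_mul,
    ← integral_sub (hi1.const_mul _) (hi2.const_mul _)]
  have e3 : (∫ x in Ω, form (A x) (weakGrad u x) (weakGrad (mulOp hχ.sq.memLp u) x)).re =
      ∫ x in Ω, (form (A x) (weakGrad u x) (weakGrad (mulOp hχ.sq.memLp u) x)).re :=
    (integral_re hi3).symm
  rw [e3]
  refine integral_mono_ae ((hi1.const_mul _).sub (hi2.const_mul _)) hi3.re ?_
  rw [hgrad]
  filter_upwards [hA.ae_norm_form_le, coeFn_mulOp hχ.sq.memLp (weakGrad u),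
    coeFn_mulVecOp hχ.sq.memLp_grad u, Lp.coeFn_add (mulOp hχ.sq.memLp (weakGrad u))
      (mulVecOp hχ.sq.memLp_grad u)] with x e4 e5 e6 e7
  rw [e7, Pi.add_apply, e5, e6, hχ.realGrad_sq]
  exact re_form_cutoff_ge hδ (e4 _ _) (hA.coercive x _) _ _

/-- The weak equation is tested against u itself. Applied to differences, this makes the gradient
continuous in the graph norm of L. -/
lemma IsDivFormOperator.norm_weakGrad_sq_le (hA : IsElliptic δ A)
    {u w : L2 Ω} (h : IsDivFormOperator A (sobolevW0 Ω) u w) :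
    δ * ‖weakGrad u‖ ^ 2 ≤ ‖w‖ * ‖u‖ := by
  have h1 := h.2 u h.1
  have hi := hA.integrable_form (weakGrad u) (weakGrad u)
  have h2 : inner ℂ u w = ∫ x in Ω, form (A x) (weakGrad u x) (weakGrad u x) := by
    rw [L2.inner_def]
    refine Eq.trans (integral_congr_ae (Eventually.of_forall fun x => ?_)) h1.symm
    simp [RCLike.inner_apply]
  calc δ * ‖weakGrad u‖ ^ 2 = ∫ x in Ω, δ * ‖weakGrad u x‖ ^ 2 := by
        rw [norm_sq_eq_integral, integral_const_mul]
    _ ≤ ∫ x in Ω, (form (A x) (weakGrad u x) (weakGrad u x)).re := by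
        refine integral_mono ((Lp.memLp (weakGrad u)).norm.integrable_sq.const_mul _) hi.re ?_
        exact fun x => hA.coercive x _
    _ = (inner ℂ u w).re := by rw [h2]; exact integral_re hi
    _ ≤ ‖w‖ * ‖u‖ := by
        rw [mul_comm]
        exact (Complex.re_le_norm _).trans (norm_inner_le_norm u w)

end Form

/-! ### Energy inequality for the semigroup -/

section Energy

variable {n : ℕ} {Ω : Set (Fin n → ℝ)} {A : (Fin n → ℝ) → Matrix (Fin n) (Fin n) ℂ} {δ : ℝ}
  {T : ℝ → L2 Ω →L[ℂ] L2 Ω}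

lemma continuousOn_weakGrad (hΩ : IsOpen Ω) (hA : IsElliptic δ A) (hδ : 0 < δ)
    (hT : IsSemigroupGeneratedByNeg (IsDivFormOperator A (sobolevW0 Ω)) T) {u w : L2 Ω}
    (h : IsDivFormOperator A (sobolevW0 Ω) u w) :
    ContinuousOn (fun s => weakGrad (T s u)) (Ici 0) := by
  intro s hs
  have hu : Tendsto (fun r => T r u - T s u) (𝓝[Ici 0] s) (𝓝 0) := by
    simpa using (hT.continuous u s hs).sub_const (T s u)
  have hw : Tendsto (fun r => T r w - T s w) (𝓝[Ici 0] s) (𝓝 0) := by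
    simpa using (hT.continuous w s hs).sub_const (T s w)
  have hlim : Tendsto (fun r => Real.sqrt (δ⁻¹ * (‖T r w - T s w‖ * ‖T r u - T s u‖)))
      (𝓝[Ici 0] s) (𝓝 0) := by
    have := (((hw.norm.mul hu.norm).const_mul δ⁻¹)).sqrt
    simpa using this
  rw [ContinuousWithinAt, tendsto_iff_norm_sub_tendsto_zero]
  refine squeeze_zero' (Eventually.of_forall fun _ => norm_nonneg _) ?_ hlim
  filter_upwards [self_mem_nhdsWithin] with r hr
  have h1 := hT.generator_map h (mem_Ici.1 hr)
  have h2 := hT.generator_map h (mem_Ici.1 hs)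
  rw [← (sub_mem_sobolevW0 hΩ h1.1 h2.1).2]
  refine Real.le_sqrt_of_sq_le ?_
  have := (hT.generator_sub h1 h2).norm_weakGrad_sq_le hA
  rw [inv_mul_eq_div, le_div_iff₀ hδ]
  linarith

lemma lintegral_enorm_sq_eq {E : Type*} [NormedAddCommGroup E] {F : ℝ → E} {a b : ℝ} (hab : a ≤ b)
    (hF : ContinuousOn F (Icc a b)) :
    ∫⁻ s in Ioc a b, ‖F s‖ₑ ^ 2 = ENNReal.ofReal (∫ s in a..b, ‖F s‖ ^ 2) := by
  have hi : IntegrableOn (fun s => ‖F s‖ ^ 2) (Ioc a b) :=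
    ((hF.norm.pow 2).integrableOn_Icc).mono_set Ioc_subset_Icc_self
  rw [intervalIntegral.integral_of_le hab, ofReal_integral_eq_lintegral_ofReal hi
    (Eventually.of_forall fun s => by positivity)]
  refine lintegral_congr fun s => ?_
  rw [ENNReal.ofReal_pow (norm_nonneg _), ofReal_norm]

/-- For data in the domain, d/ds ‖χ T s u‖² = -2 Re ⟨χ T s u, χ T s w⟩, which the Caccioppoli
inequality bounds from above; the result is integrated over [a, b]. -/
lemma energy_of_mem_domain (hΩ : IsOpen Ω) (hA : IsElliptic δ A) (hδ : 0 < δ)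
    (hT : IsSemigroupGeneratedByNeg (IsDivFormOperator A (sobolevW0 Ω)) T) {u w : L2 Ω}
    (h : IsDivFormOperator A (sobolevW0 Ω) u w) {χ : (Fin n → ℝ) → ℝ} (hχ : IsCutoff χ)
    {a b : ℝ} (ha : 0 ≤ a) (hab : a ≤ b) :
    ENNReal.ofReal δ * (∫⁻ s in Ioc a b, ‖mulOp hχ.memLp (weakGrad (T s u))‖ₑ ^ 2) +
        ‖mulOp hχ.memLp (T b u)‖ₑ ^ 2 ≤
      ‖mulOp hχ.memLp (T a u)‖ₑ ^ 2 +
        ENNReal.ofReal (4 / δ ^ 3) *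
          ∫⁻ s in Ioc a b, ‖mulOp hχ.memLp_norm_grad (T s u)‖ₑ ^ 2 := by
  have hsub : Icc a b ⊆ Ici 0 := fun s hs => ha.trans hs.1
  have hcu : ContinuousOn (fun s => mulOp hχ.memLp (T s u)) (Icc a b) :=
    (mulOp hχ.memLp).continuous.comp_continuousOn ((hT.continuous u).mono hsub)
  have hcp : ContinuousOn (fun s => mulOp hχ.memLp (weakGrad (T s u))) (Icc a b) :=
    (mulOp hχ.memLp).continuous.comp_continuousOn
      ((continuousOn_weakGrad hΩ hA hδ hT h).mono hsub)
  have hcq : ContinuousOn (fun s => mulOp hχ.memLp_norm_grad (T s u)) (Icc a b) :=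
    (mulOp hχ.memLp_norm_grad).continuous.comp_continuousOn ((hT.continuous u).mono hsub)
  have hp := hcp.norm.pow 2
  have hq := hcq.norm.pow 2
  have key := intervalIntegral.sub_le_integral_of_hasDeriv_right_of_le
    (g := fun s => ‖mulOp hχ.memLp (T s u)‖ ^ 2)
    (g' := fun s => 2 * inner ℝ (mulOp hχ.memLp (T s u)) (mulOp hχ.memLp (-T s w)))
    (φ := fun s => 4 / δ ^ 3 * ‖mulOp hχ.memLp_norm_grad (T s u)‖ ^ 2 -
      δ * ‖mulOp hχ.memLp (weakGrad (T s u))‖ ^ 2) hab (hcu.norm.pow 2) ?_ ?_ ?_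
  · rw [intervalIntegral.integral_sub, intervalIntegral.integral_const_mul,
      intervalIntegral.integral_const_mul] at key
    · rw [lintegral_enorm_sq_eq hab hcp, lintegral_enorm_sq_eq hab hcq]
      have e : ∀ v : L2 Ω, ‖v‖ₑ ^ 2 = ENNReal.ofReal (‖v‖ ^ 2) := fun v => by
        rw [ENNReal.ofReal_pow (norm_nonneg _), ofReal_norm]
      have i1 : 0 ≤ ∫ s in a..b, ‖mulOp hχ.memLp (weakGrad (T s u))‖ ^ 2 :=
        intervalIntegral.integral_nonneg hab fun s _ => by positivity
      have i2 : 0 ≤ ∫ s in a..b, ‖mulOp hχ.memLp_norm_grad (T s u)‖ ^ 2 :=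
        intervalIntegral.integral_nonneg hab fun s _ => by positivity
      rw [e, e, ← ENNReal.ofReal_mul hδ.le, ← ENNReal.ofReal_mul (by positivity),
        ← ENNReal.ofReal_add (by positivity) (by positivity),
        ← ENNReal.ofReal_add (by positivity) (by positivity)]
      refine ENNReal.ofReal_le_ofReal ?_
      linarith
    · exact (hq.intervalIntegrable_of_Icc hab).const_mul _
    · exact (hp.intervalIntegrable_of_Icc hab).const_mul _
  · intro s hs
    have hd := hT.hasDerivWithinAt h (ha.trans hs.1.le)
    exact ((mulOp hχ.memLp).hasFDerivAt.comp_hasDerivWithinAt s hd).norm_sq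
  · exact ((continuousOn_const.mul hq).sub (continuousOn_const.mul hp)).integrableOn_Icc
  · intro s hs
    have := (hT.generator_map h (ha.trans hs.1.le)).cutoff_estimate hΩ hA hδ hχ
    have e : inner ℝ (mulOp hχ.memLp (T s u)) (mulOp hχ.memLp (-T s w)) =
        -(inner ℂ (mulOp hχ.memLp (T s u)) (mulOp hχ.memLp (T s w))).re := by
      rw [map_neg, inner_neg_right, L2.inner_def, L2.inner_def]
      congr 1
      exact integral_re (L2.integrable_inner _ _)
    simp only [e]
    have e4 : 4 / δ ^ 3 = 2 * (2 / δ ^ 3) := by ring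
    rw [e4]
    linarith

lemma mulOp_one {E : Type*} [NormedAddCommGroup E] [NormedSpace ℝ E]
    (hg : MemLp (fun _ : Fin n → ℝ => (1 : ℝ)) ∞ (volume.restrict Ω))
    (u : Lp E 2 (volume.restrict Ω)) : mulOp hg u = u := by
  refine Lp.ext ?_
  filter_upwards [coeFn_mulOp hg u] with x hx
  rw [hx, one_smul]

lemma mulOp_norm_grad_const (c : ℝ) (u : L2 Ω) :
    mulOp (IsCutoff.const (n := n) c).memLp_norm_grad u = 0 := by
  refine Lp.ext ?_
  filter_upwards [coeFn_mulOp (IsCutoff.const (n := n) c).memLp_norm_grad u,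
    Lp.coeFn_zero ℂ 2 (volume.restrict Ω)] with x hx h0
  have : realGrad (fun _ : Fin n → ℝ => c) x = 0 := by
    ext i
    simp [realGrad, classicalGrad_apply]
  rw [hx, h0, this]
  simp

lemma energy_global_of_mem_domain (hΩ : IsOpen Ω) (hA : IsElliptic δ A) (hδ : 0 < δ)
    (hT : IsSemigroupGeneratedByNeg (IsDivFormOperator A (sobolevW0 Ω)) T) {u w : L2 Ω}
    (h : IsDivFormOperator A (sobolevW0 Ω) u w) {b : ℝ} (hb : 0 ≤ b) :
    ENNReal.ofReal δ * (∫⁻ s in Ioc 0 b, ‖weakGrad (T s u)‖ₑ ^ 2) + ‖T b u‖ₑ ^ 2 ≤ ‖u‖ₑ ^ 2 := by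
  have := energy_of_mem_domain hΩ hA hδ hT h (IsCutoff.const 1) le_rfl hb
  simpa [mulOp_one, mulOp_norm_grad_const, hT.zero] using this

lemma norm_le_of_mem_domain (hΩ : IsOpen Ω) (hA : IsElliptic δ A) (hδ : 0 < δ)
    (hT : IsSemigroupGeneratedByNeg (IsDivFormOperator A (sobolevW0 Ω)) T) {u w : L2 Ω}
    (h : IsDivFormOperator A (sobolevW0 Ω) u w) {b : ℝ} (hb : 0 ≤ b) : ‖T b u‖ ≤ ‖u‖ := by
  have := le_add_self.trans (energy_global_of_mem_domain hΩ hA hδ hT h hb)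
  have h2 := (ENNReal.pow_le_pow_left_iff two_ne_zero).1 this
  rw [← ofReal_norm, ← ofReal_norm] at h2
  exact (ENNReal.ofReal_le_ofReal_iff (norm_nonneg _)).1 h2

/-- The global energy bound does not depend on the final time. It controls the gradients in L²((0,
∞); L²) by the initial datum alone, which makes the passage to general f possible. -/
lemma lintegral_Ioi_of_mem_domain (hΩ : IsOpen Ω) (hA : IsElliptic δ A) (hδ : 0 < δ)
    (hT : IsSemigroupGeneratedByNeg (IsDivFormOperator A (sobolevW0 Ω)) T) {u w : L2 Ω}
    (h : IsDivFormOperator A (sobolevW0 Ω) u w) :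
    ENNReal.ofReal δ * ∫⁻ s in Ioi 0, ‖weakGrad (T s u)‖ₑ ^ 2 ≤ ‖u‖ₑ ^ 2 := by
  have e : Ioi (0 : ℝ) = ⋃ k : ℕ, Ioc 0 (k : ℝ) := by
    ext s
    simp only [mem_Ioi, mem_iUnion, mem_Ioc]
    exact ⟨fun hs => (exists_nat_ge s).imp fun k hk => ⟨hs, hk⟩, fun ⟨_, hs, _⟩ => hs⟩
  rw [e, setLIntegral_iUnion_of_directed, ENNReal.mul_iSup]
  · exact iSup_le fun k => le_self_add.trans
      (energy_global_of_mem_domain hΩ hA hδ hT h (Nat.cast_nonneg k))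
  · refine Monotone.directed_le fun k l hkl => Ioc_subset_Ioc_right ?_
    exact_mod_cast hkl

/-- Approximation of `f ∈ L²` by elements of `D(L)`, with convergence of the gradients of the
evolutions at almost every time. -/
lemma exists_approx (hΩ : IsOpen Ω) (hA : IsElliptic δ A) (hδ : 0 < δ)
    (hT : IsSemigroupGeneratedByNeg (IsDivFormOperator A (sobolevW0 Ω)) T) (f : L2 Ω) :
    ∃ u w : ℕ → L2 Ω, (∀ k, IsDivFormOperator A (sobolevW0 Ω) (u k) (w k)) ∧
      Tendsto u atTop (𝓝 f) ∧
      ∀ᵐ s ∂(volume.restrict (Ioi 0)),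
        Tendsto (fun k => weakGrad (T s (u k))) atTop (𝓝 (weakGrad (T s f))) := by
  obtain ⟨u₀, w₀, hL₀, hlim₀⟩ := hT.exists_seq_tendsto f
  -- A geometric rate makes the Cauchy moduli summable, so that the gradients converge at almost
  -- every time along the whole sequence.
  have hch : ∀ k : ℕ, ∃ m, ‖u₀ m - f‖ < (1 / 2) ^ (k + 1) := fun k => by
    obtain ⟨m, hm⟩ := (Metric.tendsto_nhds.1 hlim₀ ((1 / 2) ^ (k + 1)) (by positivity)).exists
    exact ⟨m, by rwa [← dist_eq_norm]⟩
  choose m hm using hch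
  set u := fun k => u₀ (m k)
  set w := fun k => w₀ (m k)
  have hL : ∀ k, IsDivFormOperator A (sobolevW0 Ω) (u k) (w k) := fun k => hL₀ _
  have hlim : Tendsto u atTop (𝓝 f) := by
    rw [tendsto_iff_norm_sub_tendsto_zero]
    refine squeeze_zero (fun _ => norm_nonneg _) (fun k => (hm k).le) ?_
    exact (tendsto_pow_atTop_nhds_zero_of_lt_one (by norm_num) (by norm_num)).comp
      (tendsto_add_atTop_nat 1)
  have hcauchy : ∀ N k l : ℕ, N ≤ k → N ≤ l → ‖u k - u l‖ < (1 / 2) ^ N := by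
    intro N k l hk hl
    have h1 : ∀ j, N ≤ j → ‖u j - f‖ < (1 / 2) ^ (N + 1) := fun j hj =>
      (hm j).trans_le (pow_le_pow_of_le_one (by norm_num) (by norm_num) (by omega))
    calc ‖u k - u l‖ ≤ ‖u k - f‖ + ‖u l - f‖ := by
          simpa using norm_sub_le (u k - f) (u l - f)
      _ < (1 / 2) ^ (N + 1) + (1 / 2) ^ (N + 1) := add_lt_add (h1 k hk) (h1 l hl)
      _ = (1 / 2) ^ N := by ring
  refine ⟨u, w, hL, hlim, ?_⟩
  have hmeas : ∀ k, AEStronglyMeasurable (fun s => weakGrad (T s (u k)))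
      (volume.restrict (Ioi 0)) := fun k =>
    ((continuousOn_weakGrad hΩ hA hδ hT (hL k)).mono Ioi_subset_Ici_self).aestronglyMeasurable
      measurableSet_Ioi
  have hsum : ∑' N : ℕ, ENNReal.ofReal (Real.sqrt δ⁻¹ * (1 / 2) ^ N) ≠ ⊤ := by
    rw [← ENNReal.ofReal_tsum_of_nonneg (fun N => by positivity)]
    · exact ENNReal.ofReal_ne_top
    · exact (summable_geometric_of_lt_one (by norm_num) (by norm_num)).mul_left _
  have hae := Lp.ae_tendsto_of_cauchy_eLpNorm hmeas (p := 2) (by norm_num) hsum ?_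
  · filter_upwards [hae, ae_restrict_mem measurableSet_Ioi] with s ⟨G, hG⟩ hs
    have hs0 : (0 : ℝ) ≤ s := le_of_lt hs
    -- Closedness of the gradient identifies the limit G with the gradient of T s f.
    have := mem_sobolevW0_of_tendsto hΩ (fun k => (hT.generator_map (hL k) hs0).1)
      (((T s).continuous.tendsto f).comp hlim) hG
    rw [this.2]
    exact hG
  · intro N k l hk hl
    have hlt : eLpNorm ((fun s => weakGrad (T s (u k))) - fun s => weakGrad (T s (u l))) 2
        (volume.restrict (Ioi 0)) ≤ ENNReal.ofReal (Real.sqrt δ⁻¹ * ‖u k - u l‖) := by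
      rw [eLpNorm_eq_lintegral_rpow_enorm_toReal (by norm_num) (by norm_num)]
      have e : ∫⁻ s in Ioi 0, ‖((fun s => weakGrad (T s (u k))) -
          fun s => weakGrad (T s (u l))) s‖ₑ ^ (2 : ℝ≥0∞).toReal =
          ∫⁻ s in Ioi 0, ‖weakGrad (T s (u k - u l))‖ₑ ^ 2 := by
        refine setLIntegral_congr_fun measurableSet_Ioi fun s hs => ?_
        have hs0 : (0 : ℝ) ≤ s := le_of_lt hs
        simp only [Pi.sub_apply, map_sub]
        rw [(sub_mem_sobolevW0 hΩ (hT.generator_map (hL k) hs0).1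
          (hT.generator_map (hL l) hs0).1).2]
        norm_num
      have h1 := lintegral_Ioi_of_mem_domain hΩ hA hδ hT (hT.generator_sub (hL k) (hL l))
      rw [e]
      have h2 : ∫⁻ s in Ioi 0, ‖weakGrad (T s (u k - u l))‖ₑ ^ 2 ≤
          ENNReal.ofReal ((Real.sqrt δ⁻¹ * ‖u k - u l‖) ^ 2) := by
        rw [mul_pow, Real.sq_sqrt (by positivity), ENNReal.ofReal_mul (by positivity),
          ENNReal.ofReal_inv_of_pos hδ, ENNReal.ofReal_pow (norm_nonneg _), ofReal_norm]
        rw [mul_comm, ← div_eq_mul_inv, ENNReal.le_div_iff_mul_le, mul_comm]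
        · exact h1
        · exact Or.inl (by simpa using hδ)
        · exact Or.inl ENNReal.ofReal_ne_top
      refine (ENNReal.rpow_le_rpow h2 (by positivity)).trans_eq ?_
      rw [ENNReal.ofReal_rpow_of_nonneg (by positivity) (by positivity),
        ENNReal.toReal_ofNat, ← Real.sqrt_eq_rpow]
      · congr 1
        exact Real.sqrt_sq (by positivity)
    refine hlt.trans_lt ?_
    have : 0 < Real.sqrt δ⁻¹ := Real.sqrt_pos.2 (by positivity)
    rw [ENNReal.ofReal_lt_ofReal_iff (by positivity)]
    exact mul_lt_mul_of_pos_left (hcauchy N k l hk hl) this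

/-- Local energy inequality for `e^{-sL} f`, `f ∈ L²(Ω)`. -/
theorem energy_inequality (hΩ : IsOpen Ω) (hA : IsElliptic δ A) (hδ : 0 < δ)
    (hT : IsSemigroupGeneratedByNeg (IsDivFormOperator A (sobolevW0 Ω)) T) (f : L2 Ω)
    {χ : (Fin n → ℝ) → ℝ} (hχ : IsCutoff χ) {a b : ℝ} (ha : 0 ≤ a) (hab : a ≤ b) :
    ENNReal.ofReal δ * (∫⁻ s in Ioc a b, ‖mulOp hχ.memLp (weakGrad (T s f))‖ₑ ^ 2) +
        ‖mulOp hχ.memLp (T b f)‖ₑ ^ 2 ≤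
      ‖mulOp hχ.memLp (T a f)‖ₑ ^ 2 +
        ENNReal.ofReal (4 / δ ^ 3) *
          ∫⁻ s in Ioc a b, ‖mulOp hχ.memLp_norm_grad (T s f)‖ₑ ^ 2 := by
  obtain ⟨u, w, hL, hlim, hae⟩ := exists_approx hΩ hA hδ hT f
  have hIoc : Ioc a b ⊆ Ioi 0 := fun s hs => ha.trans_lt hs.1
  have hIoc' : Ioc a b ⊆ Ici 0 := fun s hs => ha.trans hs.1.le
  set P := ∫⁻ s in Ioc a b, ‖mulOp hχ.memLp (weakGrad (T s f))‖ₑ ^ 2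
  set P' : ℕ → ℝ≥0∞ := fun k => ∫⁻ s in Ioc a b, ‖mulOp hχ.memLp (weakGrad (T s (u k)))‖ₑ ^ 2
  set Q := ∫⁻ s in Ioc a b, ‖mulOp hχ.memLp_norm_grad (T s f)‖ₑ ^ 2
  set Q' : ℕ → ℝ≥0∞ := fun k => ∫⁻ s in Ioc a b, ‖mulOp hχ.memLp_norm_grad (T s (u k))‖ₑ ^ 2
  -- Fatou suffices for the gradient term, which is on the smaller side; the other terms converge.
  have hP : P ≤ liminf P' atTop := by
    refine le_trans (le_of_eq ?_) (lintegral_liminf_le' fun k => ?_)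
    · refine lintegral_congr_ae ?_
      filter_upwards [ae_restrict_of_ae_restrict_of_subset hIoc hae] with s hs
      have : Tendsto (fun k => ‖mulOp hχ.memLp (weakGrad (T s (u k)))‖ₑ ^ 2) atTop
          (𝓝 (‖mulOp hχ.memLp (weakGrad (T s f))‖ₑ ^ 2)) :=
        ((ENNReal.continuous_pow 2).tendsto _).comp
          ((((mulOp hχ.memLp).continuous.tendsto _).comp hs).enorm)
      exact this.liminf_eq.symm
    · have h1 : ContinuousOn (fun s => mulOp hχ.memLp (weakGrad (T s (u k)))) (Ioc a b) :=
        (mulOp hχ.memLp).continuous.comp_continuousOn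
          ((continuousOn_weakGrad hΩ hA hδ hT (hL k)).mono hIoc')
      exact ((h1.aestronglyMeasurable measurableSet_Ioc).enorm).pow_const 2
  have hQ : Tendsto Q' atTop (𝓝 Q) := by
    obtain ⟨C, hC⟩ := hlim.norm.bddAbove_range
    refine tendsto_lintegral_of_dominated_convergence'
      (fun _ => ENNReal.ofReal (‖(mulOp hχ.memLp_norm_grad : L2 Ω →L[ℝ] L2 Ω)‖ * C) ^ 2) (fun k => ?_)
      (fun k => ?_) ?_ ?_
    · have h1 : ContinuousOn (fun s => mulOp hχ.memLp_norm_grad (T s (u k))) (Ioc a b) :=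
        (mulOp hχ.memLp_norm_grad).continuous.comp_continuousOn
          ((hT.continuous (u k)).mono hIoc')
      exact ((h1.aestronglyMeasurable measurableSet_Ioc).enorm).pow_const 2
    · filter_upwards [ae_restrict_mem measurableSet_Ioc] with s hs
      rw [← ofReal_norm]
      gcongr
      refine (ContinuousLinearMap.le_opNorm _ _).trans ?_
      gcongr
      exact (norm_le_of_mem_domain hΩ hA hδ hT (hL k) (hIoc' hs)).trans (hC ⟨k, rfl⟩)
    · rw [lintegral_const]
      refine ENNReal.mul_ne_top (ENNReal.pow_ne_top ENNReal.ofReal_ne_top) ?_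
      simp
    · refine Eventually.of_forall fun s => ?_
      exact ((ENNReal.continuous_pow 2).tendsto _).comp
        ((((mulOp hχ.memLp_norm_grad).continuous.comp (T s).continuous).tendsto f).comp hlim).enorm
  have he : ∀ s, Tendsto (fun k => ‖mulOp hχ.memLp (T s (u k))‖ₑ ^ 2) atTop
      (𝓝 (‖mulOp hχ.memLp (T s f)‖ₑ ^ 2)) := fun s =>
    ((ENNReal.continuous_pow 2).tendsto _).comp
      ((((mulOp hχ.memLp).continuous.comp (T s).continuous).tendsto f).comp hlim).enorm
  have hk := fun k => energy_of_mem_domain hΩ hA hδ hT (hL k) hχ ha hab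
  have hR := (he a).add (ENNReal.Tendsto.const_mul (a := ENNReal.ofReal (4 / δ ^ 3)) hQ
    (Or.inr ENNReal.ofReal_ne_top))
  have hfin : ‖mulOp hχ.memLp (T b f)‖ₑ ^ 2 ≠ ⊤ := by simp
  -- The finite term at time b is moved to the right, so that only the gradient term is left under
  -- the lower limit.
  have h1 : ENNReal.ofReal δ * P ≤ ‖mulOp hχ.memLp (T a f)‖ₑ ^ 2 +
      ENNReal.ofReal (4 / δ ^ 3) * Q - ‖mulOp hχ.memLp (T b f)‖ₑ ^ 2 := by
    have h2 := ENNReal.Tendsto.sub hR (he b) (Or.inr hfin)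
    rw [← h2.liminf_eq]
    calc ENNReal.ofReal δ * P ≤ ENNReal.ofReal δ * liminf P' atTop := by gcongr
      _ = liminf (fun k => ENNReal.ofReal δ * P' k) atTop :=
        (ENNReal.liminf_const_mul_of_ne_zero_of_ne_top (by simpa using hδ)
          ENNReal.ofReal_ne_top).symm
      _ ≤ _ := by
        refine liminf_le_liminf (Eventually.of_forall fun k => ?_)
        exact ENNReal.le_sub_of_add_le_right (by simp) (hk k)
  have h3 : ‖mulOp hχ.memLp (T b f)‖ₑ ^ 2 ≤ ‖mulOp hχ.memLp (T a f)‖ₑ ^ 2 +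
      ENNReal.ofReal (4 / δ ^ 3) * Q :=
    le_of_tendsto_of_tendsto (he b) hR (Eventually.of_forall fun k => le_add_self.trans (hk k))
  calc _ ≤ _ := add_le_add_left h1 _
    _ = _ := tsub_add_cancel_of_le h3

end Energy

/-! ### Smooth cutoff functions adapted to neighbourhoods of a set -/

section Cutoff

variable {n : ℕ}

lemma realGrad_apply {χ : (Fin n → ℝ) → ℝ} {x : Fin n → ℝ} (h : DifferentiableAt ℝ χ x)
    (i : Fin n) : realGrad χ x i = (fderiv ℝ χ x (Pi.single i 1) : ℝ) := by
  have := (Complex.ofRealCLM.hasFDerivAt.comp x h.hasFDerivAt).fderiv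
  rw [realGrad, classicalGrad_apply]
  exact DFunLike.congr_fun this (Pi.single i 1)

lemma norm_realGrad_le {χ : (Fin n → ℝ) → ℝ} {x : Fin n → ℝ} (h : DifferentiableAt ℝ χ x) {D : ℝ}
    (hD : ‖fderiv ℝ χ x‖ ≤ D) : ‖realGrad χ x‖ ≤ Real.sqrt n * D := by
  have hD0 : 0 ≤ D := (norm_nonneg _).trans hD
  rw [EuclideanSpace.norm_eq, ← Real.sqrt_sq hD0, ← Real.sqrt_mul (by positivity)]
  refine Real.sqrt_le_sqrt ?_
  calc ∑ i, ‖realGrad χ x i‖ ^ 2 ≤ ∑ _i : Fin n, D ^ 2 := by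
        refine Finset.sum_le_sum fun i _ => ?_
        gcongr
        rw [realGrad_apply h, Complex.norm_real]
        refine ((fderiv ℝ χ x).le_opNorm _).trans ?_
        rw [Pi.norm_single, norm_one, mul_one]
        exact hD
    _ = n * D ^ 2 := by simp

lemma realGrad_eq_zero {χ : (Fin n → ℝ) → ℝ} {x : Fin n → ℝ} (h : DifferentiableAt ℝ χ x)
    (h0 : fderiv ℝ χ x = 0) : realGrad χ x = 0 := by
  ext i
  simp [realGrad_apply h, h0]

variable (n) in
-- The indicator of the 3/2-neighbourhood of E is mollified by a bump supported at distance at most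
-- 1/4. The derivative falls on the bump, so the bound K = ∫ ‖∇f‖ is the same for all E.
lemma exists_unit_cutoff : ∃ K : ℝ, 0 ≤ K ∧ ∀ E : Set (Fin n → ℝ), ∃ χ : (Fin n → ℝ) → ℝ,
    ContDiff ℝ ∞ χ ∧ (∀ x, 0 ≤ χ x ∧ χ x ≤ 1) ∧ (∀ x ∈ Metric.thickening 1 E, χ x = 1) ∧
    (∀ x ∉ Metric.thickening 2 E, χ x = 0) ∧ ∀ x, ‖fderiv ℝ χ x‖ ≤ K := by
  let φ : ContDiffBump (0 : Fin n → ℝ) := ⟨1 / 8, 1 / 4, by norm_num, by norm_num⟩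
  let f : (Fin n → ℝ) → ℝ := φ.normed volume
  have hf : ContDiff ℝ ∞ f := φ.contDiff_normed
  have hfc : HasCompactSupport f := φ.hasCompactSupport_normed
  have hfi : ∫ x, f x = 1 := φ.integral_normed
  have hfint : Integrable f := φ.integrable_normed
  have hf0 : ∀ x, 0 ≤ f x := φ.nonneg_normed
  have hfs : ∀ x, f x ≠ 0 → ‖x‖ < 1 / 4 := by
    intro x hx
    have : x ∈ Function.support (φ.normed volume) := hx
    rw [φ.support_normed_eq, mem_ball_zero_iff] at this
    exact this
  refine ⟨∫ x, ‖fderiv ℝ f x‖, integral_nonneg fun _ => norm_nonneg _, fun E => ?_⟩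
  let U := Metric.thickening (3 / 2) E
  let g : (Fin n → ℝ) → ℝ := U.indicator fun _ => 1
  have hg0 : ∀ x, 0 ≤ g x := fun x => indicator_nonneg (fun _ _ => zero_le_one) x
  have hg1 : ∀ x, g x ≤ 1 := fun x => indicator_le_self' (fun _ _ => zero_le_one) x
  have hU : MeasurableSet U := Metric.isOpen_thickening.measurableSet
  have hgm : Measurable g := measurable_const.indicator hU
  have hgl : LocallyIntegrable g :=
    (locallyIntegrable_const (1 : ℝ)).mono hgm.aestronglyMeasurable
      (Eventually.of_forall fun x => by
        rw [Real.norm_of_nonneg (hg0 x), norm_one]; exact hg1 x)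
  let χ : (Fin n → ℝ) → ℝ := convolution f g (ContinuousLinearMap.lsmul ℝ ℝ) volume
  have hχ : ∀ x, χ x = ∫ t, f t * g (x - t) := fun x => rfl
  have hint : ∀ x, Integrable fun t => f t * g (x - t) := fun x =>
    hfint.mul_bdd (c := 1) (hgm.comp (measurable_const.sub measurable_id)).aestronglyMeasurable
      (Eventually.of_forall fun t => by rw [Real.norm_of_nonneg (hg0 _)]; exact hg1 _)
  refine ⟨χ, hfc.contDiff_convolution_left _ hf hgl, fun x => ⟨?_, ?_⟩, fun x hx => ?_,
    fun x hx => ?_, fun x => ?_⟩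
  · exact integral_nonneg fun t => mul_nonneg (hf0 t) (hg0 _)
  · rw [hχ, ← hfi]
    exact integral_mono (hint x) hfint fun t => mul_le_of_le_one_right (hf0 t) (hg1 _)
  · rw [hχ, ← hfi]
    refine integral_congr_ae (Eventually.of_forall fun t => ?_)
    show f t * g (x - t) = f t
    by_cases ht : f t = 0
    · simp [ht]
    · have : x - t ∈ U := by
        obtain ⟨z, hz, hxz⟩ := Metric.mem_thickening_iff.1 hx
        refine Metric.mem_thickening_iff.2 ⟨z, hz, ?_⟩
        have h1 := hfs t ht
        have h2 : dist (x - t) x = ‖t‖ := by rw [dist_eq_norm]; simp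
        have := dist_triangle (x - t) x z
        linarith
      simp [g, this]
  · rw [hχ]
    refine integral_eq_zero_of_ae (Eventually.of_forall fun t => ?_)
    show f t * g (x - t) = 0
    by_cases ht : f t = 0
    · simp [ht]
    · have : x - t ∉ U := by
        intro hxt
        obtain ⟨z, hz, hxz⟩ := Metric.mem_thickening_iff.1 hxt
        refine hx (Metric.mem_thickening_iff.2 ⟨z, hz, ?_⟩)
        have h1 := hfs t ht
        have h2 : dist x (x - t) = ‖t‖ := by rw [dist_eq_norm]; simp
        have := dist_triangle x (x - t) z
        linarith
      simp [g, this]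
  · rw [(hfc.hasFDerivAt_convolution_left (ContinuousLinearMap.lsmul ℝ ℝ) (hf.of_le (by simp))
      hgl x).fderiv]
    refine (norm_integral_le_integral_norm _).trans ?_
    refine integral_mono_of_nonneg (Eventually.of_forall fun _ => norm_nonneg _) ?_
      (Eventually.of_forall fun t => ?_)
    · exact ((hf.continuous_fderiv (by simp)).norm.integrable_of_hasCompactSupport
        (hfc.fderiv ℝ).norm)
    · have e : (ContinuousLinearMap.lsmul ℝ ℝ : ℝ →L[ℝ] ℝ →L[ℝ] ℝ).precompL (Fin n → ℝ)
          (fderiv ℝ f t) (g (x - t)) = g (x - t) • fderiv ℝ f t := by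
        ext v
        simp [ContinuousLinearMap.precompL_apply, mul_comm]
      show ‖(ContinuousLinearMap.lsmul ℝ ℝ : ℝ →L[ℝ] ℝ →L[ℝ] ℝ).precompL (Fin n → ℝ)
          (fderiv ℝ f t) (g (x - t))‖ ≤ _
      rw [e, norm_smul, Real.norm_of_nonneg (hg0 _)]
      exact mul_le_of_le_one_left (norm_nonneg _) (hg1 _)

variable (n) in
/-- Cutoff functions that are `1` on the `r`-neighbourhood of `E`, vanish off its
`2r`-neighbourhood, and have gradient of size `1 / r`. -/
lemma exists_cutoff : ∃ K : ℝ, 0 ≤ K ∧ ∀ (E : Set (Fin n → ℝ)) (r : ℝ), 0 < r →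
    ∃ χ : (Fin n → ℝ) → ℝ, IsCutoff χ ∧ (∀ x, |χ x| ≤ 1) ∧
      (∀ x ∈ Metric.thickening r E, χ x = 1 ∧ realGrad χ x = 0) ∧
      (∀ x ∉ Metric.thickening (2 * r) E, χ x = 0 ∧ realGrad χ x = 0) ∧
      ∀ x, ‖realGrad χ x‖ ≤ K / r := by
  obtain ⟨K, hK0, hK⟩ := exists_unit_cutoff n
  refine ⟨Real.sqrt n * K, by positivity, fun E r hr => ?_⟩
  obtain ⟨χ₀, hs, h01, h1, h2, hd⟩ := hK ((fun x => r • x) ⁻¹' E)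
  let χ : (Fin n → ℝ) → ℝ := fun x => χ₀ (r⁻¹ • x)
  have hth : ∀ a x, r⁻¹ • x ∈ Metric.thickening a ((fun x : Fin n → ℝ => r • x) ⁻¹' E) ↔
      x ∈ Metric.thickening (a * r) E := by
    intro a x
    rw [Metric.mem_thickening_iff, Metric.mem_thickening_iff]
    have hdist : ∀ z : Fin n → ℝ, dist (r⁻¹ • x) (r⁻¹ • z) < a ↔ dist x z < a * r := by
      intro z
      rw [dist_smul₀, Real.norm_of_nonneg (by positivity), inv_mul_eq_div, div_lt_iff₀ hr]
    constructor
    · rintro ⟨z, hz, hlt⟩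
      refine ⟨r • z, hz, (hdist _).1 ?_⟩
      rwa [inv_smul_smul₀ hr.ne']
    · rintro ⟨z, hz, hlt⟩
      refine ⟨r⁻¹ • z, ?_, (hdist _).2 hlt⟩
      rwa [mem_preimage, smul_inv_smul₀ hr.ne']
  have hχs : ContDiff ℝ ∞ χ := hs.comp (contDiff_const_smul r⁻¹)
  have hdiff : ∀ x, DifferentiableAt ℝ χ x := fun x => hχs.differentiable (by simp) x
  have hgrad : ∀ x, ‖realGrad χ x‖ ≤ Real.sqrt n * K / r := by
    intro x
    rw [mul_div_assoc]
    refine norm_realGrad_le (hdiff x) ?_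
    have hc : HasFDerivAt χ ((fderiv ℝ χ₀ (r⁻¹ • x)).comp (r⁻¹ • ContinuousLinearMap.id ℝ _)) x :=
      ((hs.differentiable (by simp) (r⁻¹ • x)).hasFDerivAt).comp x
        ((hasFDerivAt_id x).const_smul r⁻¹)
    rw [hc.fderiv, ContinuousLinearMap.comp_smul, norm_smul, ContinuousLinearMap.comp_id,
      Real.norm_of_nonneg (by positivity), inv_mul_eq_div]
    gcongr
    exact hd _
  have habs : ∀ x, |χ x| ≤ 1 := fun x => abs_le.2 ⟨by linarith [(h01 (r⁻¹ • x)).1], (h01 _).2⟩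
  have hone : ∀ x ∈ Metric.thickening r E, χ x = 1 := fun x hx =>
    h1 _ ((hth 1 x).2 (by rwa [one_mul]))
  have hzero : ∀ x ∉ Metric.thickening (2 * r) E, χ x = 0 := fun x hx =>
    h2 _ fun h => hx ((hth 2 x).1 h)
  refine ⟨χ, ⟨hχs, ⟨1, habs⟩, ⟨_, hgrad⟩⟩, habs, fun x hx => ⟨hone x hx, ?_⟩,
    fun x hx => ⟨hzero x hx, ?_⟩, hgrad⟩
  · refine realGrad_eq_zero (hdiff x) ?_
    have : χ =ᶠ[𝓝 x] fun _ => 1 := by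
      filter_upwards [Metric.isOpen_thickening.mem_nhds hx] with y hy
      exact hone y hy
    rw [this.fderiv_eq]
    simp
  -- The complement of the neighbourhood is not open; instead, x is a global minimum of the
  -- nonnegative function χ.
  · refine realGrad_eq_zero (hdiff x) (IsLocalMin.fderiv_eq_zero ?_)
    refine Eventually.of_forall fun y => ?_
    rw [hzero x hx]
    exact (h01 _).1

end Cutoff

/-! ### The gradient on a sawtooth region -/

section Sawtooth

variable {n : ℕ} {Ω : Set (Fin n → ℝ)} {A : (Fin n → ℝ) → Matrix (Fin n) (Fin n) ℂ} {δ : ℝ}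
  {T : ℝ → L2 Ω →L[ℂ] L2 Ω}

/-- The part of `Ω` at distance between `2 t` and `4 t` from `E`. -/
def annulus (Ω E : Set (Fin n → ℝ)) (t : ℝ) : Set (Fin n → ℝ) :=
  Ω ∩ (Metric.thickening (4 * t) E \ Metric.thickening (2 * t) E)

lemma measurableSet_annulus (hΩ : IsOpen Ω) (E : Set (Fin n → ℝ)) (t : ℝ) :
    MeasurableSet (annulus Ω E t) :=
  hΩ.measurableSet.inter
    (Metric.isOpen_thickening.measurableSet.diff Metric.isOpen_thickening.measurableSet)

/-- The annuli are disjoint because 4ε2^i ≤ 2ε2^j for i < j, and they avoid E. -/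
lemma sum_volume_annulus_le (hΩ : IsOpen Ω) {E : Set (Fin n → ℝ)} {ε : ℝ} (hε : 0 < ε) (m : ℕ) :
    ∑ j ∈ Finset.range m, volume (annulus Ω E (ε * 2 ^ j)) ≤ volume (Ω \ E) := by
  rw [← measure_biUnion_finset]
  · refine measure_mono (iUnion₂_subset fun j _ x hx => ⟨hx.1, fun hxE => hx.2.2 ?_⟩)
    exact Metric.self_subset_thickening (by positivity) _ hxE
  · intro i _ j _ hij
    wlog h : i < j generalizing i j with H
    · exact (H (by assumption) (by assumption) hij.symm
        (lt_of_le_of_ne (not_lt.1 h) hij.symm)).symm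
    refine Set.disjoint_left.2 fun x hx hx' => hx'.2.2 ?_
    refine Metric.thickening_mono ?_ _ hx.2.1
    have : (2 : ℝ) ^ (i + 1) ≤ 2 ^ j := pow_le_pow_right₀ one_le_two h
    rw [pow_succ] at this
    nlinarith
  · exact fun j _ => measurableSet_annulus hΩ E _

lemma enorm_mulOp_sq {F : Type*} [NormedAddCommGroup F] [NormedSpace ℝ F]
    {g : (Fin n → ℝ) → ℝ} (hg : MemLp g ∞ (volume.restrict Ω))
    (u : Lp F 2 (volume.restrict Ω)) :
    ‖mulOp hg u‖ₑ ^ 2 = ∫⁻ x in Ω, ‖g x‖ₑ ^ 2 * ‖u x‖ₑ ^ 2 := by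
  rw [enorm_sq_eq_lintegral]
  refine lintegral_congr_ae ?_
  filter_upwards [coeFn_mulOp hg u] with x hx
  rw [hx, enorm_smul, mul_pow]

/-- If `|u| ≤ Λ` on the sawtooth region of aperture `4` above `E`, then `∇u` is square integrable
on the sawtooth region of aperture `1`; dyadic version with finitely many scales. -/
lemma sawtooth_estimate_dyadic (hΩ : IsOpen Ω) (hA : IsElliptic δ A) (hδ : 0 < δ)
    (hT : IsSemigroupGeneratedByNeg (IsDivFormOperator A (sobolevW0 Ω)) T) :
    ∃ C : ℝ≥0∞, C ≠ ⊤ ∧ ∀ (f : L2 Ω) (E : Set (Fin n → ℝ)) (Λ : ℝ≥0∞)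
      (N : (Fin n → ℝ) → ℝ≥0∞), MeasurableSet E → E ⊆ Ω →
      (∀ t : ℝ, 0 < t → ENNReal.ofReal t < dOmega Ω → ∀ᵐ y ∂(volume.restrict Ω),
        (y ∈ Metric.thickening (4 * t) E → ‖T (t ^ 2) f y‖ₑ ≤ Λ) ∧
        (y ∈ E → ‖T (t ^ 2) f y‖ₑ ≤ N y)) →
      ∀ (ε : ℝ) (m : ℕ), 0 < ε → ENNReal.ofReal (ε * 2 ^ m) < dOmega Ω →
      ∫⁻ s in Ioc (ε ^ 2) ((ε * 2 ^ m) ^ 2), ∫⁻ y in Ω ∩ Metric.thickening (Real.sqrt s) E,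
        ‖weakGrad (T s f) y‖ₑ ^ 2 ≤ C * (Λ ^ 2 * volume (Ω \ E) + ∫⁻ y in E, N y ^ 2) := by
  obtain ⟨K, hK0, hK⟩ := exists_cutoff n
  set C₁ : ℝ≥0∞ := ENNReal.ofReal (4 / δ ^ 3) * ENNReal.ofReal (3 / 4 * K ^ 2) with hC₁
  have hC₁t : C₁ ≠ ⊤ := ENNReal.mul_ne_top ENNReal.ofReal_ne_top ENNReal.ofReal_ne_top
  refine ⟨(ENNReal.ofReal δ)⁻¹ * (C₁ + 3), ENNReal.mul_ne_top (by simpa using hδ)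
    (ENNReal.add_ne_top.2 ⟨hC₁t, by simp⟩), ?_⟩
  intro f E Λ N hE hEΩ hbd ε m hε hm
  set τ : ℕ → ℝ := fun j => ε * 2 ^ j with hτ
  have hτ0 : ∀ j, 0 < τ j := fun j => by positivity
  have hτs : ∀ j, τ (j + 1) = 2 * τ j := fun j => by simp only [hτ]; ring
  have hτmono : Monotone τ := fun i j hij =>
    mul_le_mul_of_nonneg_left (pow_le_pow_right₀ one_le_two hij) hε.le
  -- One cutoff serves the times s with τ_j < √s ≤ 2τ_j: it is 1 on the 2τ_j-neighbourhood of E,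
  -- which contains the √s-neighbourhood, and it vanishes off the 4τ_j-neighbourhood, where the
  -- bound Λ is available since τ_j ≤ √s.
  choose χ hχ hχ1 hχone hχzero hχgrad using fun j : ℕ => hK E (2 * τ j) (by have := hτ0 j; linarith)
  set e : ℕ → ℝ → ℝ≥0∞ := fun j s => ‖mulOp (hχ j).memLp (T s f)‖ₑ ^ 2 with he
  set a : ℕ → ℝ≥0∞ := fun j => Λ ^ 2 * volume (annulus Ω E (τ j)) with ha
  set Ψ : ℝ → ℝ≥0∞ := fun s => ∫⁻ y in Ω ∩ Metric.thickening (Real.sqrt s) E,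
    ‖weakGrad (T s f) y‖ₑ ^ 2 with hΨ
  have hthick : ∀ r, MeasurableSet (Metric.thickening r E) :=
    fun r => Metric.isOpen_thickening.measurableSet
  -- ∇χ_j has size K / (2τ_j) and lives on the j-th annulus, and the block has length 3τ_j²; this
  -- gives the factor 3K²/4.
  have hgradterm : ∀ j, ENNReal.ofReal (τ (j + 1)) < dOmega Ω →
      ∫⁻ s in Ioc (τ j ^ 2) (τ (j + 1) ^ 2), ‖mulOp (hχ j).memLp_norm_grad (T s f)‖ₑ ^ 2 ≤
        ENNReal.ofReal (3 / 4 * K ^ 2) * a j := by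
    intro j hj
    calc _ ≤ ∫⁻ _s in Ioc (τ j ^ 2) (τ (j + 1) ^ 2),
          ENNReal.ofReal (K / (2 * τ j)) ^ 2 * a j := by
          refine setLIntegral_mono' measurableSet_Ioc fun s hs => ?_
          have hs0 : 0 < s := (pow_pos (hτ0 j) 2).trans hs.1
          have hlow : τ j ≤ Real.sqrt s := Real.le_sqrt_of_sq_le hs.1.le
          have hup : Real.sqrt s ≤ τ (j + 1) := Real.sqrt_le_iff.2 ⟨(hτ0 _).le, hs.2⟩
          have hb := hbd (Real.sqrt s) (Real.sqrt_pos.2 hs0)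
            ((ENNReal.ofReal_le_ofReal hup).trans_lt hj)
          rw [Real.sq_sqrt hs0.le] at hb
          rw [enorm_mulOp_sq, ha, ← mul_assoc]
          calc ∫⁻ x in Ω, ‖‖realGrad (χ j) x‖‖ₑ ^ 2 * ‖T s f x‖ₑ ^ 2
              ≤ ∫⁻ x in Ω, (annulus Ω E (τ j)).indicator
                (fun _ => ENNReal.ofReal (K / (2 * τ j)) ^ 2 * Λ ^ 2) x := by
                refine lintegral_mono_ae ?_
                filter_upwards [hb, ae_restrict_mem hΩ.measurableSet] with x hx hxΩ
                rw [enorm_norm]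
                by_cases h1 : x ∈ Metric.thickening (2 * τ j) E
                · simp [(hχone j x h1).2]
                by_cases h2 : x ∈ Metric.thickening (2 * (2 * τ j)) E
                · have h3 : x ∈ Metric.thickening (4 * τ j) E := by
                    convert h2 using 2; ring
                  rw [indicator_of_mem (show x ∈ annulus Ω E (τ j) from ⟨hxΩ, h3, h1⟩)]
                  gcongr
                  · rw [← ofReal_norm]
                    exact ENNReal.ofReal_le_ofReal (hχgrad j x)
                  · exact hx.1 (Metric.thickening_mono (by linarith) _ h3)
                · simp [(hχzero j x h2).2]
            _ ≤ ∫⁻ x, (annulus Ω E (τ j)).indicator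
                (fun _ => ENNReal.ofReal (K / (2 * τ j)) ^ 2 * Λ ^ 2) x :=
                setLIntegral_le_lintegral _ _
            _ = _ := by rw [lintegral_indicator (measurableSet_annulus hΩ E _), setLIntegral_const]
      _ = _ := by
          rw [setLIntegral_const, Real.volume_Ioc, hτs, mul_right_comm,
            ← ENNReal.ofReal_pow (by have := hτ0 j; positivity), ← ENNReal.ofReal_mul (by positivity)]
          congr 2
          have := (hτ0 j).ne'
          field_simp
          ring
  -- Cost of replacing χ_j by χ_{j+1}: where χ_j is not yet 1 and χ_{j+1} is not yet 0, the point
  -- lies in annulus j or j + 1, and |u| ≤ Λ there.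
  have htrans : ∀ j, ENNReal.ofReal (τ (j + 1)) < dOmega Ω →
      e (j + 1) (τ (j + 1) ^ 2) ≤ e j (τ (j + 1) ^ 2) + (a j + a (j + 1)) := by
    intro j hj
    have hb := hbd _ (hτ0 (j + 1)) hj
    simp only [he, enorm_mulOp_sq]
    calc _ ≤ ∫⁻ x in Ω, (‖χ j x‖ₑ ^ 2 * ‖T (τ (j + 1) ^ 2) f x‖ₑ ^ 2 +
          ((annulus Ω E (τ j)).indicator (fun _ => Λ ^ 2) x +
            (annulus Ω E (τ (j + 1))).indicator (fun _ => Λ ^ 2) x)) := by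
          refine lintegral_mono_ae ?_
          filter_upwards [hb, ae_restrict_mem hΩ.measurableSet] with x hx hxΩ
          have hle1 : ‖χ (j + 1) x‖ₑ ^ 2 ≤ 1 := by
            refine pow_le_one' ?_ 2
            rw [← ofReal_norm]
            exact ENNReal.ofReal_le_one.2 (hχ1 _ x)
          by_cases h1 : x ∈ Metric.thickening (2 * τ j) E
          · rw [(hχone j x h1).1]
            refine le_trans ?_ le_self_add
            simpa using mul_le_mul_left hle1 _
          refine le_trans ?_ le_add_self
          by_cases h2 : x ∈ Metric.thickening (4 * τ (j + 1)) E
          · have hbound : ‖χ (j + 1) x‖ₑ ^ 2 * ‖T (τ (j + 1) ^ 2) f x‖ₑ ^ 2 ≤ Λ ^ 2 := by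
              calc _ ≤ 1 * Λ ^ 2 := by
                    gcongr
                    exact hx.1 h2
                _ = _ := one_mul _
            by_cases h3 : x ∈ Metric.thickening (4 * τ j) E
            · rw [indicator_of_mem (show x ∈ annulus Ω E (τ j) from ⟨hxΩ, h3, h1⟩)]
              exact hbound.trans le_self_add
            · have h4 : x ∉ Metric.thickening (2 * τ (j + 1)) E := by
                intro h; apply h3; rw [hτs] at h; convert h using 2; ring
              rw [indicator_of_mem (show x ∈ annulus Ω E (τ (j + 1)) from ⟨hxΩ, h2, h4⟩)]
              exact hbound.trans le_add_self
          · have h3 : x ∉ Metric.thickening (2 * (2 * τ (j + 1))) E := by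
              intro h; apply h2; convert h using 2; ring
            simp [(hχzero (j + 1) x h3).1]
      _ = (∫⁻ x in Ω, ‖χ j x‖ₑ ^ 2 * ‖T (τ (j + 1) ^ 2) f x‖ₑ ^ 2) +
          ((∫⁻ x in Ω, (annulus Ω E (τ j)).indicator (fun _ => Λ ^ 2) x) +
            ∫⁻ x in Ω, (annulus Ω E (τ (j + 1))).indicator (fun _ => Λ ^ 2) x) := by
          have m1 : ∀ i, Measurable fun x => (annulus Ω E (τ i)).indicator (fun _ => Λ ^ 2) x :=
            fun i => measurable_const.indicator (measurableSet_annulus hΩ E _)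
          have m2 : Measurable fun x => (annulus Ω E (τ j)).indicator (fun _ => Λ ^ 2) x +
              (annulus Ω E (τ (j + 1))).indicator (fun _ => Λ ^ 2) x := (m1 _).add (m1 _)
          rw [lintegral_add_right _ m2, lintegral_add_right _ (m1 _)]
      _ ≤ _ := by
          gcongr
          · refine (setLIntegral_le_lintegral _ _).trans_eq ?_
            rw [lintegral_indicator (measurableSet_annulus hΩ E _), setLIntegral_const]
          · refine (setLIntegral_le_lintegral _ _).trans_eq ?_
            rw [lintegral_indicator (measurableSet_annulus hΩ E _), setLIntegral_const]
  have hΨle : ∀ j, ∫⁻ s in Ioc (τ j ^ 2) (τ (j + 1) ^ 2), Ψ s ≤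
      ∫⁻ s in Ioc (τ j ^ 2) (τ (j + 1) ^ 2), ‖mulOp (hχ j).memLp (weakGrad (T s f))‖ₑ ^ 2 := by
    intro j
    refine setLIntegral_mono' measurableSet_Ioc fun s hs => ?_
    have hup : Real.sqrt s ≤ τ (j + 1) := Real.sqrt_le_iff.2 ⟨(hτ0 _).le, hs.2⟩
    rw [enorm_mulOp_sq, hΨ]
    calc ∫⁻ y in Ω ∩ Metric.thickening (Real.sqrt s) E, ‖weakGrad (T s f) y‖ₑ ^ 2
        ≤ ∫⁻ y in Ω ∩ Metric.thickening (Real.sqrt s) E,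
            ‖χ j y‖ₑ ^ 2 * ‖weakGrad (T s f) y‖ₑ ^ 2 := by
          refine setLIntegral_mono' (hΩ.measurableSet.inter (hthick _)) fun y hy => ?_
          rw [(hχone j y (Metric.thickening_mono (by rw [← hτs]; exact hup) _ hy.2)).1]
          simp
      _ ≤ _ := lintegral_mono_set inter_subset_left
  -- The energy inequalities of the blocks telescope: the terminal term of each block, after the
  -- change of cutoff, is the initial term of the next.
  have hind : ∀ k, ENNReal.ofReal (τ k) < dOmega Ω →
      ENNReal.ofReal δ * (∫⁻ s in Ioc (ε ^ 2) (τ k ^ 2), Ψ s) + e k (τ k ^ 2) ≤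
        e 0 (ε ^ 2) + ∑ j ∈ Finset.range k, (C₁ * a j + (a j + a (j + 1))) := by
    intro k
    induction k with
    | zero => intro _; simp [hτ]
    | succ k ih =>
      intro hk
      have hk' : ENNReal.ofReal (τ k) < dOmega Ω :=
        (ENNReal.ofReal_le_ofReal (hτmono k.le_succ)).trans_lt hk
      have hsq : τ k ^ 2 ≤ τ (k + 1) ^ 2 := pow_le_pow_left₀ (hτ0 k).le (hτmono k.le_succ) 2
      have hε2 : ε ^ 2 ≤ τ k ^ 2 := by
        have : τ 0 ≤ τ k := hτmono (Nat.zero_le k)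
        simp only [hτ, pow_zero, mul_one] at this ⊢
        exact pow_le_pow_left₀ hε.le this 2
      have hen := energy_inequality hΩ hA hδ hT f (hχ k) (sq_nonneg (τ k)) hsq
      rw [Finset.sum_range_succ, ← Ioc_union_Ioc_eq_Ioc hε2 hsq]
      calc _ ≤ ENNReal.ofReal δ * ((∫⁻ s in Ioc (ε ^ 2) (τ k ^ 2), Ψ s) +
            ∫⁻ s in Ioc (τ k ^ 2) (τ (k + 1) ^ 2), Ψ s) +
              (e k (τ (k + 1) ^ 2) + (a k + a (k + 1))) := by
            gcongr
            · exact lintegral_union_le _ _ _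
            · exact htrans k hk
        _ ≤ ENNReal.ofReal δ * ((∫⁻ s in Ioc (ε ^ 2) (τ k ^ 2), Ψ s) +
            ∫⁻ s in Ioc (τ k ^ 2) (τ (k + 1) ^ 2),
              ‖mulOp (hχ k).memLp (weakGrad (T s f))‖ₑ ^ 2) +
              (e k (τ (k + 1) ^ 2) + (a k + a (k + 1))) := by
            gcongr ENNReal.ofReal δ * (_ + ?_) + _
            exact hΨle k
        _ = ENNReal.ofReal δ * (∫⁻ s in Ioc (ε ^ 2) (τ k ^ 2), Ψ s) +
            (ENNReal.ofReal δ * (∫⁻ s in Ioc (τ k ^ 2) (τ (k + 1) ^ 2),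
              ‖mulOp (hχ k).memLp (weakGrad (T s f))‖ₑ ^ 2) +
              e k (τ (k + 1) ^ 2)) + (a k + a (k + 1)) := by ring
        _ ≤ ENNReal.ofReal δ * (∫⁻ s in Ioc (ε ^ 2) (τ k ^ 2), Ψ s) +
            (e k (τ k ^ 2) + C₁ * a k) + (a k + a (k + 1)) := by
            refine add_le_add (add_le_add le_rfl (hen.trans ?_)) le_rfl
            rw [hC₁, mul_assoc]
            gcongr
            exact hgradterm k hk
        _ = ENNReal.ofReal δ * (∫⁻ s in Ioc (ε ^ 2) (τ k ^ 2), Ψ s) + e k (τ k ^ 2) +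
            (C₁ * a k + (a k + a (k + 1))) := by ring
        _ ≤ _ := (add_le_add (ih hk') le_rfl).trans_eq (add_assoc _ _ _)
  have hsum : ∑ j ∈ Finset.range m, (C₁ * a j + (a j + a (j + 1))) ≤
      (C₁ + 2) * (Λ ^ 2 * volume (Ω \ E)) := by
    have h1 : ∀ k, ∑ j ∈ Finset.range k, a j ≤ Λ ^ 2 * volume (Ω \ E) := fun k => by
      rw [← Finset.mul_sum]
      gcongr
      exact sum_volume_annulus_le hΩ hε k
    have h2 : ∑ j ∈ Finset.range m, a (j + 1) ≤ ∑ j ∈ Finset.range (m + 1), a j := by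
      rw [Finset.sum_range_succ']
      exact le_self_add
    rw [Finset.sum_add_distrib, Finset.sum_add_distrib, ← Finset.mul_sum]
    calc _ ≤ C₁ * (Λ ^ 2 * volume (Ω \ E)) +
          (Λ ^ 2 * volume (Ω \ E) + Λ ^ 2 * volume (Ω \ E)) := by
          gcongr
          · exact h1 m
          · exact h1 m
          · exact h2.trans (h1 _)
      _ = _ := by ring
  -- At the initial time |u| is bounded by N on E, and by Λ on the rest of the support of χ_0.
  have hbottom : e 0 (ε ^ 2) ≤ Λ ^ 2 * volume (Ω \ E) + ∫⁻ y in E, N y ^ 2 := by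
    have hε' : ENNReal.ofReal ε < dOmega Ω := by
      refine (ENNReal.ofReal_le_ofReal ?_).trans_lt hm
      exact le_mul_of_one_le_right hε.le (one_le_pow₀ one_le_two)
    have hb := hbd ε hε hε'
    have hτ0' : τ 0 = ε := by simp [hτ]
    have hle1 : ∀ x, ‖χ 0 x‖ₑ ^ 2 ≤ 1 := fun x => by
      refine pow_le_one' ?_ 2
      rw [← ofReal_norm]
      exact ENNReal.ofReal_le_one.2 (hχ1 _ x)
    simp only [he, enorm_mulOp_sq]
    calc _ ≤ ∫⁻ x in (Ω \ E) ∪ E, ‖χ 0 x‖ₑ ^ 2 * ‖T (ε ^ 2) f x‖ₑ ^ 2 :=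
          lintegral_mono_set (by rw [sdiff_union_self]; exact subset_union_left)
      _ ≤ (∫⁻ x in Ω \ E, ‖χ 0 x‖ₑ ^ 2 * ‖T (ε ^ 2) f x‖ₑ ^ 2) +
          ∫⁻ x in E, ‖χ 0 x‖ₑ ^ 2 * ‖T (ε ^ 2) f x‖ₑ ^ 2 := lintegral_union_le _ _ _
      _ ≤ (∫⁻ _x in Ω \ E, Λ ^ 2) + ∫⁻ x in E, N x ^ 2 := by
          gcongr ?_ + ?_
          · refine lintegral_mono_ae ?_
            filter_upwards [ae_restrict_of_ae_restrict_of_subset sdiff_subset hb] with x hx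
            by_cases h2 : x ∈ Metric.thickening (4 * ε) E
            · calc _ ≤ 1 * Λ ^ 2 := by
                    gcongr
                    · exact hle1 x
                    · exact hx.1 h2
                _ = _ := one_mul _
            · have h3 : x ∉ Metric.thickening (2 * (2 * τ 0)) E := by
                intro h; apply h2; rw [hτ0'] at h; convert h using 2; ring
              simp [(hχzero 0 x h3).1]
          · refine lintegral_mono_ae ?_
            filter_upwards [ae_restrict_of_ae_restrict_of_subset hEΩ hb,
              ae_restrict_mem hE] with x hx hxE
            calc _ ≤ 1 * N x ^ 2 := by
                  gcongr
                  · exact hle1 x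
                  · exact hx.2 hxE
              _ = _ := one_mul _
      _ = _ := by rw [setLIntegral_const]
  have hfinal : ENNReal.ofReal δ * (∫⁻ s in Ioc (ε ^ 2) (τ m ^ 2), Ψ s) ≤
      (C₁ + 3) * (Λ ^ 2 * volume (Ω \ E) + ∫⁻ y in E, N y ^ 2) := by
    calc _ ≤ e 0 (ε ^ 2) + ∑ j ∈ Finset.range m, (C₁ * a j + (a j + a (j + 1))) :=
          le_self_add.trans (hind m hm)
      _ ≤ (Λ ^ 2 * volume (Ω \ E) + ∫⁻ y in E, N y ^ 2) +
          (C₁ + 2) * (Λ ^ 2 * volume (Ω \ E) + ∫⁻ y in E, N y ^ 2) := by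
          gcongr
          refine hsum.trans ?_
          gcongr
          exact le_self_add
      _ = _ := by ring
  have hδ' : ENNReal.ofReal δ ≠ 0 := by simpa using hδ
  calc _ = (ENNReal.ofReal δ)⁻¹ * (ENNReal.ofReal δ * ∫⁻ s in Ioc (ε ^ 2) (τ m ^ 2), Ψ s) := by
        rw [← mul_assoc, ENNReal.inv_mul_cancel hδ' ENNReal.ofReal_ne_top, one_mul]
    _ ≤ (ENNReal.ofReal δ)⁻¹ *
        ((C₁ + 3) * (Λ ^ 2 * volume (Ω \ E) + ∫⁻ y in E, N y ^ 2)) := by gcongr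
    _ = _ := (mul_assoc _ _ _).symm

end Sawtooth

/-! ### The sawtooth estimate over all times below d_Ω, and measurability of the area function -/

section AreaFunction

variable {n : ℕ} {Ω : Set (Fin n → ℝ)} {A : (Fin n → ℝ) → Matrix (Fin n) (Fin n) ℂ} {δ : ℝ}
  {T : ℝ → L2 Ω →L[ℂ] L2 Ω}

/-- If `|u| ≤ Λ` on the sawtooth region of aperture `4` above `E`, then `∇u` is square integrable
on the sawtooth region of aperture `1`. -/
lemma sawtooth_estimate (hΩ : IsOpen Ω) (hA : IsElliptic δ A) (hδ : 0 < δ)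
    (hT : IsSemigroupGeneratedByNeg (IsDivFormOperator A (sobolevW0 Ω)) T) :
    ∃ C : ℝ≥0∞, C ≠ ⊤ ∧ ∀ (f : L2 Ω) (E : Set (Fin n → ℝ)) (Λ : ℝ≥0∞)
      (N : (Fin n → ℝ) → ℝ≥0∞), MeasurableSet E → E ⊆ Ω →
      (∀ t : ℝ, 0 < t → ENNReal.ofReal t < dOmega Ω → ∀ᵐ y ∂(volume.restrict Ω),
        (y ∈ Metric.thickening (4 * t) E → ‖T (t ^ 2) f y‖ₑ ≤ Λ) ∧
        (y ∈ E → ‖T (t ^ 2) f y‖ₑ ≤ N y)) →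
      ∫⁻ s in {s : ℝ | 0 < s ∧ ENNReal.ofReal (Real.sqrt s) < dOmega Ω},
        ∫⁻ y in Ω ∩ Metric.thickening (Real.sqrt s) E,
          ‖weakGrad (T s f) y‖ₑ ^ 2 ≤ C * (Λ ^ 2 * volume (Ω \ E) + ∫⁻ y in E, N y ^ 2) := by
  obtain ⟨C, hC, h⟩ := sawtooth_estimate_dyadic hΩ hA hδ hT
  refine ⟨C, hC, fun f E Λ N hE hEΩ hb => ?_⟩
  have h1 := h f E Λ N hE hEΩ hb
  set Ψ : ℝ → ℝ≥0∞ := fun s => ∫⁻ y in Ω ∩ Metric.thickening (Real.sqrt s) E,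
    ‖weakGrad (T s f) y‖ₑ ^ 2
  set B := C * (Λ ^ 2 * volume (Ω \ E) + ∫⁻ y in E, N y ^ 2)
  -- The dyadic bound is uniform in ε and m, so ε = τ / 2^m → 0 with the final time τ fixed.
  have h2 : ∀ τ : ℝ, 0 < τ → ENNReal.ofReal τ < dOmega Ω → ∫⁻ s in Ioc 0 (τ ^ 2), Ψ s ≤ B := by
    intro τ hτ hτd
    have e : Ioc 0 (τ ^ 2) = ⋃ m : ℕ, Ioc ((τ / 2 ^ m) ^ 2) (τ ^ 2) := by
      ext s
      simp only [mem_iUnion, mem_Ioc]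
      constructor
      · rintro ⟨hs, hs'⟩
        have hlim : Tendsto (fun m : ℕ => (τ / 2 ^ m) ^ 2) atTop (𝓝 0) := by
          have := (tendsto_pow_atTop_nhds_zero_of_lt_one (r := (1 / 2 : ℝ)) (by norm_num)
            (by norm_num)).const_mul τ
          simpa [div_eq_mul_inv] using this.pow 2
        obtain ⟨m, hm⟩ := (hlim.eventually (gt_mem_nhds hs)).exists
        exact ⟨m, hm, hs'⟩
      · rintro ⟨m, hs, hs'⟩
        exact ⟨lt_of_le_of_lt (by positivity) hs, hs'⟩
    rw [e, setLIntegral_iUnion_of_directed]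
    · refine iSup_le fun m => ?_
      have e2 : τ / 2 ^ m * 2 ^ m = τ := by field_simp
      have := h1 (τ / 2 ^ m) m (by positivity) (by rwa [e2])
      rwa [e2] at this
    · refine Monotone.directed_le fun k l hkl => Ioc_subset_Ioc_left ?_
      have : (2 : ℝ) ^ k ≤ 2 ^ l := pow_le_pow_right₀ one_le_two hkl
      gcongr
  -- Exhaustion by rational final times, a countable directed family.
  have e : {s : ℝ | 0 < s ∧ ENNReal.ofReal (Real.sqrt s) < dOmega Ω} ⊆
      ⋃ q : {q : ℚ // 0 < q ∧ ENNReal.ofReal (q : ℝ) < dOmega Ω}, Ioc 0 ((q.1 : ℝ) ^ 2) := by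
    rintro s ⟨hs, hsd⟩
    obtain ⟨r, hr1, hr2⟩ := ENNReal.lt_iff_exists_nnreal_btwn.1 hsd
    have hr1' : Real.sqrt s < r := by
      rw [← ENNReal.ofReal_coe_nnreal] at hr1
      exact (ENNReal.ofReal_lt_ofReal_iff_of_nonneg (Real.sqrt_nonneg _)).1 hr1
    obtain ⟨q, hq1, hq2⟩ := exists_rat_btwn hr1'
    have hq0 : (0 : ℝ) < q := (Real.sqrt_nonneg s).trans_lt hq1
    refine mem_iUnion.2 ⟨⟨q, by exact_mod_cast hq0, ?_⟩, hs, ?_⟩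
    · refine lt_of_le_of_lt (ENNReal.ofReal_le_ofReal hq2.le) ?_
      rwa [ENNReal.ofReal_coe_nnreal]
    · exact ((Real.sqrt_lt' hq0).1 hq1).le
  refine (lintegral_mono_set e).trans ?_
  rw [setLIntegral_iUnion_of_directed]
  · exact iSup_le fun q => h2 _ (by exact_mod_cast q.2.1) q.2.2
  · refine Monotone.directed_le fun p q hpq => Ioc_subset_Ioc_right ?_
    have h3 : (p.1 : ℝ) ≤ q.1 := by exact_mod_cast hpq
    have h4 : (0 : ℝ) < p.1 := by exact_mod_cast p.2.1
    exact pow_le_pow_left₀ h4.le h3 2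

/-! ### Measurability -/

/-- The times `t ∈ (0, d_Ω)`. -/
def times (Ω : Set (Fin n → ℝ)) : Set ℝ := {t : ℝ | 0 < t ∧ ENNReal.ofReal t < dOmega Ω}

lemma measurableSet_times : MeasurableSet (times Ω) :=
  measurableSet_Ioi.inter (measurableSet_lt ENNReal.measurable_ofReal measurable_const)

/-- `∫_{Ω ∩ B(x,t)} |g|²` as a function of `(t, x)`. -/
@[irreducible] def localEnergy (g : L2Vec Ω) (p : ℝ × (Fin n → ℝ)) : ℝ≥0∞ :=
  ∫⁻ y in Ω ∩ Metric.ball p.2 p.1, ‖g y‖ₑ ^ 2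

lemma measurable_localEnergy (hΩ : IsOpen Ω) (g : L2Vec Ω) : Measurable (localEnergy g) := by
  have hset : MeasurableSet {q : (ℝ × (Fin n → ℝ)) × (Fin n → ℝ) |
      q.2 ∈ Ω ∩ Metric.ball q.1.2 q.1.1} := by
    refine (hΩ.measurableSet.preimage measurable_snd).inter ?_
    exact (isOpen_lt (continuous_snd.dist (continuous_snd.comp continuous_fst))
      (continuous_fst.comp continuous_fst)).measurableSet
  have hm : Measurable fun q : (ℝ × (Fin n → ℝ)) × (Fin n → ℝ) =>
      {q : (ℝ × (Fin n → ℝ)) × (Fin n → ℝ) | q.2 ∈ Ω ∩ Metric.ball q.1.2 q.1.1}.indicator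
        (fun q => ‖g q.2‖ₑ ^ 2) q :=
    (((Lp.stronglyMeasurable g).measurable.comp measurable_snd).enorm.pow_const 2).indicator hset
  convert! hm.lintegral_prod_right' (ν := volume) using 2 with p
  rw [localEnergy, ← lintegral_indicator (hΩ.measurableSet.inter Metric.isOpen_ball.measurableSet)]
  rfl

lemma continuous_localEnergy (p : ℝ × (Fin n → ℝ)) :
    Continuous fun g : L2Vec Ω => localEnergy g p := by
  have hm : MemLp ((Metric.ball p.2 p.1).indicator fun _ : Fin n → ℝ => (1 : ℝ)) ∞
      (volume.restrict Ω) := by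
    refine memLp_top_of_bound ((measurable_const.indicator
      Metric.isOpen_ball.measurableSet).aestronglyMeasurable) 1 (Eventually.of_forall fun x => ?_)
    exact (norm_indicator_le_norm_self _ _).trans (by simp)
  have e : (fun g : L2Vec Ω => localEnergy g p) = fun g => ‖mulOp hm g‖ₑ ^ 2 := by
    ext g
    rw [enorm_mulOp_sq, localEnergy, inter_comm, ← Measure.restrict_restrict
      Metric.isOpen_ball.measurableSet, ← lintegral_indicator Metric.isOpen_ball.measurableSet]
    refine lintegral_congr fun x => ?_
    by_cases hx : x ∈ Metric.ball p.2 p.1 <;> simp [hx]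
  rw [e]
  exact (ENNReal.continuous_pow 2).comp ((mulOp hm).continuous.enorm)

/-- A Carathéodory function, continuous in one variable and measurable in the other, is jointly
measurable over a separable metrizable space. This allows ∇e^{-t²L} f to be treated as an L²-valued
function of t, without a jointly measurable representative in (t, y). -/
lemma aemeasurable_comp_prod {X α β : Type*} [TopologicalSpace X]
    [TopologicalSpace.MetrizableSpace X] [SecondCountableTopology X] [MeasurableSpace α]
    [MeasurableSpace β] {ν : Measure α} {ρ : Measure β} [SFinite ρ] {g : α → X}
    {F : X → α × β → ℝ≥0∞} (hF : ∀ p, Continuous fun x => F x p) (hF' : ∀ x, Measurable (F x))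
    (hg : AEStronglyMeasurable g ν) :
    AEMeasurable (fun p : α × β => F (g p.1) p) (ν.prod ρ) := by
  let _ : MeasurableSpace X := borel X
  have _ : BorelSpace X := ⟨rfl⟩
  obtain ⟨g', hg', hgg'⟩ := hg
  refine ⟨fun p => F (g' p.1) p, ?_, ?_⟩
  · exact (measurable_uncurry_of_continuous_of_measurable hF hF').comp
      ((hg'.measurable.comp measurable_fst).prodMk measurable_id)
  · filter_upwards [Measure.quasiMeasurePreserving_fst.ae hgg'] with p hp
    rw [hp]

instance secondCountableTopology_L2Vec : SecondCountableTopology (L2Vec Ω) := by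
  have _ : Fact ((2 : ℝ≥0∞) ≠ ⊤) := ⟨by norm_num⟩
  infer_instance

lemma aemeasurable_localEnergy_comp (hΩ : IsOpen Ω) {ν : Measure ℝ} {ρ : Measure (Fin n → ℝ)}
    [SFinite ρ] {g : ℝ → L2Vec Ω} (hg : AEStronglyMeasurable g ν) :
    AEMeasurable (fun p : ℝ × (Fin n → ℝ) => localEnergy (g p.1) p) (ν.prod ρ) := by
  have h2 := measurable_localEnergy hΩ
  have h3 := continuous_localEnergy (Ω := Ω)
  generalize localEnergy (Ω := Ω) = F at *
  exact aemeasurable_comp_prod h3 h2 hg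

/-- The exceptional set of times t is the image under the square root of a null set in (0, ∞), and
differentiable maps preserve null sets. -/
lemma ae_comp_sq {p : ℝ → Prop} (h : ∀ᵐ s ∂(volume.restrict (Ioi (0 : ℝ))), p s) :
    ∀ᵐ t ∂(volume.restrict (Ioi (0 : ℝ))), p (t ^ 2) := by
  rw [ae_restrict_iff' measurableSet_Ioi, ae_iff] at h ⊢
  have h1 : volume (Real.sqrt '' {s | ¬ (s ∈ Ioi 0 → p s)}) = 0 := by
    refine addHaar_image_eq_zero_of_differentiableOn_of_addHaar_eq_zero _ ?_ h
    intro s hs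
    simp only [mem_ofPred_eq, Classical.not_imp] at hs
    exact (Real.hasDerivAt_sqrt (ne_of_gt hs.1)).differentiableAt.differentiableWithinAt
  refine measure_mono_null (fun t ht => ?_) h1
  simp only [mem_ofPred_eq, Classical.not_imp] at ht
  refine ⟨t ^ 2, ?_, Real.sqrt_sq (le_of_lt ht.1)⟩
  simp only [mem_ofPred_eq, Classical.not_imp]
  exact ⟨mem_Ioi.2 (pow_pos (mem_Ioi.1 ht.1) 2), ht.2⟩

/-- For data in the domain the gradient is continuous in time; in general it is an almost everywhere
limit of such functions. -/
lemma aestronglyMeasurable_weakGrad_sq (hΩ : IsOpen Ω) (hA : IsElliptic δ A) (hδ : 0 < δ)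
    (hT : IsSemigroupGeneratedByNeg (IsDivFormOperator A (sobolevW0 Ω)) T) (f : L2 Ω) :
    AEStronglyMeasurable (fun t : ℝ => weakGrad (T (t ^ 2) f)) (volume.restrict (Ioi 0)) := by
  obtain ⟨u, w, hL, -, hae⟩ := exists_approx hΩ hA hδ hT f
  refine aestronglyMeasurable_of_tendsto_ae atTop (fun k => ?_) (ae_comp_sq hae)
  have : ContinuousOn (fun t : ℝ => weakGrad (T (t ^ 2) (u k))) (Ioi 0) :=
    (continuousOn_weakGrad hΩ hA hδ hT (hL k)).comp (by fun_prop) fun t _ => sq_nonneg t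
  exact this.aestronglyMeasurable measurableSet_Ioi

lemma aemeasurable_localEnergy (hΩ : IsOpen Ω) (hA : IsElliptic δ A) (hδ : 0 < δ)
    (hT : IsSemigroupGeneratedByNeg (IsDivFormOperator A (sobolevW0 Ω)) T) (f : L2 Ω)
    (E : Set (Fin n → ℝ)) :
    AEMeasurable (fun p : ℝ × (Fin n → ℝ) => localEnergy (weakGrad (T (p.1 ^ 2) f)) p)
      ((volume.restrict (times Ω)).prod (volume.restrict E)) := by
  have h : times Ω ⊆ Ioi 0 := fun t ht => mem_Ioi.2 ht.1
  have h1 := (aestronglyMeasurable_weakGrad_sq hΩ hA hδ hT f).mono_measure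
    (Measure.restrict_mono h (le_refl volume))
  exact aemeasurable_localEnergy_comp (g := fun t => weakGrad (T (t ^ 2) f)) hΩ h1

/-- The weight of the area function. -/
def areaWeight (Ω : Set (Fin n → ℝ)) (p : ℝ × (Fin n → ℝ)) : ℝ≥0∞ :=
  ‖p.1‖ₑ ^ 2 / (ENNReal.ofReal p.1 * volume (Metric.closedBall p.2 (p.1 / 2) ∩ Ω))

lemma measurable_areaWeight (hΩ : IsOpen Ω) : Measurable (areaWeight Ω) := by
  have hset : MeasurableSet {q : (ℝ × (Fin n → ℝ)) × (Fin n → ℝ) |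
      q.2 ∈ Metric.closedBall q.1.2 (q.1.1 / 2) ∩ Ω} := by
    refine MeasurableSet.inter ?_ (hΩ.measurableSet.preimage measurable_snd)
    exact (isClosed_le (continuous_snd.dist (continuous_snd.comp continuous_fst))
      ((continuous_fst.comp continuous_fst).div_const 2)).measurableSet
  have h1 : Measurable fun p : ℝ × (Fin n → ℝ) =>
      volume (Metric.closedBall p.2 (p.1 / 2) ∩ Ω) := measurable_measure_prodMk_left hset
  exact (measurable_fst.enorm.pow_const 2).div (measurable_fst.ennreal_ofReal.mul h1)

lemma areaFn_sq (f : L2 Ω) (x : Fin n → ℝ) :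
    areaFn A f x ^ 2 = ∫⁻ t in times Ω, areaWeight Ω (t, x) *
      localEnergy (weakGrad (heatSemigroup Ω A (t ^ 2) f)) (t, x) := by
  rw [areaFn, ← ENNReal.rpow_natCast, ← ENNReal.rpow_mul]
  norm_num
  refine lintegral_congr fun t => ?_
  rw [localEnergy, areaWeight, ← lintegral_const_mul'']
  · refine lintegral_congr fun y => ?_
    rw [enorm_smul, mul_pow, ENNReal.mul_div_right_comm]
  · exact ((Lp.stronglyMeasurable _).measurable.enorm.pow_const 2).aemeasurable

lemma areaFn_eq_rpow (f : L2 Ω) (x : Fin n → ℝ) :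
    areaFn A f x = (areaFn A f x ^ 2) ^ (1 / 2 : ℝ) := by
  rw [← ENNReal.rpow_natCast, ← ENNReal.rpow_mul]
  norm_num

lemma aemeasurable_areaFn (hΩ : IsOpen Ω) (hA : IsElliptic δ A) (hδ : 0 < δ)
    (hT : IsSemigroupGeneratedByNeg (IsDivFormOperator A (sobolevW0 Ω)) (heatSemigroup Ω A))
    (f : L2 Ω) (E : Set (Fin n → ℝ)) : AEMeasurable (areaFn A f) (volume.restrict E) := by
  have h1 : AEMeasurable (fun p : ℝ × (Fin n → ℝ) => areaWeight Ω p *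
      localEnergy (weakGrad (heatSemigroup Ω A (p.1 ^ 2) f)) p)
      ((volume.restrict (times Ω)).prod (volume.restrict E)) :=
    (measurable_areaWeight hΩ).aemeasurable.mul (aemeasurable_localEnergy hΩ hA hδ hT f E)
  have h2 := h1.prod_swap.lintegral_prod_right'
  have e : areaFn A f = fun x => (areaFn A f x ^ 2) ^ (1 / 2 : ℝ) :=
    funext fun x => areaFn_eq_rpow f x
  rw [e]
  simp_rw [areaFn_sq]
  exact h2.pow_const _

end AreaFunction

/-! ### Fubini for the square of the area function -/

section AreaFunctionBound

variable {n : ℕ} {Ω : Set (Fin n → ℝ)} {A : (Fin n → ℝ) → Matrix (Fin n) (Fin n) ℂ} {δ : ℝ}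

lemma volume_ball_le (x : Fin n → ℝ) {t : ℝ} (ht : 0 < t) :
    volume (Metric.ball x t) ≤ ENNReal.ofReal (2 * t) ^ n := by
  rw [Real.volume_pi_ball x ht, ENNReal.ofReal_pow (by positivity), Fintype.card_fin]

/-- By Tonelli, a point y is counted only for x ∈ E ∩ B(y, t), a set of measure at most (2t)ⁿ that
is empty unless y is within t of E. -/
lemma lintegral_localEnergy_le (g : L2Vec Ω) {t : ℝ} (ht : 0 < t) (E : Set (Fin n → ℝ)) :
    ∫⁻ x in E, localEnergy g (t, x) ≤
      ENNReal.ofReal (2 * t) ^ n * ∫⁻ y in Ω ∩ Metric.thickening t E, ‖g y‖ₑ ^ 2 := by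
  have hgm : Measurable fun y => ‖g y‖ₑ ^ 2 :=
    (Lp.stronglyMeasurable g).measurable.enorm.pow_const 2
  have hset : MeasurableSet {q : (Fin n → ℝ) × (Fin n → ℝ) | dist q.2 q.1 < t} :=
    (isOpen_lt (continuous_snd.dist continuous_fst) continuous_const).measurableSet
  have e1 : ∀ x, localEnergy g (t, x) = ∫⁻ y in Ω,
      {q : (Fin n → ℝ) × (Fin n → ℝ) | dist q.2 q.1 < t}.indicator (fun q => ‖g q.2‖ₑ ^ 2)
        (x, y) := by
    intro x
    rw [localEnergy, inter_comm, ← Measure.restrict_restrict Metric.isOpen_ball.measurableSet,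
      ← lintegral_indicator Metric.isOpen_ball.measurableSet]
    rfl
  simp_rw [e1]
  rw [lintegral_lintegral_swap]
  swap
  · exact ((hgm.comp measurable_snd).indicator hset).aemeasurable
  rw [← lintegral_const_mul _ hgm, inter_comm,
    ← Measure.restrict_restrict Metric.isOpen_thickening.measurableSet,
    ← lintegral_indicator Metric.isOpen_thickening.measurableSet]
  refine lintegral_mono fun y => ?_
  have e2 : ∀ x, {q : (Fin n → ℝ) × (Fin n → ℝ) | dist q.2 q.1 < t}.indicator
      (fun q => ‖g q.2‖ₑ ^ 2) (x, y) = (Metric.ball y t).indicator (fun _ => ‖g y‖ₑ ^ 2) x := by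
    intro x
    by_cases hx : dist y x < t
    · rw [indicator_of_mem (by exact hx), indicator_of_mem (Metric.mem_ball'.2 hx)]
    · rw [indicator_of_notMem (by exact hx), indicator_of_notMem (fun h => hx (Metric.mem_ball'.1 h))]
  simp_rw [e2]
  rw [lintegral_indicator Metric.isOpen_ball.measurableSet, setLIntegral_const,
    Measure.restrict_apply Metric.isOpen_ball.measurableSet]
  by_cases hy : y ∈ Metric.thickening t E
  · rw [indicator_of_mem hy, mul_comm]
    gcongr
    exact (measure_mono inter_subset_left).trans (volume_ball_le y ht)
  · have : Metric.ball y t ∩ E = ∅ := by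
      refine eq_empty_of_forall_notMem fun x hx => hy ?_
      exact Metric.mem_thickening_iff.2 ⟨x, hx.2, Metric.mem_ball'.1 hx.1⟩
    simp [this]

lemma areaWeight_le {c : ℝ≥0∞}
    (hdens : ∀ x ∈ Ω, ∀ t : ℝ, 0 < t → ENNReal.ofReal t < dOmega Ω →
      c * ENNReal.ofReal t ^ n ≤ volume (Metric.ball x t ∩ Ω))
    {x : Fin n → ℝ} (hx : x ∈ Ω) {t : ℝ} (ht : t ∈ times Ω) :
    areaWeight Ω (t, x) ≤
      ENNReal.ofReal t ^ 2 / (ENNReal.ofReal t * (c * ENNReal.ofReal (t / 2) ^ n)) := by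
  have ht0 : 0 < t := ht.1
  rw [areaWeight, Real.enorm_eq_ofReal ht0.le]
  gcongr
  refine (hdens x hx (t / 2) (by positivity) (lt_of_le_of_lt ?_ ht.2)).trans
    (measure_mono (inter_subset_inter_left _ Metric.ball_subset_closedBall))
  exact ENNReal.ofReal_le_ofReal (by linarith)

/-- The powers of t from the two volumes cancel up to the factor 4ⁿ, leaving the factor t which
becomes the Jacobian of s = t². -/
lemma weight_mul_volume_le {c : ℝ≥0∞} (hc : c ≠ 0) (hc' : c ≠ ⊤) {t : ℝ} :
    ENNReal.ofReal t ^ 2 / (ENNReal.ofReal t * (c * ENNReal.ofReal (t / 2) ^ n)) *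
      ENNReal.ofReal (2 * t) ^ n ≤ 4 ^ n / c * ENNReal.ofReal t := by
  have e : ENNReal.ofReal (2 * t) = 4 * ENNReal.ofReal (t / 2) := by
    rw [show (4 : ℝ≥0∞) = ENNReal.ofReal 4 by norm_num, ← ENNReal.ofReal_mul (by norm_num)]
    congr 1
    ring
  rw [e, mul_pow, ← ENNReal.mul_div_right_comm]
  refine ENNReal.div_le_of_le_mul ?_
  calc ENNReal.ofReal t ^ 2 * (4 ^ n * ENNReal.ofReal (t / 2) ^ n)
      = ENNReal.ofReal t ^ 2 * ((4 ^ n / c * c) * ENNReal.ofReal (t / 2) ^ n) := by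
        rw [ENNReal.div_mul_cancel hc hc']
    _ = _ := by ring
    _ ≤ _ := le_rfl

lemma lintegral_areaFn_sq_le (hΩ : IsOpen Ω) (hA : IsElliptic δ A) (hδ : 0 < δ)
    (hT : IsSemigroupGeneratedByNeg (IsDivFormOperator A (sobolevW0 Ω)) (heatSemigroup Ω A))
    {c : ℝ≥0∞} (hc : c ≠ 0) (hc' : c ≠ ⊤)
    (hdens : ∀ x ∈ Ω, ∀ t : ℝ, 0 < t → ENNReal.ofReal t < dOmega Ω →
      c * ENNReal.ofReal t ^ n ≤ volume (Metric.ball x t ∩ Ω))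
    (f : L2 Ω) {E : Set (Fin n → ℝ)} (hE : MeasurableSet E) (hEΩ : E ⊆ Ω) :
    ∫⁻ x in E, areaFn A f x ^ 2 ≤ 4 ^ n / c *
      ∫⁻ s in {s : ℝ | 0 < s ∧ ENNReal.ofReal (Real.sqrt s) < dOmega Ω},
        ∫⁻ y in Ω ∩ Metric.thickening (Real.sqrt s) E,
          ‖weakGrad (heatSemigroup Ω A s f) y‖ₑ ^ 2 := by
  set Ψ : ℝ → ℝ≥0∞ := fun s => ∫⁻ y in Ω ∩ Metric.thickening (Real.sqrt s) E,
    ‖weakGrad (heatSemigroup Ω A s f) y‖ₑ ^ 2 with hΨ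
  have h1 : AEMeasurable (fun p : ℝ × (Fin n → ℝ) => areaWeight Ω p *
      localEnergy (weakGrad (heatSemigroup Ω A (p.1 ^ 2) f)) p)
      ((volume.restrict (times Ω)).prod (volume.restrict E)) :=
    (measurable_areaWeight hΩ).aemeasurable.mul (aemeasurable_localEnergy hΩ hA hδ hT f E)
  have hCtop : (4 : ℝ≥0∞) ^ n / c ≠ ⊤ := ENNReal.div_ne_top (by simp) hc
  simp_rw [areaFn_sq]
  rw [lintegral_lintegral_swap (f := fun x t => areaWeight Ω (t, x) *
    localEnergy (weakGrad (heatSemigroup Ω A (t ^ 2) f)) (t, x)) h1.prod_swap]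
  calc ∫⁻ t in times Ω, ∫⁻ x in E, areaWeight Ω (t, x) *
        localEnergy (weakGrad (heatSemigroup Ω A (t ^ 2) f)) (t, x)
      ≤ ∫⁻ t in times Ω, 4 ^ n / c * (ENNReal.ofReal |2 * t| * Ψ (t ^ 2)) := by
        refine setLIntegral_mono' measurableSet_times fun t ht => ?_
        have ht0 : 0 < t := ht.1
        generalize hg : weakGrad (heatSemigroup Ω A (t ^ 2) f) = g
        have e : Ψ (t ^ 2) = ∫⁻ y in Ω ∩ Metric.thickening t E, ‖g y‖ₑ ^ 2 := by
          rw [hΨ, ← hg]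
          simp only [Real.sqrt_sq ht0.le]
        rw [e]
        have hLE : Measurable fun x => localEnergy g (t, x) :=
          (measurable_localEnergy hΩ g).comp measurable_prodMk_left
        calc ∫⁻ x in E, areaWeight Ω (t, x) * localEnergy g (t, x)
            ≤ ∫⁻ x in E, ENNReal.ofReal t ^ 2 /
                (ENNReal.ofReal t * (c * ENNReal.ofReal (t / 2) ^ n)) * localEnergy g (t, x) := by
              refine setLIntegral_mono' hE fun x hx => ?_
              gcongr
              exact areaWeight_le hdens (hEΩ hx) ht
          _ ≤ ENNReal.ofReal t ^ 2 / (ENNReal.ofReal t * (c * ENNReal.ofReal (t / 2) ^ n)) *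
                (ENNReal.ofReal (2 * t) ^ n *
                  ∫⁻ y in Ω ∩ Metric.thickening t E, ‖g y‖ₑ ^ 2) := by
              rw [lintegral_const_mul _ hLE]
              gcongr
              exact lintegral_localEnergy_le g ht0 E
          _ ≤ 4 ^ n / c * ENNReal.ofReal |2 * t| *
                ∫⁻ y in Ω ∩ Metric.thickening t E, ‖g y‖ₑ ^ 2 := by
              rw [← mul_assoc]
              refine mul_le_mul_left ((weight_mul_volume_le hc hc').trans ?_) _
              refine mul_le_mul_right (ENNReal.ofReal_le_ofReal ?_) _
              rw [abs_of_pos (by positivity)]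
              linarith
          _ = _ := mul_assoc _ _ _
    -- Change of variables s = t², whose Jacobian is 2t.
    _ = 4 ^ n / c * ∫⁻ s in (fun t : ℝ => t ^ 2) '' times Ω, Ψ s := by
        rw [lintegral_const_mul' _ _ hCtop, lintegral_image_eq_lintegral_abs_deriv_mul
          (f' := fun t => 2 * t) measurableSet_times]
        · intro t _
          simpa using (hasDerivAt_pow 2 t).hasDerivWithinAt
        · intro a ha b hb hab
          exact (pow_left_inj₀ (le_of_lt ha.1) (le_of_lt hb.1) two_ne_zero).1 hab
    _ ≤ _ := by
        refine mul_le_mul_right (lintegral_mono_set ?_) _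
        rintro _ ⟨t, ht, rfl⟩
        have ht0 : 0 < t := ht.1
        refine ⟨pow_pos ht0 2, ?_⟩
        rw [Real.sqrt_sq ht0.le]
        exact ht.2

end AreaFunctionBound

/-! ### The good-λ inequality -/

section GoodLambda

variable {n : ℕ} {Ω : Set (Fin n → ℝ)} {A : (Fin n → ℝ) → Matrix (Fin n) (Fin n) ℂ} {δ : ℝ}

/-- The union of the balls `B(y, a t)`, `(y, t) ∈ W`. -/
def shadow (W : Set ((Fin n → ℝ) × ℝ)) (a : ℝ) : Set (Fin n → ℝ) :=
  ⋃ p ∈ W, Metric.ball p.1 (a * p.2)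

lemma isOpen_shadow (W : Set ((Fin n → ℝ) × ℝ)) (a : ℝ) : IsOpen (shadow W a) :=
  isOpen_biUnion fun _ _ => Metric.isOpen_ball

lemma mem_shadow {W : Set ((Fin n → ℝ) × ℝ)} {a : ℝ} {x : Fin n → ℝ} :
    x ∈ shadow W a ↔ ∃ p ∈ W, dist x p.1 < a * p.2 := by
  simp [shadow]

lemma ne_zero_of_isConnected_of_ne_univ (hc : IsConnected Ω) (hne : Ω ≠ univ) : n ≠ 0 := by
  rintro rfl
  obtain ⟨x, hx⟩ := hc.nonempty
  exact hne (eq_univ_of_forall fun y => Subsingleton.elim x y ▸ hx)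

/-- Vitali selects disjoint balls B(y, 4t) whose fivefold enlargements cover the wide shadow. Each
enlargement has volume (40t)ⁿ, comparable by the density estimate to |B(y, t) ∩ Ω|, and these
smaller sets are disjoint parts of the narrow shadow. -/
lemma volume_inter_shadow_le (hn : n ≠ 0) {c : ℝ≥0∞} (hc : c ≠ 0) (hc' : c ≠ ⊤)
    (hdens : ∀ x ∈ Ω, ∀ t : ℝ, 0 < t → ENNReal.ofReal t < dOmega Ω →
      c * ENNReal.ofReal t ^ n ≤ volume (Metric.ball x t ∩ Ω))
    {W : Set ((Fin n → ℝ) × ℝ)}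
    (hW : ∀ p ∈ W, p.1 ∈ Ω ∧ 0 < p.2 ∧ ENNReal.ofReal p.2 < dOmega Ω) :
    volume (Ω ∩ shadow W 4) ≤ 40 ^ n / c * volume (Ω ∩ shadow W 1) := by
  rcases eq_top_or_lt_top (volume (Ω ∩ shadow W 1)) with htop | hfin
  · rw [htop, ENNReal.mul_top]
    · exact le_top
    · exact (ENNReal.div_pos (by simp) hc').ne'
  have hsub : ∀ p ∈ W, Metric.ball p.1 p.2 ∩ Ω ⊆ Ω ∩ shadow W 1 := fun p hp x hx =>
    ⟨hx.2, mem_shadow.2 ⟨p, hp, by simpa using hx.1⟩⟩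
  -- Vitali requires bounded radii: the density estimate bounds tⁿ by the finite volume of the
  -- narrow shadow divided by c, and t ≤ tⁿ for t > 1 because n ≠ 0.
  have hr : ∀ p ∈ W, 4 * p.2 ≤ 4 * max 1 (volume (Ω ∩ shadow W 1) / c).toReal := by
    intro p hp
    obtain ⟨hpΩ, hp0, hpd⟩ := hW p hp
    gcongr
    by_contra! hcon
    obtain ⟨h1, h2⟩ := max_lt_iff.1 hcon
    have h3 : ENNReal.ofReal p.2 ^ n ≤ volume (Ω ∩ shadow W 1) / c := by
      refine ENNReal.le_div_iff_mul_le (Or.inl hc) (Or.inl hc') |>.2 ?_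
      rw [mul_comm]
      exact (hdens p.1 hpΩ p.2 hp0 hpd).trans (measure_mono (hsub p hp))
    rw [← ENNReal.ofReal_pow hp0.le,
      ENNReal.ofReal_le_iff_le_toReal (ENNReal.div_ne_top hfin.ne hc)] at h3
    have h4 : p.2 ≤ p.2 ^ n := le_self_pow₀ h1.le hn
    linarith
  obtain ⟨u, huW, hdisj, hcov⟩ := Vitali.exists_disjoint_subfamily_covering_enlargement_closedBall
    W (fun p => p.1) (fun p => 4 * p.2) _ hr 5 (by norm_num)
  have hu : u.Countable := hdisj.countable_of_nonempty_interior fun p hp =>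
    (Metric.nonempty_ball.2 (by have := (hW p (huW hp)).2.1; positivity)).mono
      Metric.ball_subset_interior_closedBall
  have hterm : ∀ p ∈ u, volume (Metric.closedBall p.1 (5 * (4 * p.2))) ≤
      40 ^ n / c * volume (Metric.ball p.1 p.2 ∩ Ω) := by
    intro p hp
    obtain ⟨hpΩ, hp0, hpd⟩ := hW p (huW hp)
    have e : (40 : ℝ≥0∞) = ENNReal.ofReal 40 := by norm_num
    calc volume (Metric.closedBall p.1 (5 * (4 * p.2)))
        = 40 ^ n * ENNReal.ofReal p.2 ^ n := by
          rw [Real.volume_pi_closedBall _ (by positivity), Fintype.card_fin,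
            ENNReal.ofReal_pow (by positivity), ← mul_pow, e,
            ← ENNReal.ofReal_mul (by norm_num)]
          congr 2
          ring
      _ = 40 ^ n / c * (c * ENNReal.ofReal p.2 ^ n) := by
          rw [← mul_assoc, ENNReal.div_mul_cancel hc hc']
      _ ≤ _ := by
          gcongr
          exact hdens p.1 hpΩ p.2 hp0 hpd
  have := hu.to_subtype
  calc volume (Ω ∩ shadow W 4)
      ≤ volume (⋃ p ∈ u, Metric.closedBall p.1 (5 * (4 * p.2))) := by
        refine measure_mono fun x hx => ?_
        obtain ⟨p, hp, hxp⟩ := mem_shadow.1 hx.2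
        obtain ⟨b, hb, hpb⟩ := hcov p hp
        exact mem_biUnion hb (hpb (Metric.mem_closedBall.2 hxp.le))
    _ ≤ ∑' p : u, volume (Metric.closedBall p.1.1 (5 * (4 * p.1.2))) :=
        measure_biUnion_le _ hu _
    _ ≤ ∑' p : u, 40 ^ n / c * volume (Metric.ball p.1.1 p.1.2 ∩ Ω) :=
        ENNReal.tsum_le_tsum fun p => hterm p.1 p.2
    _ = 40 ^ n / c * ∑' p : u, volume (Metric.ball p.1.1 p.1.2 ∩ Ω) := ENNReal.tsum_mul_left
    _ ≤ _ := by
        gcongr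
        have hd : Pairwise fun p q : u =>
            Disjoint (Metric.ball p.1.1 p.1.2) (Metric.ball q.1.1 q.1.2) := by
          intro p q hpq
          refine (hdisj p.2 q.2 fun h => hpq (Subtype.ext h)).mono ?_ ?_
          · have := (hW p.1 (huW p.2)).2.1
            exact Metric.ball_subset_closedBall.trans (Metric.closedBall_subset_closedBall
              (by linarith))
          · have := (hW q.1 (huW q.2)).2.1
            exact Metric.ball_subset_closedBall.trans (Metric.closedBall_subset_closedBall
              (by linarith))
        calc ∑' p : u, volume (Metric.ball p.1.1 p.1.2 ∩ Ω)
            = ∑' p : u, volume.restrict Ω (Metric.ball p.1.1 p.1.2) := by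
              simp_rw [Measure.restrict_apply Metric.isOpen_ball.measurableSet]
          _ = volume.restrict Ω (⋃ p : u, Metric.ball p.1.1 p.1.2) :=
              (measure_iUnion hd fun p => Metric.isOpen_ball.measurableSet).symm
          _ = volume ((⋃ p : u, Metric.ball p.1.1 p.1.2) ∩ Ω) :=
              Measure.restrict_apply (isOpen_iUnion fun p => Metric.isOpen_ball).measurableSet
          _ ≤ _ := by
              refine measure_mono ?_
              rw [iUnion_inter]
              exact iUnion_subset fun p => hsub p.1 (huW p.2)

/-- Without a continuous representative `contRep` is u itself, so the identity holds in either case.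
-/
lemma contRep_ae_eq (u : L2 Ω) : u =ᵐ[volume.restrict Ω] contRep u := by
  by_cases h : ∃ g : (Fin n → ℝ) → ℂ, ContinuousOn g Ω ∧ u =ᵐ[volume.restrict Ω] g
  · rw [contRep, dif_pos h]
    exact h.choose_spec.2
  · rw [contRep, dif_neg h]

/-- The points `(y, t)` at which `|e^{-t²L} f (y)|` exceeds `Λ`. -/
def levelSet (A : (Fin n → ℝ) → Matrix (Fin n) (Fin n) ℂ) (f : L2 Ω) (Λ : ℝ≥0∞) :
    Set ((Fin n → ℝ) × ℝ) :=
  {p | (p.1 ∈ Ω ∧ 0 < p.2 ∧ ENNReal.ofReal p.2 < dOmega Ω) ∧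
    Λ < ‖contRep (heatSemigroup Ω A (p.2 ^ 2) f) p.1‖ₑ}

/-- A supremum exceeds Λ exactly when one of its terms does; superlevel sets of the maximal function
are therefore unions of open balls, which also yields measurability. -/
lemma lt_maximalFn_iff {f : L2 Ω} {Λ : ℝ≥0∞} {x : Fin n → ℝ} :
    Λ < maximalFn A f x ↔ x ∈ shadow (levelSet A f Λ) 1 := by
  simp only [maximalFn, lt_iSup_iff, mem_shadow, levelSet, mem_ofPred_eq, Prod.exists, one_mul,
    exists_prop]
  refine exists_congr fun y => exists_congr fun t => ?_
  rw [dist_comm, dist_eq_norm]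
  tauto

lemma measurable_maximalFn (f : L2 Ω) : Measurable (maximalFn A f) := by
  refine measurable_of_Ioi fun Λ => ?_
  have : maximalFn A f ⁻¹' Ioi Λ = shadow (levelSet A f Λ) 1 := by
    ext x
    exact lt_maximalFn_iff
  rw [this]
  exact (isOpen_shadow _ _).measurableSet

/-- The level sets of the area function are controlled by those of the maximal function. -/
lemma volume_lt_areaFn_le (hΩ : IsStronglyLipschitzDomain Ω) (hA : IsElliptic δ A) (hδ : 0 < δ)
    (hT : IsSemigroupGeneratedByNeg (IsDivFormOperator A (sobolevW0 Ω)) (heatSemigroup Ω A)) :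
    ∃ C : ℝ≥0∞, C ≠ ⊤ ∧ ∀ (f : L2 Ω) (Λ : ℝ≥0∞), Λ ≠ 0 → Λ ≠ ⊤ →
      volume.restrict Ω {x | Λ < areaFn A f x} ≤
        C * (volume.restrict Ω {x | Λ < maximalFn A f x} +
          (∫⁻ x in Ω ∩ {x | maximalFn A f x ≤ Λ}, maximalFn A f x ^ 2) / Λ ^ 2) := by
  have hn := ne_zero_of_isConnected_of_ne_univ hΩ.isConnected hΩ.ne_univ
  obtain ⟨c, hc, hc', hdens⟩ := hΩ.exists_density
  obtain ⟨C, hC, hsaw⟩ := sawtooth_estimate hΩ.isOpen hA hδ hT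
  set K₁ : ℝ≥0∞ := 4 ^ n / c * C with hK₁
  set K₂ : ℝ≥0∞ := 40 ^ n / c with hK₂
  have hK₁t : K₁ ≠ ⊤ := ENNReal.mul_ne_top (ENNReal.div_ne_top (by simp) hc) hC
  have hK₂t : K₂ ≠ ⊤ := ENNReal.div_ne_top (by simp) hc
  refine ⟨(1 + K₁) * K₂ + K₁, by finiteness, fun f Λ hΛ0 hΛ => ?_⟩
  set W := levelSet A f Λ
  -- Removing the balls of aperture 4 rather than 1 ensures |u(y, t)| ≤ Λ whenever y is within 4t of
  -- E, as the sawtooth estimate demands.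
  set E := Ω \ shadow W 4 with hEdef
  have hE : MeasurableSet E := hΩ.isOpen.measurableSet.diff (isOpen_shadow _ _).measurableSet
  have hEΩ : E ⊆ Ω := sdiff_subset
  have hNE : E ⊆ {x | maximalFn A f x ≤ Λ} := by
    intro x hx
    show maximalFn A f x ≤ Λ
    refine not_lt.1 fun h => hx.2 ?_
    obtain ⟨p, hp, hxp⟩ := mem_shadow.1 (lt_maximalFn_iff.1 h)
    have := hp.1.2.1
    exact mem_shadow.2 ⟨p, hp, by linarith⟩
  have hbad : volume (Ω \ E) ≤ K₂ * volume.restrict Ω {x | Λ < maximalFn A f x} := by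
    have e1 : Ω \ E = Ω ∩ shadow W 4 := by rw [hEdef, Set.sdiff_sdiff_right_self]
    have e2 : volume.restrict Ω {x | Λ < maximalFn A f x} = volume (Ω ∩ shadow W 1) := by
      have : {x | Λ < maximalFn A f x} = shadow W 1 := by
        ext x
        exact lt_maximalFn_iff
      rw [this, Measure.restrict_apply (isOpen_shadow _ _).measurableSet, inter_comm]
    rw [e1, e2]
    exact volume_inter_shadow_le hn hc hc' hdens fun p hp => hp.1
  have hint : ∫⁻ x in E, areaFn A f x ^ 2 ≤ K₁ * (Λ ^ 2 * volume (Ω \ E) +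
      ∫⁻ x in Ω ∩ {x | maximalFn A f x ≤ Λ}, maximalFn A f x ^ 2) := by
    refine (lintegral_areaFn_sq_le hΩ.isOpen hA hδ hT hc hc' hdens f hE hEΩ).trans ?_
    rw [hK₁, mul_assoc]
    gcongr
    refine (hsaw f E Λ (maximalFn A f) hE hEΩ fun t ht htd => ?_).trans ?_
    · filter_upwards [contRep_ae_eq (heatSemigroup Ω A (t ^ 2) f),
        ae_restrict_mem hΩ.isOpen.measurableSet] with y hy hyΩ
      rw [hy]
      refine ⟨fun hyE => ?_, fun hyE => ?_⟩
      · obtain ⟨x, hx, hyx⟩ := Metric.mem_thickening_iff.1 hyE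
        refine not_lt.1 fun h => hx.2 (mem_shadow.2 ⟨(y, t), ⟨⟨hyΩ, ht, htd⟩, h⟩, ?_⟩)
        rwa [dist_comm]
      · refine le_iSup₂_of_le y t (le_iSup_of_le ⟨hyΩ, ht, htd, by simpa using ht⟩ le_rfl)
    · gcongr
      exact subset_inter hEΩ hNE
  -- Chebyshev applied to S² on E.
  have hcheb : volume (E ∩ {x | Λ < areaFn A f x}) ≤
      K₁ * (volume (Ω \ E) +
        (∫⁻ x in Ω ∩ {x | maximalFn A f x ≤ Λ}, maximalFn A f x ^ 2) / Λ ^ 2) := by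
    have hm := (aemeasurable_areaFn hΩ.isOpen hA hδ hT f E).pow_const 2
    have h1 := (mul_meas_ge_le_lintegral₀ hm (Λ ^ 2)).trans hint
    have hΛ2 : Λ ^ 2 ≠ 0 := pow_ne_zero 2 hΛ0
    have hΛ2t : Λ ^ 2 ≠ ⊤ := ENNReal.pow_ne_top hΛ
    calc volume (E ∩ {x | Λ < areaFn A f x})
        ≤ volume.restrict E {x | Λ ^ 2 ≤ areaFn A f x ^ 2} := by
          rw [inter_comm]
          refine le_trans ?_ (Measure.le_restrict_apply _ _)
          refine measure_mono (inter_subset_inter_left _ fun x hx => ?_)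
          have hx' : Λ < areaFn A f x := hx
          exact pow_le_pow_left' hx'.le 2
      _ ≤ K₁ * (Λ ^ 2 * volume (Ω \ E) +
            ∫⁻ x in Ω ∩ {x | maximalFn A f x ≤ Λ}, maximalFn A f x ^ 2) / Λ ^ 2 :=
          (ENNReal.le_div_iff_mul_le (Or.inl hΛ2) (Or.inl hΛ2t)).2 (by rwa [mul_comm])
      _ = _ := by
          rw [mul_div_assoc, ENNReal.add_div, mul_comm (Λ ^ 2), ENNReal.mul_div_cancel_right hΛ2 hΛ2t]
  have hm := nullMeasurableSet_lt (aemeasurable_const (b := Λ))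
    (aemeasurable_areaFn hΩ.isOpen hA hδ hT f Ω)
  set V := volume.restrict Ω {x | Λ < maximalFn A f x}
  set J := (∫⁻ x in Ω ∩ {x | maximalFn A f x ≤ Λ}, maximalFn A f x ^ 2) / Λ ^ 2
  calc volume.restrict Ω {x | Λ < areaFn A f x}
      ≤ volume ({x | Λ < areaFn A f x} ∩ Ω) := by
        rw [Measure.restrict_apply₀ hm]
    _ ≤ volume (Ω \ E) + volume (E ∩ {x | Λ < areaFn A f x}) := by
        refine (measure_mono ?_).trans (measure_union_le _ _)
        intro x hx
        by_cases hxE : x ∈ E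
        · exact Or.inr ⟨hxE, hx.1⟩
        · exact Or.inl ⟨hx.2, hxE⟩
    _ ≤ K₂ * V + K₁ * (K₂ * V + J) := by
        gcongr
        exact hcheb.trans (by gcongr)
    _ = ((1 + K₁) * K₂) * V + K₁ * J := by ring
    _ ≤ ((1 + K₁) * K₂ + K₁) * V + ((1 + K₁) * K₂ + K₁) * J := by
        gcongr
        · exact le_self_add
        · exact le_add_self
    _ = _ := (mul_add _ _ _).symm

end GoodLambda

/-! ### Dyadic sums of Φ and modular inequalities -/

section Orlicz

variable {n : ℕ} {μ : ℝ} {Φ : ℝ → ℝ}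

lemma extendPhi_zero (Φ : ℝ → ℝ) : extendPhi Φ 0 = 0 := if_pos rfl

lemma extendPhi_top (Φ : ℝ → ℝ) : extendPhi Φ ⊤ = ⊤ := by simp [extendPhi]

lemma extendPhi_ofReal (Φ : ℝ → ℝ) {r : ℝ} (hr : 0 < r) :
    extendPhi Φ (ENNReal.ofReal r) = ENNReal.ofReal (Φ r) := by
  simp [extendPhi, hr, hr.le]

lemma eq_zero_or_top_or_ofReal (s : ℝ≥0∞) :
    s = 0 ∨ s = ⊤ ∨ ∃ r : ℝ, 0 < r ∧ s = ENNReal.ofReal r := by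
  by_cases h0 : s = 0
  · exact Or.inl h0
  by_cases ht : s = ⊤
  · exact Or.inr (Or.inl ht)
  · exact Or.inr (Or.inr ⟨s.toReal, ENNReal.toReal_pos h0 ht, (ENNReal.ofReal_toReal ht).symm⟩)

lemma AssumptionA.monotone_extendPhi (hΦ : AssumptionA n μ Φ) : Monotone (extendPhi Φ) := by
  intro a b hab
  rcases eq_zero_or_top_or_ofReal a with rfl | rfl | ⟨r, hr, rfl⟩
  · simp [extendPhi_zero]
  · rw [top_le_iff.1 hab]
  rcases eq_zero_or_top_or_ofReal b with rfl | rfl | ⟨s, hs, rfl⟩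
  · exact absurd hab (by simpa using hr)
  · simp [extendPhi_top]
  · rw [extendPhi_ofReal Φ hr, extendPhi_ofReal Φ hs]
    exact ENNReal.ofReal_le_ofReal
      (hΦ.strictMonoOn.monotoneOn hr hs ((ENNReal.ofReal_le_ofReal_iff hs.le).1 hab))

/-- A positive critical index means that some exponent p > 0 is admissible, and q = 2^{-p} works.
This is the only form in which lower type is used below. -/
lemma AssumptionA.exists_half_le (hμ : 0 < μ) (hΦ : AssumptionA n μ Φ) :
    ∃ q : ℝ, 0 < q ∧ q < 1 ∧ ∀ s, 0 < s → Φ (s / 2) ≤ q * Φ s := by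
  have h0 : 0 < criticalLowerType Φ :=
    lt_of_le_of_lt (by positivity) hΦ.lt_criticalLowerType
  obtain ⟨p, hp, hpΦ⟩ : {p : ℝ | 0 < p ∧
      ∀ t s : ℝ, 0 < t → t < 1 → 0 < s → Φ (s * t) ≤ t ^ p * Φ s}.Nonempty := by
    by_contra hcon
    rw [criticalLowerType, not_nonempty_iff_eq_empty.1 hcon, Real.sSup_empty] at h0
    exact h0.false
  refine ⟨(1 / 2) ^ p, by positivity, Real.rpow_lt_one (by norm_num) (by norm_num) hp, ?_⟩
  intro s hs
  have := hpΦ (1 / 2) s (by norm_num) (by norm_num) hs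
  rwa [mul_one_div] at this

lemma tsum_int_le_geometric {a : ℤ → ℝ≥0∞} {b q : ℝ≥0∞} {g : ℕ → ℤ} (hg : Function.Injective g)
    (hsupp : Function.support a ⊆ range g) (h : ∀ j, a (g j) ≤ b * q ^ j) :
    ∑' k, a k ≤ b * (1 - q)⁻¹ := by
  rw [← hg.tsum_eq hsupp, ← ENNReal.tsum_geometric, ← ENNReal.tsum_mul_left]
  exact ENNReal.tsum_le_tsum h

/-- The dyadic numbers `2 ^ k`. -/
def dyadic (k : ℤ) : ℝ≥0∞ := ENNReal.ofReal ((2 : ℝ) ^ k)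

lemma dyadic_ne_zero (k : ℤ) : dyadic k ≠ 0 :=
  (ENNReal.ofReal_pos.2 (by positivity)).ne'

lemma dyadic_ne_top (k : ℤ) : dyadic k ≠ ⊤ := ENNReal.ofReal_ne_top

/-- Discrete layer cake: for 2^k < s ≤ 2^{k+1} the single term of index k already dominates Φ(s). -/
lemma AssumptionA.extendPhi_le_tsum (hΦ : AssumptionA n μ Φ) (s : ℝ≥0∞) :
    extendPhi Φ s ≤
      ∑' k : ℤ, (Ioi (dyadic k)).indicator (fun _ => extendPhi Φ (dyadic (k + 1))) s := by
  rcases eq_zero_or_top_or_ofReal s with rfl | rfl | ⟨r, hr, rfl⟩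
  · simp [extendPhi_zero]
  -- At s = ∞ all terms are present, and those with k ≥ 0 are at least Φ(1) > 0, so the sum
  -- diverges.
  · have h1 : ∀ k : ℕ, extendPhi Φ (dyadic 0) ≤
        (Ioi (dyadic k)).indicator (fun _ => extendPhi Φ (dyadic (k + 1))) (⊤ : ℝ≥0∞) := by
      intro k
      rw [indicator_of_mem (mem_Ioi.2 (dyadic_ne_top k).lt_top)]
      refine hΦ.monotone_extendPhi (ENNReal.ofReal_le_ofReal ?_)
      exact zpow_le_zpow_right₀ one_le_two (by positivity)
    have h2 : extendPhi Φ (dyadic 0) ≠ 0 := by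
      rw [dyadic, extendPhi_ofReal Φ (by positivity)]
      exact (ENNReal.ofReal_pos.2 (hΦ.pos _ (by positivity))).ne'
    calc extendPhi Φ ⊤ ≤ ⊤ := le_top
      _ = ∑' _ : ℕ, extendPhi Φ (dyadic 0) := (ENNReal.tsum_const_eq_top_of_ne_zero h2).symm
      _ ≤ ∑' k : ℕ, (Ioi (dyadic k)).indicator
            (fun _ => extendPhi Φ (dyadic (k + 1))) (⊤ : ℝ≥0∞) := ENNReal.tsum_le_tsum h1
      _ ≤ _ := ENNReal.tsum_comp_le_tsum_of_injective Nat.cast_injective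
            (fun k : ℤ => (Ioi (dyadic k)).indicator
              (fun _ => extendPhi Φ (dyadic (k + 1))) (⊤ : ℝ≥0∞))
  · obtain ⟨k, hk1, hk2⟩ := exists_mem_Ioc_zpow hr (one_lt_two (α := ℝ))
    refine le_trans ?_ (ENNReal.le_tsum k)
    rw [indicator_of_mem]
    · exact hΦ.monotone_extendPhi (ENNReal.ofReal_le_ofReal hk2)
    · exact (ENNReal.ofReal_lt_ofReal_iff hr).2 hk1

/-- Going down from the largest k with 2^k < s, the values Φ(2^k) decay like powers of q; upper type
absorbs the shift from k to k + 1. -/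
lemma AssumptionA.exists_tsum_below_le (hμ : 0 < μ) (hΦ : AssumptionA n μ Φ) :
    ∃ K : ℝ≥0∞, K ≠ 0 ∧ K ≠ ⊤ ∧ ∀ s : ℝ≥0∞,
      ∑' k : ℤ, (Ioi (dyadic k)).indicator (fun _ => extendPhi Φ (dyadic (k + 1))) s ≤
        K * extendPhi Φ s := by
  obtain ⟨q, hq0, hq1, hq⟩ := hΦ.exists_half_le hμ
  obtain ⟨C, hC, hup⟩ := hΦ.upperType
  have hq1' : 1 - ENNReal.ofReal q ≠ 0 := by
    rw [Ne, tsub_eq_zero_iff_le, not_le]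
    exact ENNReal.ofReal_lt_one.2 hq1
  refine ⟨ENNReal.ofReal (C * 2) * (1 - ENNReal.ofReal q)⁻¹, ?_, ?_, fun s => ?_⟩
  · refine mul_ne_zero (ENNReal.ofReal_pos.2 (by positivity)).ne' (ENNReal.inv_ne_zero.2 ?_)
    exact ENNReal.sub_ne_top ENNReal.one_ne_top
  · exact ENNReal.mul_ne_top ENNReal.ofReal_ne_top (ENNReal.inv_ne_top.2 hq1')
  rcases eq_zero_or_top_or_ofReal s with rfl | rfl | ⟨r, hr, rfl⟩
  · simp
  · rw [extendPhi_top, ENNReal.mul_top]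
    · exact le_top
    · refine mul_ne_zero (ENNReal.ofReal_pos.2 (by positivity)).ne' (ENNReal.inv_ne_zero.2 ?_)
      exact ENNReal.sub_ne_top ENNReal.one_ne_top
  obtain ⟨m, hm1, hm2⟩ := exists_mem_Ioc_zpow hr (one_lt_two (α := ℝ))
  have hdec : ∀ j : ℕ, Φ (2 ^ (m - j)) ≤ q ^ j * Φ r := by
    intro j
    induction j with
    | zero =>
      have h2m : (0 : ℝ) < 2 ^ m := by positivity
      simpa using hΦ.strictMonoOn.monotoneOn h2m hr hm1.le
    | succ j ih =>
      have e : (2 : ℝ) ^ (m - ((j + 1 : ℕ) : ℤ)) = 2 ^ (m - j) / 2 := by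
        rw [div_eq_mul_inv, ← zpow_sub_one₀ (two_ne_zero (α := ℝ))]
        congr 1
        push_cast
        ring
      rw [e]
      calc _ ≤ q * Φ (2 ^ (m - j)) := hq _ (by positivity)
        _ ≤ q * (q ^ j * Φ r) := by gcongr
        _ = _ := by ring
  rw [mul_right_comm]
  refine tsum_int_le_geometric (g := fun j : ℕ => m - j) (fun a b hab => by simpa using hab) ?_ ?_
  · intro k hk
    have hk' : (2 : ℝ) ^ k < r := by
      by_contra hcon
      refine hk ?_
      simp only
      rw [indicator_of_notMem]
      exact fun h => hcon ((ENNReal.ofReal_lt_ofReal_iff hr).1 h)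
    have hkm : k < m + 1 := (zpow_lt_zpow_iff_right₀ one_lt_two).1 (hk'.trans_le hm2)
    exact ⟨(m - k).toNat, by simp only; omega⟩
  · intro j
    refine (indicator_le_self _ _ _).trans ?_
    rw [dyadic, extendPhi_ofReal Φ (by positivity), extendPhi_ofReal Φ hr,
      ← ENNReal.ofReal_pow hq0.le, ← ENNReal.ofReal_mul (by positivity),
      ← ENNReal.ofReal_mul (mul_nonneg (by positivity) (hΦ.pos r hr).le)]
    refine ENNReal.ofReal_le_ofReal ?_
    rw [zpow_add_one₀ two_ne_zero]
    calc Φ (2 ^ (m - j) * 2) ≤ C * 2 * Φ (2 ^ (m - (j : ℤ))) := hup _ _ one_le_two (by positivity)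
      _ ≤ C * 2 * (q ^ j * Φ r) := by gcongr; exact hdec j
      _ = _ := by ring

/-- Upper type 1 gives Φ(2^{k+1}) ≤ C (2^{k+1} / s) Φ(s). The square (s / 2^k)² beats this growth
and leaves a geometric series of ratio 1/2. -/
lemma AssumptionA.exists_tsum_above_le (hΦ : AssumptionA n μ Φ) :
    ∃ K : ℝ≥0∞, K ≠ ⊤ ∧ ∀ s : ℝ≥0∞,
      ∑' k : ℤ, extendPhi Φ (dyadic (k + 1)) *
        (Iic (dyadic k)).indicator (fun s => (s / dyadic k) ^ 2) s ≤ K * extendPhi Φ s := by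
  obtain ⟨C, hC, hup⟩ := hΦ.upperType
  have hq1' : (1 : ℝ≥0∞) - ENNReal.ofReal (1 / 2) ≠ 0 := by
    rw [Ne, tsub_eq_zero_iff_le, not_le]
    exact ENNReal.ofReal_lt_one.2 (by norm_num)
  refine ⟨ENNReal.ofReal (C * 2) * (1 - ENNReal.ofReal (1 / 2))⁻¹, ?_, fun s => ?_⟩
  · exact ENNReal.mul_ne_top ENNReal.ofReal_ne_top (ENNReal.inv_ne_top.2 hq1')
  rcases eq_zero_or_top_or_ofReal s with rfl | rfl | ⟨r, hr, rfl⟩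
  · simp
  · simp [dyadic_ne_top]
  obtain ⟨m, hm1, hm2⟩ := exists_mem_Ioc_zpow hr (one_lt_two (α := ℝ))
  rw [mul_right_comm]
  refine tsum_int_le_geometric (g := fun j : ℕ => m + 1 + j)
    (fun a b hab => by simpa using hab) ?_ ?_
  · intro k hk
    have hk' : r ≤ (2 : ℝ) ^ k := by
      by_contra hcon
      refine hk ?_
      simp only
      rw [indicator_of_notMem, mul_zero]
      exact fun h => hcon ((ENNReal.ofReal_le_ofReal_iff (by positivity)).1 h)
    have hkm : m < k := (zpow_lt_zpow_iff_right₀ one_lt_two).1 (hm1.trans_le hk')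
    exact ⟨(k - (m + 1)).toNat, by simp only; omega⟩
  · intro j
    set k : ℤ := m + 1 + j with hk
    have h2k : (0 : ℝ) < 2 ^ k := by positivity
    have e : (2 : ℝ) ^ k = 2 ^ (m + 1) * 2 ^ j := by
      rw [hk, zpow_add₀ two_ne_zero, zpow_natCast]
    have hrk : r ≤ 2 ^ k := by
      rw [e]
      exact hm2.trans (le_mul_of_one_le_right (by positivity) (one_le_pow₀ one_le_two))
    calc extendPhi Φ (dyadic (k + 1)) *
          (Iic (dyadic k)).indicator (fun s => (s / dyadic k) ^ 2) (ENNReal.ofReal r)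
        ≤ extendPhi Φ (dyadic (k + 1)) * (ENNReal.ofReal r / dyadic k) ^ 2 := by
          gcongr
          exact indicator_le_self _ _ _
      _ = ENNReal.ofReal (Φ (2 ^ (k + 1)) * (r / 2 ^ k) ^ 2) := by
          rw [dyadic, dyadic, extendPhi_ofReal Φ (by positivity), ← ENNReal.ofReal_div_of_pos h2k,
            ← ENNReal.ofReal_pow (by positivity),
            ← ENNReal.ofReal_mul (hΦ.pos _ (by positivity)).le]
      _ ≤ ENNReal.ofReal (C * 2 * Φ r * (1 / 2) ^ j) := by
          refine ENNReal.ofReal_le_ofReal ?_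
          have hΦr := hΦ.pos r hr
          have h1 : Φ (2 ^ (k + 1)) ≤ C * (2 ^ (k + 1) / r) * Φ r := by
            have h1 : (1 : ℝ) ≤ 2 ^ (k + 1) / r := by
              rw [one_le_div hr, zpow_add_one₀ two_ne_zero]
              linarith
            have := hup _ r h1 hr
            rwa [mul_div_cancel₀ _ hr.ne'] at this
          have h2 : r / 2 ^ k ≤ (1 / 2) ^ j := by
            rw [div_le_iff₀ h2k, e, one_div, inv_pow]
            field_simp
            exact hm2
          calc Φ (2 ^ (k + 1)) * (r / 2 ^ k) ^ 2
              ≤ C * (2 ^ (k + 1) / r) * Φ r * (r / 2 ^ k) ^ 2 := by gcongr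
            _ = C * 2 * Φ r * (r / 2 ^ k) := by
                rw [zpow_add_one₀ two_ne_zero]
                field_simp
            _ ≤ _ := by gcongr
      _ = _ := by
          rw [extendPhi_ofReal Φ hr, ← ENNReal.ofReal_mul (by positivity),
            ← ENNReal.ofReal_pow (by norm_num),
            ← ENNReal.ofReal_mul (mul_nonneg (by positivity) (hΦ.pos r hr).le)]

/-- Integration of a good-`λ` inequality against `dΦ(λ)`. -/
lemma AssumptionA.exists_lintegral_le (hμ : 0 < μ) (hΦ : AssumptionA n μ Φ) {X : Type*}
    [MeasurableSpace X] (ν : Measure X) {C : ℝ≥0∞} (hC : C ≠ ⊤) :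
    ∃ K : ℝ≥0∞, K ≠ ⊤ ∧ ∀ S N : X → ℝ≥0∞, AEMeasurable S ν → Measurable N →
      (∀ Λ : ℝ≥0∞, Λ ≠ 0 → Λ ≠ ⊤ → ν {x | Λ < S x} ≤
        C * (ν {x | Λ < N x} + ∫⁻ x in {x | N x ≤ Λ}, (N x / Λ) ^ 2 ∂ν)) →
      ∫⁻ x, extendPhi Φ (S x) ∂ν ≤ K * ∫⁻ x, extendPhi Φ (N x) ∂ν := by
  obtain ⟨K₁, -, hK₁, h₁⟩ := hΦ.exists_tsum_below_le hμ
  obtain ⟨K₂, hK₂, h₂⟩ := hΦ.exists_tsum_above_le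
  refine ⟨C * (K₁ + K₂), by finiteness, fun S N hS hN h => ?_⟩
  set b : ℤ → ℝ≥0∞ := fun k => extendPhi Φ (dyadic (k + 1)) with hb
  have hφN : Measurable fun x => extendPhi Φ (N x) := hΦ.monotone_extendPhi.measurable.comp hN
  have hm₁ : ∀ k, Measurable fun x => (Ioi (dyadic k)).indicator (fun _ => b k) (N x) := fun k =>
    (measurable_const.indicator measurableSet_Ioi).comp hN
  have hm₂ : ∀ k, Measurable fun x =>
      (Iic (dyadic k)).indicator (fun s => (s / dyadic k) ^ 2) (N x) := fun k =>
    (((measurable_id.div_const _).pow_const 2).indicator measurableSet_Iic).comp hN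
  -- The integral of Φ(S) is cut into dyadic layers, the hypothesis is applied at Λ = 2^k, and the
  -- sum is put back under the integral, where the two dyadic sums in N(x) are pointwise multiples
  -- of Φ(N(x)).
  calc ∫⁻ x, extendPhi Φ (S x) ∂ν
      ≤ ∫⁻ x, ∑' k, (Ioi (dyadic k)).indicator (fun _ => b k) (S x) ∂ν :=
        lintegral_mono fun x => hΦ.extendPhi_le_tsum (S x)
    _ = ∑' k, ∫⁻ x, (Ioi (dyadic k)).indicator (fun _ => b k) (S x) ∂ν :=
        lintegral_tsum fun k =>
          (measurable_const.indicator measurableSet_Ioi).comp_aemeasurable hS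
    _ = ∑' k, b k * ν {x | dyadic k < S x} := by
        refine tsum_congr fun k => ?_
        exact lintegral_indicator_const₀ (hS.nullMeasurable measurableSet_Ioi) (b k)
    _ ≤ ∑' k, C * (∫⁻ x, (Ioi (dyadic k)).indicator (fun _ => b k) (N x) ∂ν +
          ∫⁻ x, b k * (Iic (dyadic k)).indicator (fun s => (s / dyadic k) ^ 2) (N x) ∂ν) := by
        refine ENNReal.tsum_le_tsum fun k => ?_
        have e1 : ∫⁻ x, (Ioi (dyadic k)).indicator (fun _ => b k) (N x) ∂ν =
            b k * ν {x | dyadic k < N x} :=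
          lintegral_indicator_const (hN measurableSet_Ioi) (b k)
        have e2 : ∫⁻ x, b k * (Iic (dyadic k)).indicator (fun s => (s / dyadic k) ^ 2) (N x) ∂ν =
            b k * ∫⁻ x in {x | N x ≤ dyadic k}, (N x / dyadic k) ^ 2 ∂ν := by
          have hset : MeasurableSet {x | N x ≤ dyadic k} := hN measurableSet_Iic
          rw [lintegral_const_mul _ (hm₂ k), ← lintegral_indicator hset]
          rfl
        rw [e1, e2, ← mul_add, mul_left_comm]
        gcongr
        exact h _ (dyadic_ne_zero k) (dyadic_ne_top k)
    _ = C * (∫⁻ x, ∑' k, (Ioi (dyadic k)).indicator (fun _ => b k) (N x) ∂ν +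
          ∫⁻ x, ∑' k, b k *
            (Iic (dyadic k)).indicator (fun s => (s / dyadic k) ^ 2) (N x) ∂ν) := by
        rw [ENNReal.tsum_mul_left, ENNReal.tsum_add, lintegral_tsum fun k => (hm₁ k).aemeasurable,
          lintegral_tsum fun k => ((hm₂ k).const_mul (b k)).aemeasurable]
    _ ≤ C * (∫⁻ x, K₁ * extendPhi Φ (N x) ∂ν + ∫⁻ x, K₂ * extendPhi Φ (N x) ∂ν) := by
        gcongr with x x
        · exact h₁ _
        · exact h₂ _
    _ = _ := by
        rw [lintegral_const_mul _ hφN, lintegral_const_mul _ hφN, ← add_mul, mul_assoc]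

/-- This turns a modular constant into a norm constant: Q = q^j compensates K once j is large. -/
lemma AssumptionA.exists_div_two_pow_le (hμ : 0 < μ) (hΦ : AssumptionA n μ Φ) {K : ℝ≥0∞}
    (hK : K ≠ ⊤) : ∃ j : ℕ, ∃ Q : ℝ≥0∞, Q ≠ ⊤ ∧ Q * K ≤ 1 ∧
      ∀ s, extendPhi Φ (s / 2 ^ j) ≤ Q * extendPhi Φ s := by
  obtain ⟨q, hq0, hq1, hq⟩ := hΦ.exists_half_le hμ
  have hhalf : ∀ s, extendPhi Φ (s / 2) ≤ ENNReal.ofReal q * extendPhi Φ s := by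
    intro s
    rcases eq_zero_or_top_or_ofReal s with rfl | rfl | ⟨r, hr, rfl⟩
    · simp [extendPhi_zero]
    · rw [extendPhi_top, ENNReal.mul_top (ENNReal.ofReal_pos.2 hq0).ne']
      exact le_top
    · rw [show (2 : ℝ≥0∞) = ENNReal.ofReal 2 by norm_num, ← ENNReal.ofReal_div_of_pos two_pos,
        extendPhi_ofReal Φ hr, extendPhi_ofReal Φ (by positivity), ← ENNReal.ofReal_mul hq0.le]
      exact ENNReal.ofReal_le_ofReal (hq r hr)
  have hpow : ∀ (j : ℕ) (s : ℝ≥0∞),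
      extendPhi Φ (s / 2 ^ j) ≤ ENNReal.ofReal q ^ j * extendPhi Φ s := by
    intro j
    induction j with
    | zero => simp
    | succ j ih =>
      intro s
      have e : s / 2 ^ (j + 1) = s / 2 ^ j / 2 := by
        rw [pow_succ, div_eq_mul_inv, ENNReal.mul_inv (by simp) (by simp), ← mul_assoc,
          ← div_eq_mul_inv, ← div_eq_mul_inv]
      rw [e, pow_succ', mul_assoc]
      exact (hhalf _).trans (by gcongr; exact ih s)
  have hlim : Tendsto (fun j : ℕ => ENNReal.ofReal q ^ j * K) atTop (𝓝 (0 * K)) :=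
    ENNReal.Tendsto.mul_const
      (ENNReal.tendsto_pow_atTop_nhds_zero_of_lt_one (ENNReal.ofReal_lt_one.2 hq1)) (Or.inr hK)
  rw [zero_mul] at hlim
  obtain ⟨j, hj⟩ := (hlim.eventually_le_const zero_lt_one).exists
  exact ⟨j, _, by finiteness, hj, hpow j⟩

end Orlicz

/-! ### The comparison for every elliptic coefficient matrix -/

section AreaMaximal

variable {n : ℕ} {Ω : Set (Fin n → ℝ)} {A : (Fin n → ℝ) → Matrix (Fin n) (Fin n) ℂ}

lemma areaFn_eq_zero (hΩ : IsOpen Ω) (hT : heatSemigroup Ω A = 0) (f : L2 Ω) :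
    areaFn A f = 0 := by
  funext x
  rw [areaFn_eq_rpow, areaFn_sq]
  have h : ∀ t, localEnergy (weakGrad (heatSemigroup Ω A (t ^ 2) f)) (t, x) = 0 := by
    intro t
    have e : heatSemigroup Ω A (t ^ 2) f = 0 := by rw [hT]; rfl
    rw [e, weakGrad_zero hΩ, localEnergy]
    have h0 := ae_mono (Measure.restrict_mono (inter_subset_left (s := Ω)
      (t := Metric.ball x t)) (le_refl volume))
      (Lp.coeFn_zero (EuclideanSpace ℂ (Fin n)) 2 (volume.restrict Ω))
    rw [lintegral_congr_ae (g := fun _ => 0)]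
    · simp
    · filter_upwards [h0] with y hy
      rw [hy]
      simp
  simp [h]

/-- The good-`λ` inequality between the area function and the maximal function, whether or not
the semigroup exists. -/
lemma exists_volume_lt_areaFn_le {δ : ℝ} (hΩ : IsStronglyLipschitzDomain Ω)
    (hA : IsElliptic δ A) (hδ : 0 < δ) :
    ∃ C : ℝ≥0∞, C ≠ ⊤ ∧ ∀ f : L2 Ω, AEMeasurable (areaFn A f) (volume.restrict Ω) ∧
      ∀ Λ : ℝ≥0∞, Λ ≠ 0 → Λ ≠ ⊤ → volume.restrict Ω {x | Λ < areaFn A f x} ≤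
        C * (volume.restrict Ω {x | Λ < maximalFn A f x} +
          ∫⁻ x in {x | maximalFn A f x ≤ Λ}, (maximalFn A f x / Λ) ^ 2 ∂(volume.restrict Ω)) := by
  -- If no semigroup existed, `heatSemigroup` would take its default value 0 and the area function
  -- would vanish; generation therefore need not be proved.
  by_cases h : ∃ T : ℝ → L2 Ω →L[ℂ] L2 Ω,
      IsSemigroupGeneratedByNeg (IsDivFormOperator A (sobolevW0 Ω)) T
  · have hT : IsSemigroupGeneratedByNeg (IsDivFormOperator A (sobolevW0 Ω))
        (heatSemigroup Ω A) := by
      rw [heatSemigroup, dif_pos h]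
      exact h.choose_spec
    obtain ⟨C, hC, hle⟩ := volume_lt_areaFn_le hΩ hA hδ hT
    refine ⟨C, hC, fun f => ⟨aemeasurable_areaFn hΩ.isOpen hA hδ hT f Ω, fun Λ hΛ0 hΛ => ?_⟩⟩
    refine (hle f Λ hΛ0 hΛ).trans (le_of_eq ?_)
    have hN : MeasurableSet {x | maximalFn A f x ≤ Λ} := measurable_maximalFn f measurableSet_Iic
    rw [Measure.restrict_restrict hN, inter_comm, div_eq_mul_inv,
      ← lintegral_mul_const _ ((measurable_maximalFn f).pow_const 2)]
    congr 2
    refine lintegral_congr fun x => ?_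
    rw [div_eq_mul_inv, mul_pow, ENNReal.inv_pow]
  · have hT : heatSemigroup Ω A = 0 := by rw [heatSemigroup, dif_neg h]
    refine ⟨0, ENNReal.zero_ne_top, fun f => ?_⟩
    rw [areaFn_eq_zero hΩ.isOpen hT]
    exact ⟨aemeasurable_const, fun Λ _ _ => by simp⟩

end AreaMaximal

end OrliczHardy
end

/-! ### From the modular inequality to the Luxemburg norm -/

theorem proposition3p2 {n : ℕ} (Ω : Set (Fin n → ℝ)) (hΩ : OrliczHardy.IsStronglyLipschitzDomain Ω)
    (A : (Fin n → ℝ) → Matrix (Fin n) (Fin n) ℂ)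
    (hA : ∃ δ : ℝ, 0 < δ ∧ δ ≤ 1 ∧ OrliczHardy.IsElliptic δ A)
    (μ : ℝ) (hμ0 : 0 < μ) (hμ1 : μ ≤ 1)
    (hG : OrliczHardy.HasGaussianProperty (OrliczHardy.heatSemigroup Ω A) (Metric.ediam Ω) μ)
    (Φ : ℝ → ℝ) (hΦ : OrliczHardy.AssumptionA n μ Φ) :
    ∃ C : ℝ≥0, 0 < C ∧ ∀ f : OrliczHardy.L2 Ω, OrliczHardy.MemHardy Φ A f →
      OrliczHardy.MemOrlicz Φ Ω (OrliczHardy.areaFn A f) ∧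
      OrliczHardy.orliczNorm Φ Ω (OrliczHardy.areaFn A f) ≤ C * OrliczHardy.hardyNorm Φ A f := by
  obtain ⟨δ, hδ, -, hA⟩ := hA
  obtain ⟨C, hC, hle⟩ := OrliczHardy.exists_volume_lt_areaFn_le hΩ hA hδ
  obtain ⟨K, hK, hint⟩ := hΦ.exists_lintegral_le hμ0 (volume.restrict Ω) hC
  obtain ⟨j, Q, hQ, hQK, hscale⟩ := hΦ.exists_div_two_pow_le hμ0 hK
  have key : ∀ (f : OrliczHardy.L2 Ω) (l : ℝ), 0 < l →
      ∫⁻ x in Ω, OrliczHardy.extendPhi Φ (OrliczHardy.areaFn A f x / ENNReal.ofReal l) ≤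
        K * ∫⁻ x in Ω, OrliczHardy.extendPhi Φ
          (OrliczHardy.maximalFn A f x / ENNReal.ofReal l) := by
    intro f l hl
    obtain ⟨hS, hSN⟩ := hle f
    have hL0 : ENNReal.ofReal l ≠ 0 := (ENNReal.ofReal_pos.2 hl).ne'
    have hLt : ENNReal.ofReal l ≠ ⊤ := ENNReal.ofReal_ne_top
    refine hint _ _ (hS.div_const _) ((OrliczHardy.measurable_maximalFn f).div_const _)
      fun Λ hΛ0 hΛ => ?_
    -- The level-set inequality is homogeneous, so for S / l and N / l at level Λ it is the original
    -- one at level Λl.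
    have h := hSN (Λ * ENNReal.ofReal l) (mul_ne_zero hΛ0 hL0) (ENNReal.mul_ne_top hΛ hLt)
    simp only [ENNReal.lt_div_iff_mul_lt (Or.inl hL0) (Or.inl hLt),
      ENNReal.div_le_iff_le_mul (Or.inl hL0) (Or.inl hLt)]
    convert h using 6 with x
    rw [mul_comm, div_eq_mul_inv, div_eq_mul_inv, div_eq_mul_inv,
      ENNReal.mul_inv (Or.inl hL0) (Or.inl hLt), mul_assoc]
  -- The norm constant is 2^j: if l is admissible for the maximal function, then 2^j l is admissible
  -- for the area function, because ∫ Φ(S / (2^j l)) ≤ QK ≤ 1.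
  refine ⟨2 ^ j, by positivity, fun f hf => ⟨⟨(hle f).1, ?_⟩, ?_⟩⟩
  · have h := key f 1 one_pos
    simp only [ENNReal.ofReal_one, div_one] at h
    exact h.trans_lt (ENNReal.mul_lt_top hK.lt_top hf.2)
  · have h2 : (((2 ^ j : ℝ≥0) : ℝ≥0∞)) = 2 ^ j := by push_cast; rfl
    rw [h2, mul_comm, ← ENNReal.div_le_iff_le_mul (Or.inl (by simp)) (Or.inl (by simp))]
    refine le_iInf₂ fun l hl => ?_
    rw [ENNReal.div_le_iff_le_mul (Or.inl (by simp)) (Or.inl (by simp))]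
    have h2l : ENNReal.ofReal (l * 2 ^ j) = ENNReal.ofReal l * 2 ^ j := by
      rw [ENNReal.ofReal_mul hl.1.le, ENNReal.ofReal_pow two_pos.le]
      norm_num
    rw [← h2l]
    have hL0 : ENNReal.ofReal l ≠ 0 := (ENNReal.ofReal_pos.2 hl.1).ne'
    have hLt : ENNReal.ofReal l ≠ ⊤ := ENNReal.ofReal_ne_top
    refine iInf₂_le (l * 2 ^ j) ⟨by have := hl.1; positivity, ?_⟩
    calc ∫⁻ x in Ω, OrliczHardy.extendPhi Φ
          (OrliczHardy.areaFn A f x / ENNReal.ofReal (l * 2 ^ j))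
        ≤ ∫⁻ x in Ω, Q * OrliczHardy.extendPhi Φ
            (OrliczHardy.areaFn A f x / ENNReal.ofReal l) := by
          refine lintegral_mono fun x => ?_
          refine le_of_eq_of_le ?_ (hscale _)
          rw [h2l, div_eq_mul_inv, ENNReal.mul_inv (Or.inl hL0) (Or.inl hLt), ← mul_assoc,
            ← div_eq_mul_inv, ← div_eq_mul_inv]
      _ = Q * ∫⁻ x in Ω, OrliczHardy.extendPhi Φ
            (OrliczHardy.areaFn A f x / ENNReal.ofReal l) := lintegral_const_mul' _ _ hQ
      _ ≤ Q * (K * 1) := by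
          gcongr
          exact (key f l hl.1).trans (by gcongr; exact hl.2)
      _ ≤ 1 := by rwa [mul_one]
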